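/- For an integer $n\ge 2$ let $\Delta_G=\sum_{i=1}^n\partial_{x_i}^2+|x|^2\,\partial_u^2$ be the Grushin operator on $\mathbb R^n_x\times\mathbb R_u$, equipped with Lebesgue measure. Let $p_h$ ($h>0$) be its heat kernel, i.e. the integral kernel of $e^{h\Delta_G}$. Concretely, $p_h(g,g')$ is the function that is smooth in $(h,g,g')\in(0,\infty)\times(\mathbb R^{n}\times\mathbb R)^2$, nonnegative, solves $\partial_h p_h(g,g')=\Delta_{G}p_h(\cdot,g')(g)$, and satisfies $\int p_h(g,g')\,dg'\le 1$ and $\int p_h(g,g')f(g')\,dg'\to f(g)$ as $h\to0^+$ for every $g$ and every continuous compactly supported $f$. Let the Green function be $$(-\Delta_G)^{-1}(g,g')=\int_0^{\infty}p_h(g,g')\,dh .$$ For $g=(x,u)$ and $g'=(x',u')$ put $s=|u-u'|$, $R^2=|x|^2+|x'|^2$, $$D_K(g,g')=\big(R^4+(2s)^2\big)^{1/4},\qquad d_K(g,g')=\Big(\sqrt{R^4+(2s)^2}-2\,x\cdot x'\Big)^{1/2}.$$ Then there is a constant $A>1$, independent of $n$, such that for every $n\ge2$ the heat kernel exists, and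 for all $g\ne g'$ in $\mathbb R^n\times\mathbb R$ the integral defining $(-\Delta_G)^{-1}(g,g')$ converges and $$A^{-1}\;\le\;\frac{(-\Delta_G)^{-1}(g,g')}{\dfrac{\Gamma(n/2)}{4\pi^{n/2+1}}\;d_K(g,g')^{-n}\;n^{-1/2}\;\dfrac{d_K(g,g')}{D_K(g,g')}}\;\le\;A .$$ -/

import Mathlib

open MeasureTheory Set Filter Topology
open scoped ContDiff

noncomputable section

namespace Grushin

/-- The space `ℝⁿ × ℝ` of points `g = (x, u)`, with Lebesgue measure `dg = dx du` as its volume. -/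
abbrev Space (n : ℕ) : Type := EuclideanSpace ℝ (Fin n) × ℝ

/-- The Grushin operator `Δ_G f = ∑ᵢ ∂²f/∂xᵢ² + |x|² ∂²f/∂u²`. -/
def grushinOp (n : ℕ) (f : Space n → ℝ) (g : Space n) : ℝ :=
  (∑ i : Fin n, iteratedDeriv 2 (fun t : ℝ => f (g.1 + t • EuclideanSpace.single i (1 : ℝ), g.2)) 0)
    + ‖g.1‖ ^ 2 * iteratedDeriv 2 (fun t : ℝ => f (g.1, t)) g.2

/-- `p h g g'` (for `h > 0`) is the heat kernel of the Grushin operator, the integral kernel of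
`exp (h Δ_G)`: a smooth, nonnegative, sub-Markovian fundamental solution of the heat equation
`∂ₕ p = Δ_G p`. The values of `p` at `h ≤ 0` carry no meaning. -/
structure IsHeatKernel (n : ℕ) (p : ℝ → Space n → Space n → ℝ) : Prop where
  /-- `p` is jointly smooth on `(0, ∞) × ℝⁿ⁺¹ × ℝⁿ⁺¹`. -/
  smooth : ContDiffOn ℝ ∞ (fun q : ℝ × Space n × Space n => p q.1 q.2.1 q.2.2)
    (Ioi (0 : ℝ) ×ˢ (univ : Set (Space n × Space n)))
  nonneg : ∀ h : ℝ, 0 < h → ∀ g g' : Space n, 0 ≤ p h g g'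
  /-- The heat equation in `(h, g)`, for each `g'`. -/
  heat_eq : ∀ h : ℝ, 0 < h → ∀ g g' : Space n,
    deriv (fun t : ℝ => p t g g') h = grushinOp n (fun y : Space n => p h y g') g
  integrable : ∀ h : ℝ, 0 < h → ∀ g : Space n, Integrable (fun g' : Space n => p h g g')
  mass_le_one : ∀ h : ℝ, 0 < h → ∀ g : Space n, ∫ g' : Space n, p h g g' ≤ 1
  /-- `p h g ·` tends to the Dirac mass at `g` as `h → 0+`. -/
  initial : ∀ f : Space n → ℝ, Continuous f → HasCompactSupport f → ∀ g : Space n,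
    Tendsto (fun h : ℝ => ∫ g' : Space n, p h g g' * f g') (𝓝[>] 0) (𝓝 (f g))

/-- The Green function `(-Δ_G)⁻¹(g, g') = ∫₀^∞ p_h(g, g') dh` obtained from the heat kernel `p`. -/
def green {n : ℕ} (p : ℝ → Space n → Space n → ℝ) (g g' : Space n) : ℝ :=
  ∫ h in Ioi (0 : ℝ), p h g g'

/-- `s = |u - u'|`. -/
def s {n : ℕ} (g g' : Space n) : ℝ := |g.2 - g'.2|

/-- `R² = |x|² + |x'|²`. -/
def Rsq {n : ℕ} (g g' : Space n) : ℝ := ‖g.1‖ ^ 2 + ‖g'.1‖ ^ 2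

/-- `D_K = (R⁴ + (2s)²)^{1/4}`. -/
def DK {n : ℕ} (g g' : Space n) : ℝ := (Rsq g g' ^ 2 + (2 * s g g') ^ 2) ^ (1 / 4 : ℝ)

/-- The pseudo-distance `d_K(g, g') = (√(R⁴ + (2s)²) - 2 x · x')^{1/2}`. -/
def dK {n : ℕ} (g g' : Space n) : ℝ :=
  Real.sqrt (Real.sqrt (Rsq g g' ^ 2 + (2 * s g g') ^ 2) - 2 * inner ℝ g.1 g'.1)

end Grushin

end

/-!
The heat kernel is found by separating variables. A Fourier transform in `u` turns `Δ_G` into the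
Hermite operators `Δ_x - (2πξ)² |x|²`, whose heat kernels are given by Mehler's formula. After the
substitution `τ = 4πhξ` the inverse transform is `kernel`: with `b = 1/(4h)`, `R = R²(g, g')`,
`a = x · x'` and `v = u - u'`,

  `p_h(g, g') = (b/π)^(n/2+1) ∫ (τ / sinh τ)^(n/2) exp (b Φ(τ)) dτ`,
  `Φ(τ) = -R τ coth τ + 2 a τ / sinh τ + 2 i τ v`.

That this is a heat kernel (`isHeatKernel_kernel`) is proved without semigroup theory.
* Smoothness is differentiation under the integral sign, in a class of weights that is closed under
  the factors the derivatives produce (`contDiffOn_expInt`). The heat equation reduces to the fact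
  that the integral of `d/dτ (τ · weight · exp phase)` vanishes (`expInt_weight_relation`).
* Integrated against a product test function `φ ⊗ ψ`, the kernel stays bounded and converges to
  `φ ⊗ ψ` as `h → 0`, jointly in the base point: each Mehler kernel is dominated by the Gaussian
  heat kernel, and `ψ` is recovered by Fourier inversion (`tendsto_integral_kernel_mul_tensor`).
* Everything else follows from a minimum principle for solutions bounded below, with the barrier
  `1 + |x|² + u²` (`IsSolution.neg_barrier_le`). Applied to the evolution of bumps it gives
  positivity (`kernel_nonneg`) and conservation of mass (`integral_kernel`). Applied to the
  difference of a bounded solution and the evolution of its value at an earlier time it shows that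
  bounded solutions are propagated by `kernel`, so the heat kernel is unique
  (`IsHeatKernel.eq_kernel`).

For the Green function the integral over `b` is a Gamma integral, which leaves a multiple of
`∫ (R cosh τ - 2 i s sinh τ - 2 a)^(-n/2) dτ`. With `R = D² cos θ` and `2 s = D² sin θ` the base is
`D² cosh (τ - i θ) - 2 a`, so moving the line of integration up by `θ` removes the oscillation
(`green_kernel`):

  `(-Δ_G)⁻¹(g, g') = Γ(n/2) / (4 π^(n/2+1)) ∫ (D² cosh t - 2 a)^(-n/2) dt`.

The interchange of integrals and the contour shift are carried out with an extra factor
`exp (-ε b)`, which adds `ε sinh τ / τ` to the base; it is removed by monotone convergence, as the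
kernel is nonnegative.

Finally `D² cosh t - 2 a = d² (1 + κ (cosh t - 1))` with `κ = D²/d² ≥ 1/2`. Bernoulli's inequality
bounds `∫ (1 + κ (cosh t - 1))^(-n/2) dt` above by `2π / √(n κ)`, and the contribution of
`|t| ≤ 1/√(n κ)` bounds it below by `1 / √(n κ)`. Since `1 / √(n κ) = n^(-1/2) d / D`, the constant
`A = 2π` works for every `n`.
-/

/-! ### The function `sinh z / z` -/

namespace Grushin

/-- The entire function `sinh z / z`, with value `1` at `0`. -/
noncomputable def csinhc (z : ℂ) : ℂ := dslope Complex.sinh 0 z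

/-- The restriction of `csinhc` to the real line: `sinh t / t`, with value `1` at `0`. -/
noncomputable def sinhc (t : ℝ) : ℝ := (csinhc t).re

lemma mul_csinhc (z : ℂ) : z * csinhc z = Complex.sinh z := by
  simpa [csinhc] using sub_smul_dslope Complex.sinh 0 z

lemma csinhc_zero : csinhc 0 = 1 := by
  simp [csinhc, dslope_same, (Complex.hasDerivAt_sinh 0).deriv]

lemma differentiable_csinhc : Differentiable ℂ csinhc := by
  have h := (Complex.differentiableOn_dslope (f := Complex.sinh) (c := 0) (s := univ)
    univ_mem).2 Complex.differentiable_sinh.differentiableOn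
  exact differentiableOn_univ.1 h

lemma csinhc_ofReal (t : ℝ) : csinhc t = (sinhc t : ℂ) := by
  rcases eq_or_ne t 0 with rfl | ht
  · simp [sinhc, csinhc_zero]
  · have h : csinhc t = ((Real.sinh t / t : ℝ) : ℂ) := by
      have h1 := mul_csinhc (t : ℂ)
      have ht' : (t : ℂ) ≠ 0 := by exact_mod_cast ht
      push_cast
      rw [eq_div_iff ht', mul_comm]
      exact h1
    rw [sinhc, h, Complex.ofReal_re]

lemma mul_sinhc (t : ℝ) : t * sinhc t = Real.sinh t := by
  have h := mul_csinhc (t : ℂ)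
  rw [csinhc_ofReal] at h
  exact_mod_cast h

lemma sinhc_zero : sinhc 0 = 1 := by
  simp [sinhc, csinhc_zero]

lemma sinhc_eq_div {t : ℝ} (ht : t ≠ 0) : sinhc t = Real.sinh t / t := by
  rw [← mul_sinhc]; field_simp

lemma sinhc_neg (t : ℝ) : sinhc (-t) = sinhc t := by
  rcases eq_or_ne t 0 with rfl | ht
  · simp
  · rw [sinhc_eq_div ht, sinhc_eq_div (neg_ne_zero.2 ht), Real.sinh_neg, neg_div_neg_eq]

lemma sinhc_abs (t : ℝ) : sinhc |t| = sinhc t := by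
  rcases abs_choice t with h | h <;> rw [h]
  exact sinhc_neg t

lemma differentiable_sinhc : Differentiable ℝ sinhc := fun t =>
  (differentiable_csinhc (t : ℂ)).hasDerivAt.real_of_complex.differentiableAt

lemma continuous_sinhc : Continuous sinhc := differentiable_sinhc.continuous

/-- Obtained by differentiating `t * sinhc t = sinh t`. -/
lemma mul_deriv_sinhc (t : ℝ) : t * deriv sinhc t = Real.cosh t - sinhc t := by
  have h1 : HasDerivAt (fun t => t * sinhc t) (1 * sinhc t + t * deriv sinhc t) t :=
    (hasDerivAt_id t).mul (differentiable_sinhc t).hasDerivAt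
  have h2 : (fun t => t * sinhc t) = Real.sinh := funext mul_sinhc
  rw [h2] at h1
  have := h1.unique (Real.hasDerivAt_sinh t)
  linarith

lemma one_le_sinhc (t : ℝ) : 1 ≤ sinhc t := by
  rw [← sinhc_abs]
  rcases (abs_nonneg t).eq_or_lt with h | h
  · rw [← h, sinhc_zero]
  · rw [sinhc_eq_div h.ne', le_div_iff₀ h, one_mul]
    exact Real.self_le_sinh_iff.2 h.le

lemma sinhc_pos (t : ℝ) : 0 < sinhc t := one_pos.trans_le (one_le_sinhc t)

lemma sinhc_eq_cosh_half_mul (t : ℝ) : sinhc t = Real.cosh (t / 2) * sinhc (t / 2) := by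
  rcases eq_or_ne t 0 with rfl | ht
  · simp [sinhc_zero]
  · have h2 : t / 2 ≠ 0 := by positivity
    rw [sinhc_eq_div ht, sinhc_eq_div h2]
    have h := Real.sinh_two_mul (t / 2)
    rw [show 2 * (t / 2) = t by ring] at h
    rw [h]; field_simp

lemma half_exp_le_sinhc (t : ℝ) : Real.exp (|t| / 2) / 2 ≤ sinhc t := by
  rw [sinhc_eq_cosh_half_mul]
  have h1 : Real.exp (|t| / 2) / 2 ≤ Real.cosh (t / 2) := by
    rw [← Real.cosh_abs, abs_div, abs_two, Real.cosh_eq]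
    have := Real.exp_pos (-(|t| / 2))
    linarith
  have h2 := one_le_sinhc (t / 2)
  have h3 : 0 < Real.cosh (t / 2) := Real.cosh_pos _
  nlinarith

lemma sinhc_le_cosh (t : ℝ) : sinhc t ≤ Real.cosh t := by
  have h2 : Real.cosh t = 2 * Real.cosh (t / 2) ^ 2 - 1 := by
    have h := Real.cosh_two_mul (t / 2)
    rw [show 2 * (t / 2) = t by ring] at h
    rw [h, Real.sinh_sq]; ring
  rw [← sinhc_abs, ← Real.cosh_abs]
  rcases (abs_nonneg t).eq_or_lt with h | h
  · rw [← h, sinhc_zero, Real.cosh_zero]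
  · rw [sinhc_eq_div h.ne', div_le_iff₀ h]
    generalize |t| = u at h
    -- `u cosh u - sinh u` has derivative `u sinh u ≥ 0`
    have hm : MonotoneOn (fun u : ℝ => Real.cosh u * u - Real.sinh u) (Ici 0) := by
      refine monotoneOn_of_deriv_nonneg (convex_Ici 0) (by fun_prop) (by fun_prop) ?_
      intro x hx
      have hd : HasDerivAt (fun u : ℝ => Real.cosh u * u - Real.sinh u)
          (Real.sinh x * x + Real.cosh x * 1 - Real.cosh x) x :=
        ((Real.hasDerivAt_cosh x).mul (hasDerivAt_id x)).sub (Real.hasDerivAt_sinh x)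
      rw [hd.deriv]
      simp only [interior_Ici, mem_Ioi] at hx
      have := Real.sinh_nonneg_iff.2 hx.le
      nlinarith [mul_nonneg this hx.le]
    have := hm self_mem_Ici h.le h.le
    simp at this
    linarith

lemma cosh_le_mul_sinhc (t : ℝ) : Real.cosh t ≤ (1 + |t|) * sinhc t := by
  rw [← sinhc_abs, ← Real.cosh_abs]
  have h0 := abs_nonneg t
  generalize |t| = u at h0
  have h1 := mul_sinhc u
  have h2 := Real.exp_sub_cosh u
  have h3 : Real.cosh u - Real.sinh u = Real.exp (-u) := Real.cosh_sub_sinh u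
  have h4 : Real.exp (-u) ≤ 1 := Real.exp_le_one_iff.2 (by linarith)
  have := one_le_sinhc u
  nlinarith

/-- `Re (sinh z · conj z) = t sinh t cos y + y cosh t sin y` for `z = t + i y`. -/
lemma csinhc_re_pos {t y : ℝ} (hy0 : 0 ≤ y) (hy : y ≤ Real.pi / 2) :
    0 < (csinhc (t + y * Complex.I)).re := by
  rcases eq_or_ne (t + y * Complex.I : ℂ) 0 with hz | hz
  · rw [hz, csinhc_zero]; simp
  set z : ℂ := t + y * Complex.I with hzdef
  have hre : z.re = t := by simp [hzdef]
  have him : z.im = y := by simp [hzdef]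
  have hn : 0 < Complex.normSq z := Complex.normSq_pos.2 hz
  have hsr : (Complex.sinh z).re = Real.sinh t * Real.cos y := by
    rw [hzdef, Complex.sinh_add, Complex.sinh_mul_I, Complex.cosh_mul_I]
    simp [Complex.sinh_ofReal_re, Complex.cosh_ofReal_re, Complex.sin_ofReal_re,
      Complex.cos_ofReal_re]
  have hsi : (Complex.sinh z).im = Real.cosh t * Real.sin y := by
    rw [hzdef, Complex.sinh_add, Complex.sinh_mul_I, Complex.cosh_mul_I]
    simp [Complex.sinh_ofReal_re, Complex.cosh_ofReal_re, Complex.sin_ofReal_re,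
      Complex.cos_ofReal_re]
  have hq : csinhc z = Complex.sinh z / z := by rw [← mul_csinhc]; field_simp
  rw [hq, Complex.div_re, hsr, hsi, hre, him, ← add_div]
  refine div_pos ?_ hn
  have hts : 0 ≤ Real.sinh t * t := by
    rcases le_total 0 t with h | h
    · exact mul_nonneg (Real.sinh_nonneg_iff.2 h) h
    · exact mul_nonneg_of_nonpos_of_nonpos (Real.sinh_nonpos_iff.2 h) h
  have hcos : 0 ≤ Real.cos y := Real.cos_nonneg_of_mem_Icc ⟨by linarith [Real.pi_pos], hy⟩
  rcases hy0.eq_or_lt with h | h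
  · subst h
    have ht : t ≠ 0 := by rintro rfl; simp [hzdef] at hz
    have : Real.sinh t ≠ 0 := by rwa [Ne, Real.sinh_eq_zero]
    have hne : Real.sinh t * t ≠ 0 := mul_ne_zero this ht
    simpa using lt_of_le_of_ne hts hne.symm
  · have hsin : 0 < Real.sin y := Real.sin_pos_of_pos_of_lt_pi h (by linarith [Real.pi_pos])
    have : 0 < Real.cosh t * Real.sin y * y := by
      have := Real.cosh_pos t
      positivity
    nlinarith [mul_nonneg hts hcos]

end Grushin

/-! ### Exponential integrals over the dual variable -/

namespace Grushin

/-- The phase `τ ↦ (-τ coth τ, 2 τ / sinh τ, 2 i τ)`, as a linear form in the parameters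
`(α, β, σ)`. -/
noncomputable def phase (τ : ℝ) (v : ℝ × ℝ × ℝ) : ℂ :=
  (-(Real.cosh τ / sinhc τ) : ℝ) * (v.1 : ℂ) + (2 / sinhc τ : ℝ) * (v.2.1 : ℂ)
    + 2 * τ * Complex.I * (v.2.2 : ℂ)

/-- The first coefficient of `phase`. -/
noncomputable def coef1 (τ : ℝ) : ℂ := (-(Real.cosh τ / sinhc τ) : ℝ)

/-- The second coefficient of `phase`. -/
noncomputable def coef2 (τ : ℝ) : ℂ := (2 / sinhc τ : ℝ)

/-- The third coefficient of `phase`. -/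
noncomputable def coef3 (τ : ℝ) : ℂ := 2 * τ * Complex.I

/-- Weights that, together with all their polynomial multiples, are integrable against
`exp (|τ|/8)`. The exponential factor leaves room for slightly negative `α`. -/
def Admissible (w : ℝ → ℂ) : Prop :=
  Continuous w ∧ ∀ N : ℕ, Integrable fun τ : ℝ => (1 + |τ|) ^ N * Real.exp (|τ| / 8) * ‖w τ‖

/-- The exponential integral `∫ w(τ) exp (phase τ v) dτ`. -/
noncomputable def expInt (w : ℝ → ℂ) (v : ℝ × ℝ × ℝ) : ℂ :=
  ∫ τ : ℝ, w τ * Complex.exp (phase τ v)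

lemma continuous_coef1 : Continuous coef1 := by
  unfold coef1
  have := continuous_sinhc
  exact Complex.continuous_ofReal.comp
    ((Real.continuous_cosh.div continuous_sinhc fun t => (sinhc_pos t).ne').neg)

lemma continuous_coef2 : Continuous coef2 := by
  unfold coef2
  exact Complex.continuous_ofReal.comp
    (continuous_const.div continuous_sinhc fun t => (sinhc_pos t).ne')

lemma continuous_coef3 : Continuous coef3 := by unfold coef3; fun_prop

lemma cosh_div_sinhc_le (τ : ℝ) : Real.cosh τ / sinhc τ ≤ 1 + |τ| :=
  (div_le_iff₀ (sinhc_pos τ)).2 (cosh_le_mul_sinhc τ)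

lemma one_le_cosh_div_sinhc (τ : ℝ) : 1 ≤ Real.cosh τ / sinhc τ :=
  (one_le_div (sinhc_pos τ)).2 (sinhc_le_cosh τ)

lemma norm_coef1_le (τ : ℝ) : ‖coef1 τ‖ ≤ 2 * (1 + |τ|) := by
  have h1 := one_le_cosh_div_sinhc τ
  have h2 := cosh_div_sinhc_le τ
  rw [coef1, Complex.norm_real, norm_neg, Real.norm_of_nonneg (by linarith)]
  linarith

lemma norm_coef2_le (τ : ℝ) : ‖coef2 τ‖ ≤ 2 * (1 + |τ|) := by
  have h1 := sinhc_pos τ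
  rw [coef2, Complex.norm_real, Real.norm_of_nonneg (by positivity), div_le_iff₀ h1]
  nlinarith [one_le_sinhc τ, abs_nonneg τ]

lemma norm_coef3_le (τ : ℝ) : ‖coef3 τ‖ ≤ 2 * (1 + |τ|) := by
  simp [coef3]

lemma Admissible.mul {w c : ℝ → ℂ} (hw : Admissible w) (hc : Continuous c)
    (hb : ∀ τ, ‖c τ‖ ≤ 2 * (1 + |τ|)) : Admissible fun τ => w τ * c τ := by
  refine ⟨hw.1.mul hc, fun N => ?_⟩
  have hcw := hw.1
  refine Integrable.mono' ((hw.2 (N + 1)).const_mul 2) (by fun_prop) (.of_forall fun τ => ?_)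
  rw [norm_mul, norm_norm, Real.norm_of_nonneg (by positivity), norm_mul]
  calc (1 + |τ|) ^ N * Real.exp (|τ| / 8) * (‖w τ‖ * ‖c τ‖)
      ≤ (1 + |τ|) ^ N * Real.exp (|τ| / 8) * (‖w τ‖ * (2 * (1 + |τ|))) := by
        gcongr; exact hb τ
    _ = _ := by ring

lemma Admissible.mul_coef1 {w : ℝ → ℂ} (hw : Admissible w) : Admissible fun τ => w τ * coef1 τ :=
  hw.mul continuous_coef1 norm_coef1_le

lemma Admissible.mul_coef2 {w : ℝ → ℂ} (hw : Admissible w) : Admissible fun τ => w τ * coef2 τ :=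
  hw.mul continuous_coef2 norm_coef2_le

lemma Admissible.mul_coef3 {w : ℝ → ℂ} (hw : Admissible w) : Admissible fun τ => w τ * coef3 τ :=
  hw.mul continuous_coef3 norm_coef3_le

lemma Admissible.integrable {w : ℝ → ℂ} (hw : Admissible w) : Integrable w := by
  refine Integrable.mono' (hw.2 0) hw.1.aestronglyMeasurable (.of_forall fun τ => ?_)
  have : 1 ≤ Real.exp (|τ| / 8) := Real.one_le_exp (by positivity)
  simpa using le_mul_of_one_le_left (norm_nonneg (w τ)) this

lemma phase_eq (τ : ℝ) (v : ℝ × ℝ × ℝ) :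
    phase τ v = coef1 τ * v.1 + coef2 τ * v.2.1 + coef3 τ * v.2.2 := rfl

lemma continuous_phase (v : ℝ × ℝ × ℝ) : Continuous fun τ => phase τ v := by
  simp only [phase_eq]
  have h1 := continuous_coef1
  have h2 := continuous_coef2
  have h3 := continuous_coef3
  fun_prop

lemma phase_re (τ : ℝ) (v : ℝ × ℝ × ℝ) :
    (phase τ v).re = -(Real.cosh τ / sinhc τ) * v.1 + 2 / sinhc τ * v.2.1 := by
  simp [phase, -Complex.ofReal_div, -Complex.ofReal_neg, -Complex.ofReal_cosh]

/-- The phase as a continuous linear map in the parameters. -/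
noncomputable def phaseCLM (τ : ℝ) : ℝ × ℝ × ℝ →L[ℝ] ℂ :=
  (ContinuousLinearMap.fst ℝ ℝ (ℝ × ℝ)).smulRight (coef1 τ)
    + ((ContinuousLinearMap.fst ℝ ℝ ℝ).comp
        (ContinuousLinearMap.snd ℝ ℝ (ℝ × ℝ))).smulRight (coef2 τ)
    + ((ContinuousLinearMap.snd ℝ ℝ ℝ).comp
        (ContinuousLinearMap.snd ℝ ℝ (ℝ × ℝ))).smulRight (coef3 τ)

lemma phaseCLM_apply (τ : ℝ) (v : ℝ × ℝ × ℝ) : phaseCLM τ v = phase τ v := by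
  simp [phaseCLM, phase_eq, mul_comm]

lemma hasFDerivAt_phase (τ : ℝ) (v : ℝ × ℝ × ℝ) : HasFDerivAt (phase τ) (phaseCLM τ) v := by
  have : phase τ = phaseCLM τ := funext fun v => (phaseCLM_apply τ v).symm
  rw [this]
  exact (phaseCLM τ).hasFDerivAt

lemma norm_phaseCLM_le (τ : ℝ) : ‖phaseCLM τ‖ ≤ 6 * (1 + |τ|) := by
  refine ContinuousLinearMap.opNorm_le_bound _ (by positivity) fun v => ?_
  rw [phaseCLM_apply, phase_eq]
  have h1 : ‖v.1‖ ≤ ‖v‖ := norm_fst_le v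
  have h2 : ‖v.2.1‖ ≤ ‖v‖ := (norm_fst_le v.2).trans (norm_snd_le v)
  have h3 : ‖v.2.2‖ ≤ ‖v‖ := (norm_snd_le v.2).trans (norm_snd_le v)
  have e1 := norm_coef1_le τ
  have e2 := norm_coef2_le τ
  have e3 := norm_coef3_le τ
  calc ‖coef1 τ * v.1 + coef2 τ * v.2.1 + coef3 τ * v.2.2‖
      ≤ ‖coef1 τ‖ * ‖v.1‖ + ‖coef2 τ‖ * ‖v.2.1‖ + ‖coef3 τ‖ * ‖v.2.2‖ := by
        refine (norm_add₃_le).trans ?_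
        simp only [norm_mul, Complex.norm_real]; rfl
    _ ≤ 2 * (1 + |τ|) * ‖v‖ + 2 * (1 + |τ|) * ‖v‖ + 2 * (1 + |τ|) * ‖v‖ := by gcongr
    _ = _ := by ring

/-- The parameter domain on which exponential integrals with admissible weights converge. It is
an open neighbourhood of the half space `α ≥ 0` where the heat kernel lives. -/
def paramDomain : Set (ℝ × ℝ × ℝ) := {v | -(1 / 8) < v.1}

lemma isOpen_paramDomain : IsOpen paramDomain := isOpen_lt continuous_const continuous_fst

lemma norm_exp_phase_le {v : ℝ × ℝ × ℝ} (hv : v ∈ paramDomain) {B : ℝ} (hB : |v.2.1| ≤ B)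
    (τ : ℝ) : ‖Complex.exp (phase τ v)‖ ≤ Real.exp (1 / 8 + 2 * B) * Real.exp (|τ| / 8) := by
  rw [Complex.norm_exp, ← Real.exp_add, phase_re]
  refine Real.exp_le_exp.2 ?_
  have h1 := one_le_cosh_div_sinhc τ
  have h2 := cosh_div_sinhc_le τ
  have h3 : 2 / sinhc τ * v.2.1 ≤ 2 * B := by
    have h4 : 2 / sinhc τ ≤ 2 := div_le_self (by norm_num) (one_le_sinhc τ)
    have h5 : 0 < 2 / sinhc τ := div_pos two_pos (sinhc_pos τ)
    calc 2 / sinhc τ * v.2.1 ≤ 2 / sinhc τ * B := by gcongr; exact (le_abs_self _).trans hB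
      _ ≤ 2 * B := by
        have : 0 ≤ B := (abs_nonneg _).trans hB
        gcongr
  have h6 : -(1 / 8) < v.1 := hv
  nlinarith

lemma Admissible.integrable_mul_exp {w : ℝ → ℂ} (hw : Admissible w) {v : ℝ × ℝ × ℝ}
    (hv : v ∈ paramDomain) : Integrable fun τ => w τ * Complex.exp (phase τ v) := by
  refine Integrable.mono' ((hw.2 0).const_mul (Real.exp (1 / 8 + 2 * |v.2.1|))) ?_
    (.of_forall fun τ => ?_)
  · exact (hw.1.mul (Complex.continuous_exp.comp (continuous_phase v))).aestronglyMeasurable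
  · have := norm_exp_phase_le hv le_rfl τ
    rw [norm_mul]
    calc _ ≤ ‖w τ‖ * (Real.exp (1 / 8 + 2 * |v.2.1|) * Real.exp (|τ| / 8)) := by gcongr
      _ = _ := by ring

/-- Differentiation under the integral sign: the partial derivatives of an exponential integral
are the exponential integrals with weights multiplied by the coefficients of the phase. -/
lemma hasFDerivAt_expInt {w : ℝ → ℂ} (hw : Admissible w) {v : ℝ × ℝ × ℝ} (hv : v ∈ paramDomain) :
    HasFDerivAt (expInt w)
      ((ContinuousLinearMap.fst ℝ ℝ (ℝ × ℝ)).smulRight (expInt (fun τ => w τ * coef1 τ) v)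
      + ((ContinuousLinearMap.fst ℝ ℝ ℝ).comp
          (ContinuousLinearMap.snd ℝ ℝ (ℝ × ℝ))).smulRight (expInt (fun τ => w τ * coef2 τ) v)
      + ((ContinuousLinearMap.snd ℝ ℝ ℝ).comp
          (ContinuousLinearMap.snd ℝ ℝ (ℝ × ℝ))).smulRight (expInt (fun τ => w τ * coef3 τ) v))
      v := by
  have hcont : ∀ v, Continuous fun τ => w τ * Complex.exp (phase τ v) := fun v =>
    hw.1.mul (Complex.continuous_exp.comp (continuous_phase v))
  have hCLM : Continuous phaseCLM := by
    unfold phaseCLM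
    have h1 := continuous_coef1
    have h2 := continuous_coef2
    have h3 := continuous_coef3
    refine (Continuous.add ?_ ?_).add ?_
    · exact (ContinuousLinearMap.smulRightL ℝ (ℝ × ℝ × ℝ) ℂ _).continuous.comp h1
    · exact (ContinuousLinearMap.smulRightL ℝ (ℝ × ℝ × ℝ) ℂ _).continuous.comp h2
    · exact (ContinuousLinearMap.smulRightL ℝ (ℝ × ℝ × ℝ) ℂ _).continuous.comp h3
  let F' : ℝ × ℝ × ℝ → ℝ → (ℝ × ℝ × ℝ →L[ℝ] ℂ) :=
    fun v τ => (w τ * Complex.exp (phase τ v)) • phaseCLM τ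
  have hs : paramDomain ∩ {v' | |v'.2.1| < |v.2.1| + 1} ∈ 𝓝 v :=
    (isOpen_paramDomain.inter (isOpen_lt (by fun_prop) continuous_const)).mem_nhds
      ⟨hv, by simp⟩
  have hbound : ∀ τ, ∀ x ∈ paramDomain ∩ {v' | |v'.2.1| < |v.2.1| + 1},
      ‖F' x τ‖ ≤ 6 * Real.exp (1 / 8 + 2 * (|v.2.1| + 1)) *
        ((1 + |τ|) ^ 1 * Real.exp (|τ| / 8) * ‖w τ‖) := by
    rintro τ x ⟨hx1, hx2⟩
    have h1 := norm_exp_phase_le hx1 (le_of_lt hx2) τ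
    have h2 := norm_phaseCLM_le τ
    simp only [F', norm_smul, norm_mul]
    calc _ ≤ ‖w τ‖ * (Real.exp (1 / 8 + 2 * (|v.2.1| + 1)) * Real.exp (|τ| / 8))
          * (6 * (1 + |τ|)) := by gcongr
      _ = _ := by ring
  have hF'cont : Continuous (F' v) := (hcont v).smul hCLM
  have hint : Integrable (F' v) := by
    refine Integrable.mono' ((hw.2 1).const_mul (6 * Real.exp (1 / 8 + 2 * (|v.2.1| + 1))))
      hF'cont.aestronglyMeasurable (.of_forall fun τ => ?_)
    exact hbound τ v ⟨hv, by simp⟩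
  have key := hasFDerivAt_integral_of_dominated_of_fderiv_le (μ := volume) (𝕜 := ℝ)
    (F := fun v τ => w τ * Complex.exp (phase τ v)) (F' := F') (x₀ := v) hs
    (.of_forall fun x => (hcont x).aestronglyMeasurable) (hw.integrable_mul_exp hv)
    hF'cont.aestronglyMeasurable (.of_forall hbound) ((hw.2 1).const_mul _)
    (.of_forall fun τ x _ => by
      have h := ((hasFDerivAt_phase τ x).cexp).const_mul (w τ)
      simpa [F', mul_smul] using h)
  refine key.congr_fderiv ?_
  refine ContinuousLinearMap.ext fun y => ?_
  have i1 := hw.mul_coef1.integrable_mul_exp hv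
  have i2 := hw.mul_coef2.integrable_mul_exp hv
  have i3 := hw.mul_coef3.integrable_mul_exp hv
  have i12 : Integrable fun τ => (y.1 : ℂ) * (w τ * coef1 τ * Complex.exp (phase τ v))
      + y.2.1 * (w τ * coef2 τ * Complex.exp (phase τ v)) := (i1.const_mul _).add (i2.const_mul _)
  rw [ContinuousLinearMap.integral_apply hint]
  simp only [F', smul_apply, phaseCLM_apply, expInt, add_apply, ContinuousLinearMap.smulRight_apply,
    ContinuousLinearMap.comp_apply, ContinuousLinearMap.coe_fst', ContinuousLinearMap.coe_snd',
    Complex.real_smul, smul_eq_mul]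
  rw [← integral_const_mul, ← integral_const_mul, ← integral_const_mul,
    ← integral_add (i1.const_mul _) (i2.const_mul _), ← integral_add i12 (i3.const_mul _)]
  refine integral_congr_ae (.of_forall fun τ => ?_)
  simp only [phase_eq]
  ring

/-- By induction, since the partial derivatives of an exponential integral are again exponential
integrals with admissible weights. -/
lemma contDiffOn_expInt {w : ℝ → ℂ} (hw : Admissible w) :
    ContDiffOn ℝ ∞ (expInt w) paramDomain := by
  rw [contDiffOn_infty]
  intro m
  induction m generalizing w with
  | zero =>
    exact contDiffOn_zero.2 fun v hv =>
      (hasFDerivAt_expInt hw hv).continuousAt.continuousWithinAt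
  | succ m ih =>
    rw [Nat.cast_succ]
    refine (contDiffOn_succ_iff_fderiv_of_isOpen isOpen_paramDomain).2 ⟨fun v hv =>
      (hasFDerivAt_expInt hw hv).differentiableAt.differentiableWithinAt, by simp, ?_⟩
    refine ContDiffOn.congr ?_ fun v hv => (hasFDerivAt_expInt hw hv).fderiv
    have h1 := ih hw.mul_coef1
    have h2 := ih hw.mul_coef2
    have h3 := ih hw.mul_coef3
    exact ((contDiffOn_const.smulRight h1).add (contDiffOn_const.smulRight h2)).add
      (contDiffOn_const.smulRight h3)

/-- The chain rule for exponential integrals along a curve of parameters. -/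
lemma hasDerivAt_expInt_comp {w : ℝ → ℂ} (hw : Admissible w) {α β σ : ℝ → ℝ} {α' β' σ' t : ℝ}
    (hα : HasDerivAt α α' t) (hβ : HasDerivAt β β' t) (hσ : HasDerivAt σ σ' t) (ht : 0 ≤ α t) :
    HasDerivAt (fun t => expInt w (α t, β t, σ t))
      (α' * expInt (fun τ => w τ * coef1 τ) (α t, β t, σ t)
        + β' * expInt (fun τ => w τ * coef2 τ) (α t, β t, σ t)
        + σ' * expInt (fun τ => w τ * coef3 τ) (α t, β t, σ t)) t := by
  have hmem : (α t, β t, σ t) ∈ paramDomain := by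
    show -(1 / 8) < α t
    linarith
  have h := (hasFDerivAt_expInt hw hmem).comp_hasDerivAt t (hα.prodMk (hβ.prodMk hσ))
  simpa [Function.comp_def] using h

end Grushin

/-! ### The kernel and the heat equation -/

namespace Grushin

/-- The weight `(sinh τ / τ) ^ (-n/2)`. -/
noncomputable def weight (n : ℕ) (τ : ℝ) : ℝ := sinhc τ ^ (-((n : ℝ) / 2))

/-- The Mehler–Fourier formula for the heat kernel, with `b = 1 / (4 h)`. -/
noncomputable def kernel (n : ℕ) (h : ℝ) (g g' : Space n) : ℝ :=
  ((4 * h)⁻¹ / Real.pi) ^ ((n : ℝ) / 2 + 1) *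
    (expInt (fun τ => (weight n τ : ℂ)) ((4 * h)⁻¹ * Rsq g g', (4 * h)⁻¹ * inner ℝ g.1 g'.1,
      (4 * h)⁻¹ * (g.2 - g'.2))).re

lemma weight_pos (n : ℕ) (τ : ℝ) : 0 < weight n τ := Real.rpow_pos_of_pos (sinhc_pos τ) _

lemma continuous_weight (n : ℕ) : Continuous (weight n) :=
  continuous_sinhc.rpow_const fun τ => Or.inl (sinhc_pos τ).ne'

lemma weight_le_one (n : ℕ) (τ : ℝ) : weight n τ ≤ 1 :=
  Real.rpow_le_one_of_one_le_of_nonpos (one_le_sinhc τ) (by simp; positivity)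

lemma weight_le_exp {n : ℕ} (hn : 2 ≤ n) (τ : ℝ) : weight n τ ≤ 2 * Real.exp (-(|τ| / 2)) := by
  have h1 : weight n τ ≤ sinhc τ ^ (-1 : ℝ) := by
    refine Real.rpow_le_rpow_of_exponent_le (one_le_sinhc τ) ?_
    have : (2 : ℝ) ≤ n := by exact_mod_cast hn
    linarith
  refine h1.trans ?_
  rw [Real.rpow_neg_one, Real.exp_neg]
  have h2 := half_exp_le_sinhc τ
  calc (sinhc τ)⁻¹ ≤ (Real.exp (|τ| / 2) / 2)⁻¹ := inv_anti₀ (by positivity) h2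
    _ = _ := by rw [inv_div]; rfl

lemma integrable_exp_neg_abs_div_four : Integrable fun τ : ℝ => Real.exp (-(|τ| / 4)) := by
  refine Integrable.mono' (integrable_inv_one_add_sq.const_mul 32) (by fun_prop)
    (.of_forall fun τ => ?_)
  have h := Real.quadratic_le_exp_of_nonneg (show 0 ≤ |τ| / 4 by positivity)
  rw [Real.norm_of_nonneg (Real.exp_pos _).le, Real.exp_neg, ← div_eq_mul_inv,
    inv_le_comm₀ (Real.exp_pos _) (by positivity), inv_div]
  refine le_trans ?_ h
  rw [div_pow, sq_abs]
  have := abs_nonneg τ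
  linarith

lemma admissible_weight {n : ℕ} (hn : 2 ≤ n) : Admissible fun τ => (weight n τ : ℂ) := by
  refine ⟨Complex.continuous_ofReal.comp (continuous_weight n), fun N => ?_⟩
  have hw := continuous_weight n
  refine Integrable.mono' (integrable_exp_neg_abs_div_four.const_mul
    (2 * N.factorial * 8 ^ N * Real.exp (1 / 8))) (by fun_prop) (.of_forall fun τ => ?_)
  have h1 := weight_le_exp hn τ
  have h0 := (weight_pos n τ).le
  have h2 : (1 + |τ|) ^ N ≤ N.factorial * 8 ^ N * Real.exp ((1 + |τ|) / 8) := by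
    have h := Real.pow_div_factorial_le_exp ((1 + |τ|) / 8) (by positivity) N
    rw [div_pow, div_div, div_le_iff₀ (by positivity)] at h
    linarith
  rw [Complex.norm_real, norm_mul, norm_norm, Real.norm_of_nonneg (weight_pos n τ).le,
    Real.norm_of_nonneg (by positivity)]
  calc (1 + |τ|) ^ N * Real.exp (|τ| / 8) * weight n τ
      ≤ N.factorial * 8 ^ N * Real.exp ((1 + |τ|) / 8) * Real.exp (|τ| / 8)
          * (2 * Real.exp (-(|τ| / 2))) := by gcongr
    _ = 2 * N.factorial * 8 ^ N *
          (Real.exp ((1 + |τ|) / 8) * Real.exp (|τ| / 8) * Real.exp (-(|τ| / 2))) := by ring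
    _ = 2 * N.factorial * 8 ^ N * (Real.exp (1 / 8) * Real.exp (-(|τ| / 4))) := by
        rw [← Real.exp_add, ← Real.exp_add, ← Real.exp_add]
        congr 2; ring
    _ = _ := by ring

lemma Rsq_nonneg {n : ℕ} (g g' : Space n) : 0 ≤ Rsq g g' := by unfold Rsq; positivity

lemma contDiffOn_kernel {n : ℕ} (hn : 2 ≤ n) :
    ContDiffOn ℝ ∞ (fun q : ℝ × Space n × Space n => kernel n q.1 q.2.1 q.2.2)
      (Ioi (0 : ℝ) ×ˢ (univ : Set (Space n × Space n))) := by
  have hb : ContDiffOn ℝ ∞ (fun q : ℝ × Space n × Space n => (4 * q.1)⁻¹)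
      (Ioi (0 : ℝ) ×ˢ (univ : Set (Space n × Space n))) := by
    refine ContDiffOn.inv (by fun_prop) ?_
    rintro q ⟨hq, -⟩
    have : (0 : ℝ) < q.1 := hq
    positivity
  have hR : ContDiff ℝ ∞ fun q : ℝ × Space n × Space n => Rsq q.2.1 q.2.2 := by
    unfold Rsq
    exact ((contDiff_fst.comp (contDiff_fst.comp contDiff_snd)).norm_sq ℝ).add
      ((contDiff_fst.comp (contDiff_snd.comp contDiff_snd)).norm_sq ℝ)
  have ha : ContDiff ℝ ∞ fun q : ℝ × Space n × Space n => inner ℝ q.2.1.1 q.2.2.1 :=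
    (contDiff_fst.comp (contDiff_fst.comp contDiff_snd)).inner ℝ
      (contDiff_fst.comp (contDiff_snd.comp contDiff_snd))
  have hσ : ContDiff ℝ ∞ fun q : ℝ × Space n × Space n => q.2.1.2 - q.2.2.2 := by fun_prop
  unfold kernel
  refine ContDiffOn.mul ?_ ?_
  · refine (hb.div_const _).rpow_const_of_ne ?_
    rintro q ⟨hq, -⟩
    have : (0 : ℝ) < q.1 := hq
    have := Real.pi_pos
    positivity
  · refine Complex.reCLM.contDiff.comp_contDiffOn ((contDiffOn_expInt (admissible_weight hn)).comp
      ((hb.mul hR.contDiffOn).prodMk ((hb.mul ha.contDiffOn).prodMk (hb.mul hσ.contDiffOn))) ?_)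
    rintro q ⟨hq, -⟩
    have h1 : (0 : ℝ) < q.1 := hq
    have h2 : 0 ≤ (4 * q.1)⁻¹ * Rsq q.2.1 q.2.2 := mul_nonneg (by positivity) (Rsq_nonneg _ _)
    show -(1 / 8) < (4 * q.1)⁻¹ * Rsq q.2.1 q.2.2
    linarith

/-- Integrating `d/dτ (τ · weight · exp phase)` over the line gives the linear relation between
exponential integrals that encodes the heat equation. -/
lemma expInt_weight_relation {n : ℕ} (hn : 2 ≤ n) {α β σ : ℝ} (hα : 0 ≤ α) :
    let w : ℝ → ℂ := fun τ => (weight n τ : ℂ)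
    let v : ℝ × ℝ × ℝ := (α, β, σ)
    expInt w v + (n / 2 : ℝ) * (expInt w v + expInt (fun τ => w τ * coef1 τ) v)
      + α * (expInt (fun τ => w τ * coef1 τ) v
        + 1 / 4 * expInt (fun τ => w τ * coef2 τ * coef2 τ) v)
      + β * (expInt (fun τ => w τ * coef2 τ) v + expInt (fun τ => w τ * coef1 τ * coef2 τ) v)
      + σ * expInt (fun τ => w τ * coef3 τ) v = 0 := by
  intro w v
  have hw : Admissible w := admissible_weight hn
  have hv : v ∈ paramDomain := by
    show -(1 / 8) < α
    linarith
  have i0 := hw.integrable_mul_exp hv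
  have i1 := hw.mul_coef1.integrable_mul_exp hv
  have i2 := hw.mul_coef2.integrable_mul_exp hv
  have i3 := hw.mul_coef3.integrable_mul_exp hv
  have i12 := hw.mul_coef1.mul_coef2.integrable_mul_exp hv
  have i22 := hw.mul_coef2.mul_coef2.integrable_mul_exp hv
  have hder : ∀ τ : ℝ, HasDerivAt (fun τ : ℝ => (τ : ℂ) * (w τ * Complex.exp (phase τ v)))
      (w τ * Complex.exp (phase τ v)
        + (n / 2 : ℝ) * (w τ * Complex.exp (phase τ v) + w τ * coef1 τ * Complex.exp (phase τ v))
        + α * (w τ * coef1 τ * Complex.exp (phase τ v)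
          + 1 / 4 * (w τ * coef2 τ * coef2 τ * Complex.exp (phase τ v)))
        + β * (w τ * coef2 τ * Complex.exp (phase τ v)
          + w τ * coef1 τ * coef2 τ * Complex.exp (phase τ v))
        + σ * (w τ * coef3 τ * Complex.exp (phase τ v))) τ := by
    intro τ
    have hS := sinhc_pos τ
    have hdS := (differentiable_sinhc τ).hasDerivAt
    have e1 : HasDerivAt (fun τ : ℝ => coef1 τ) _ τ :=
      (((Real.hasDerivAt_cosh τ).div hdS hS.ne').neg).ofReal_comp
    have e2 : HasDerivAt (fun τ : ℝ => coef2 τ) _ τ :=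
      ((hasDerivAt_const τ (2 : ℝ)).div hdS hS.ne').ofReal_comp
    have e3 : HasDerivAt (fun τ : ℝ => coef3 τ) (2 * 1 * Complex.I) τ :=
      (((hasDerivAt_id τ).ofReal_comp).const_mul (2 : ℂ)).mul_const Complex.I
    have ew : HasDerivAt w _ τ :=
      (hdS.rpow_const (p := -((n : ℝ) / 2)) (Or.inl hS.ne')).ofReal_comp
    have ep : HasDerivAt (fun τ : ℝ => phase τ v) _ τ :=
      ((e1.mul_const (α : ℂ)).add (e2.mul_const (β : ℂ))).add (e3.mul_const (σ : ℂ))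
    have et : HasDerivAt (fun τ : ℝ => (τ : ℂ)) 1 τ := (hasDerivAt_id τ).ofReal_comp
    refine (et.mul (ew.mul ep.cexp)).congr_deriv ?_
    have hd := mul_deriv_sinhc τ
    have hm := mul_sinhc τ
    have hcs := Real.cosh_sq τ
    simp only [Pi.mul_apply, Real.rpow_sub_one hS.ne', w, weight, coef1, coef2, coef3]
    have hdc : (τ : ℂ) * (deriv sinhc τ : ℝ) = (Real.cosh τ : ℝ) - (sinhc τ : ℝ) := by
      exact_mod_cast hd
    have hmc : (Real.sinh τ : ℝ) = (τ : ℂ) * (sinhc τ : ℝ) := by exact_mod_cast hm.symm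
    have hcsc : ((Real.cosh τ : ℝ) : ℂ) ^ 2 = ((Real.sinh τ : ℝ) : ℂ) ^ 2 + 1 := by
      exact_mod_cast hcs
    have hSc : ((sinhc τ : ℝ) : ℂ) ≠ 0 := by exact_mod_cast hS.ne'
    generalize Complex.exp (phase τ v) = E
    generalize hW : sinhc τ ^ (-((n : ℝ) / 2)) = W
    generalize hc : Real.cosh τ = c at *
    generalize hs : Real.sinh τ = sh at *
    generalize hS' : deriv sinhc τ = S' at *
    generalize hSS : sinhc τ = S at *
    clear hd hm hcs ew e1 e2 e3 ep et hdS
    push_cast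
    rw [hmc] at hcsc ⊢
    field_simp
    linear_combination (-4 * S * W * E * n + 8 * W * E * c * α - 16 * W * E * β) * hdc
      + 8 * α * W * E * hcsc
  have j1 : Integrable fun τ => ((n / 2 : ℝ) : ℂ) * (w τ * Complex.exp (phase τ v)
      + w τ * coef1 τ * Complex.exp (phase τ v)) := (i0.add i1).const_mul _
  have j2 : Integrable fun τ => (α : ℂ) * (w τ * coef1 τ * Complex.exp (phase τ v)
      + 1 / 4 * (w τ * coef2 τ * coef2 τ * Complex.exp (phase τ v))) :=
    (i1.add (i22.const_mul _)).const_mul _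
  have j3 : Integrable fun τ => (β : ℂ) * (w τ * coef2 τ * Complex.exp (phase τ v)
      + w τ * coef1 τ * coef2 τ * Complex.exp (phase τ v)) := (i2.add i12).const_mul _
  have j4 : Integrable fun τ => (σ : ℂ) * (w τ * coef3 τ * Complex.exp (phase τ v)) :=
    i3.const_mul _
  have k1 := i0.add j1
  have k2 := k1.add j2
  have k3 := k2.add j3
  simp only [Pi.add_def] at k1 k2 k3
  have hint := integral_eq_zero_of_hasDerivAt_of_integrable hder
    (k3.add j4) (by
    have h : Integrable fun τ : ℝ => (1 / (2 * Complex.I)) *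
        (w τ * coef3 τ * Complex.exp (phase τ v)) := i3.const_mul _
    refine h.congr (.of_forall fun τ => ?_)
    simp only [coef3]
    field_simp)
  rw [integral_add k3 j4, integral_add k2 j3, integral_add k1 j2, integral_add i0 j1,
    integral_const_mul, integral_const_mul, integral_const_mul, integral_const_mul,
    integral_add i0 i1, integral_add i1 (i22.const_mul _), integral_add i2 i12,
    integral_const_mul] at hint
  exact hint

/-- The identity `(2τ / sinh τ)² = 4 (τ coth τ)² + (2iτ)²`, integrated. -/
lemma expInt_coef_relation {w : ℝ → ℂ} (hw : Admissible w) {v : ℝ × ℝ × ℝ}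
    (hv : v ∈ paramDomain) :
    expInt (fun τ => w τ * coef2 τ * coef2 τ) v
      = 4 * expInt (fun τ => w τ * coef1 τ * coef1 τ) v
        + expInt (fun τ => w τ * coef3 τ * coef3 τ) v := by
  have i11 := hw.mul_coef1.mul_coef1.integrable_mul_exp hv
  have i33 := hw.mul_coef3.mul_coef3.integrable_mul_exp hv
  unfold expInt
  rw [← integral_const_mul, ← integral_add (i11.const_mul _) i33]
  refine integral_congr_ae (.of_forall fun τ => ?_)
  have hS : (sinhc τ : ℂ) ≠ 0 := by exact_mod_cast (sinhc_pos τ).ne'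
  have h : coef2 τ * coef2 τ = 4 * (coef1 τ * coef1 τ) + coef3 τ * coef3 τ := by
    have hm : (Real.sinh τ : ℝ) = (τ : ℂ) * (sinhc τ : ℝ) := by exact_mod_cast (mul_sinhc τ).symm
    have hc : ((Real.cosh τ : ℝ) : ℂ) ^ 2 = ((Real.sinh τ : ℝ) : ℂ) ^ 2 + 1 := by
      exact_mod_cast Real.cosh_sq τ
    simp only [coef1, coef2, coef3]
    generalize Real.cosh τ = c at *
    push_cast
    field_simp
    rw [hm] at hc
    linear_combination -4 * hc - 4 * (τ : ℂ) ^ 2 * (sinhc τ : ℂ) ^ 2 * Complex.I_sq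
  simp only
  linear_combination (w τ * Complex.exp (phase τ v)) * h

lemma Rsq_line {n : ℕ} (g g' : Space n) (i : Fin n) (t : ℝ) :
    Rsq (g.1 + t • EuclideanSpace.single i (1 : ℝ), g.2) g'
      = Rsq g g' + (2 * g.1 i * t + t ^ 2) := by
  simp only [Rsq, norm_add_sq_real, inner_smul_right, EuclideanSpace.inner_single_right, norm_smul,
    PiLp.norm_single]
  simp
  ring

lemma inner_line {n : ℕ} (g g' : Space n) (i : Fin n) (t : ℝ) :
    inner ℝ (g.1 + t • EuclideanSpace.single i (1 : ℝ)) g'.1 = inner ℝ g.1 g'.1 + g'.1 i * t := by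
  simp [inner_add_left, inner_smul_left, EuclideanSpace.inner_single_left, mul_comm]

/-- Both sides are combinations of exponential integrals with coefficients polynomial in `b`, `x`,
`x'` and `u - u'`; they agree by the two relations between these integrals. -/
lemma kernel_heat_eq {n : ℕ} (hn : 2 ≤ n) {h : ℝ} (hh : 0 < h) (g g' : Space n) :
    deriv (fun t : ℝ => kernel n t g g') h
      = grushinOp n (fun y : Space n => kernel n h y g') g := by
  have hw := admissible_weight hn
  set w : ℝ → ℂ := fun τ => (weight n τ : ℂ) with hwdef
  set b : ℝ := (4 * h)⁻¹ with hb
  have hbpos : 0 < b := by positivity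
  set R := Rsq g g' with hR
  have hR0 : 0 ≤ R := Rsq_nonneg g g'
  set a : ℝ := inner ℝ g.1 g'.1 with ha
  set σ : ℝ := g.2 - g'.2 with hσ
  set v : ℝ × ℝ × ℝ := (b * R, b * a, b * σ) with hv
  have hα0 : 0 ≤ b * R := mul_nonneg hbpos.le hR0
  have hvmem : v ∈ paramDomain := by
    show -(1 / 8) < b * R
    linarith
  set C : ℝ := (b / Real.pi) ^ ((n : ℝ) / 2 + 1) with hC
  have hbπ : b / Real.pi ≠ 0 := by have := Real.pi_pos; positivity
  -- the time derivative
  have hdb : HasDerivAt (fun t : ℝ => (4 * t)⁻¹) (-(4 * b ^ 2)) h := by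
    have h1 : HasDerivAt (fun t : ℝ => 4 * t) (4 * 1) h := (hasDerivAt_id h).const_mul 4
    refine (h1.fun_inv (by positivity)).congr_deriv ?_
    rw [hb]; field_simp
  have hdC : HasDerivAt (fun t : ℝ => ((4 * t)⁻¹ / Real.pi) ^ ((n : ℝ) / 2 + 1))
      (-(4 * b * ((n : ℝ) / 2 + 1) * C)) h := by
    refine ((hdb.div_const Real.pi).rpow_const (Or.inl hbπ)).congr_deriv ?_
    rw [← hb, Real.rpow_sub_one hbπ, ← hC]
    field_simp
  have hdt : HasDerivAt (fun t : ℝ => kernel n t g g')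
      (-(4 * b * ((n : ℝ) / 2 + 1) * C) * (expInt w v).re
        + C * ((-(4 * b ^ 2) * R) * (expInt (fun τ => w τ * coef1 τ) v).re
          + (-(4 * b ^ 2) * a) * (expInt (fun τ => w τ * coef2 τ) v).re
          + (-(4 * b ^ 2) * σ) * (expInt (fun τ => w τ * coef3 τ) v).re)) h := by
    have h1 := hasDerivAt_expInt_comp hw (hdb.mul_const R) (hdb.mul_const a) (hdb.mul_const σ) hα0
    have h2 := Complex.reCLM.hasFDerivAt.comp_hasDerivAt h h1
    refine (hdC.mul h2).congr_deriv ?_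
    simp only [Complex.reCLM_apply, Complex.add_re, Complex.re_ofReal_mul, Function.comp_apply,
      ← hb, ← hv, ← hC]
  -- the second derivatives in the `x` directions
  have hdx : ∀ i : Fin n,
      iteratedDeriv 2
          (fun t : ℝ => kernel n h (g.1 + t • EuclideanSpace.single i (1 : ℝ), g.2) g') 0
        = C * (2 * b * (expInt (fun τ => w τ * coef1 τ) v).re
          + 4 * b ^ 2 * (expInt (fun τ => w τ * coef1 τ * coef1 τ) v).re * (g.1 i * g.1 i)
          + 4 * b ^ 2 * (expInt (fun τ => w τ * coef1 τ * coef2 τ) v).re * (g.1 i * g'.1 i)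
          + b ^ 2 * (expInt (fun τ => w τ * coef2 τ * coef2 τ) v).re * (g'.1 i * g'.1 i)) := by
    intro i
    have hα : ∀ t, HasDerivAt (fun t => b * (R + (2 * g.1 i * t + t ^ 2)))
        (b * (2 * g.1 i + 2 * t)) t := fun t => by
      have := ((((hasDerivAt_id t).const_mul (2 * g.1 i)).add (hasDerivAt_pow 2 t)).const_add
        R).const_mul b
      refine this.congr_deriv ?_
      simp
    have hβ : ∀ t, HasDerivAt (fun t => b * (a + g'.1 i * t)) (b * g'.1 i) t := fun t => by
      have := (((hasDerivAt_id t).const_mul (g'.1 i)).const_add a).const_mul b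
      refine this.congr_deriv ?_
      simp
    have hαnn : ∀ t, 0 ≤ b * (R + (2 * g.1 i * t + t ^ 2)) := fun t => by
      rw [hR, ← Rsq_line]
      exact mul_nonneg hbpos.le (Rsq_nonneg _ _)
    have hf : (fun t : ℝ => kernel n h (g.1 + t • EuclideanSpace.single i (1 : ℝ), g.2) g')
        = fun t : ℝ => C * (expInt w (b * (R + (2 * g.1 i * t + t ^ 2)), b * (a + g'.1 i * t),
            b * σ)).re := by
      funext t
      simp only [kernel, Rsq_line, inner_line]
      rfl
    have hE : ∀ {w : ℝ → ℂ}, Admissible w → ∀ t, HasDerivAt (fun t : ℝ =>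
        (expInt w (b * (R + (2 * g.1 i * t + t ^ 2)), b * (a + g'.1 i * t), b * σ)).re)
        (b * (2 * g.1 i + 2 * t) * (expInt (fun τ => w τ * coef1 τ)
          (b * (R + (2 * g.1 i * t + t ^ 2)), b * (a + g'.1 i * t), b * σ)).re
          + b * g'.1 i * (expInt (fun τ => w τ * coef2 τ)
          (b * (R + (2 * g.1 i * t + t ^ 2)), b * (a + g'.1 i * t), b * σ)).re) t := by
      intro w hw t
      have h1 := hasDerivAt_expInt_comp hw (hα t) (hβ t) (hasDerivAt_const t (b * σ)) (hαnn t)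
      refine (Complex.reCLM.hasFDerivAt.comp_hasDerivAt t h1).congr_deriv ?_
      simp only [Complex.reCLM_apply, Complex.add_re, Complex.re_ofReal_mul]
      simp
    rw [hf, iteratedDeriv_succ, iteratedDeriv_one,
      funext fun t => ((hE hw t).const_mul C).deriv]
    have hlin : HasDerivAt (fun t : ℝ => b * (2 * g.1 i + 2 * t)) (2 * b) 0 := by
      have := (((hasDerivAt_id (0 : ℝ)).const_mul 2).const_add (2 * g.1 i)).const_mul b
      refine this.congr_deriv ?_
      ring
    have hfin := ((hlin.mul (hE hw.mul_coef1 0)).add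
      ((hE hw.mul_coef2 0).const_mul (b * g'.1 i))).const_mul C
    have h21 : (fun τ => w τ * coef2 τ * coef1 τ) = fun τ => w τ * coef1 τ * coef2 τ := by
      funext τ; ring
    refine hfin.deriv.trans ?_
    simp only [h21, mul_zero, add_zero, zero_pow two_ne_zero, ← hv]
    ring
  -- the second derivative in `u`
  have hdu : iteratedDeriv 2 (fun t : ℝ => kernel n h (g.1, t) g') g.2
      = C * (b ^ 2 * (expInt (fun τ => w τ * coef3 τ * coef3 τ) v).re) := by
    have hσ' : ∀ t, HasDerivAt (fun t => b * (t - g'.2)) b t := fun t => by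
      simpa using ((hasDerivAt_id t).sub_const g'.2).const_mul b
    have hf : (fun t : ℝ => kernel n h (g.1, t) g')
        = fun t : ℝ => C * (expInt w (b * R, b * a, b * (t - g'.2))).re := by
      funext t
      rfl
    have hE : ∀ {w : ℝ → ℂ}, Admissible w → ∀ t, HasDerivAt (fun t : ℝ =>
        (expInt w (b * R, b * a, b * (t - g'.2))).re)
        (b * (expInt (fun τ => w τ * coef3 τ) (b * R, b * a, b * (t - g'.2))).re) t := by
      intro w hw t
      have h1 := hasDerivAt_expInt_comp hw (hasDerivAt_const t (b * R)) (hasDerivAt_const t (b * a))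
        (hσ' t) hα0
      refine (Complex.reCLM.hasFDerivAt.comp_hasDerivAt t h1).congr_deriv ?_
      simp only [Complex.reCLM_apply, Complex.add_re, Complex.re_ofReal_mul]
      simp
    rw [hf, iteratedDeriv_succ, iteratedDeriv_one,
      funext fun t => ((hE hw t).const_mul C).deriv]
    refine (((hE hw.mul_coef3 g.2).const_mul b).const_mul C).deriv.trans ?_
    rw [← hv]
    ring
  have hxx : ∑ i, g.1 i * g.1 i = ‖g.1‖ ^ 2 := by
    rw [EuclideanSpace.real_norm_sq_eq]
    exact Finset.sum_congr rfl fun i _ => (sq _).symm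
  have hyy : ∑ i, g'.1 i * g'.1 i = ‖g'.1‖ ^ 2 := by
    rw [EuclideanSpace.real_norm_sq_eq]
    exact Finset.sum_congr rfl fun i _ => (sq _).symm
  have hxy : ∑ i, g.1 i * g'.1 i = a := by
    rw [ha, PiLp.inner_apply]
    exact Finset.sum_congr rfl fun i _ => by simp [mul_comm]
  rw [hdt.deriv, grushinOp, Finset.sum_congr rfl fun i _ => hdx i, hdu, ← Finset.mul_sum,
    Finset.sum_add_distrib, Finset.sum_add_distrib, Finset.sum_add_distrib, ← Finset.mul_sum,
    ← Finset.mul_sum, ← Finset.mul_sum, ← Finset.mul_sum, hxx, hyy, hxy]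
  have hrel := congrArg Complex.re (expInt_weight_relation hn (β := b * a) (σ := b * σ) hα0)
  have hrel2 := congrArg Complex.re (expInt_coef_relation hw hvmem)
  simp only [Complex.add_re, Complex.re_ofReal_mul, Complex.zero_re, ← hwdef, ← hv] at hrel hrel2
  rw [show (1 / 4 : ℂ) = ((1 / 4 : ℝ) : ℂ) by push_cast; rfl, Complex.re_ofReal_mul] at hrel
  rw [show (4 : ℂ) = ((4 : ℝ) : ℂ) by push_cast; rfl, Complex.re_ofReal_mul] at hrel2
  have hRdef : R = ‖g.1‖ ^ 2 + ‖g'.1‖ ^ 2 := rfl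
  simp only [Finset.sum_const, Finset.card_univ, Fintype.card_fin, nsmul_eq_mul]
  rw [hRdef] at hrel ⊢
  linear_combination (-4 * b * C) * hrel + C * b ^ 2 * ‖g.1‖ ^ 2 * hrel2

end Grushin

/-! ### Solutions of the heat equation and the minimum principle -/

namespace Grushin

/-- A smooth solution of the Grushin heat equation `∂ₕ v = Δ_G v` on `(0, ∞) × ℝⁿ⁺¹`. -/
def IsSolution (n : ℕ) (v : ℝ → Space n → ℝ) : Prop :=
  ContDiffOn ℝ ∞ (fun q : ℝ × Space n => v q.1 q.2) (Ioi 0 ×ˢ univ) ∧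
    ∀ h : ℝ, 0 < h → ∀ g : Space n, deriv (fun t => v t g) h = grushinOp n (v h) g

/-- The barrier `1 + |x|² + u²`, which satisfies `Δ_G ψ ≤ (2n + 2) ψ`. -/
noncomputable def barrier {n : ℕ} (g : Space n) : ℝ := 1 + ‖g.1‖ ^ 2 + g.2 ^ 2

lemma IsSolution.contDiff {n : ℕ} {v : ℝ → Space n → ℝ} (hv : IsSolution n v) {h : ℝ}
    (hh : 0 < h) : ContDiff ℝ ∞ (v h) := by
  rw [← contDiffOn_univ]
  exact hv.1.comp (contDiffOn_const.prodMk contDiffOn_id) fun g _ => ⟨hh, mem_univ _⟩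

lemma IsSolution.differentiableAt {n : ℕ} {v : ℝ → Space n → ℝ} (hv : IsSolution n v) {h : ℝ}
    (hh : 0 < h) (g : Space n) : DifferentiableAt ℝ (fun t => v t g) h := by
  have h1 : ContDiffOn ℝ ∞ (fun t => v t g) (Ioi 0) :=
    hv.1.comp (contDiffOn_id.prodMk contDiffOn_const) fun t ht => ⟨ht, mem_univ _⟩
  exact (h1.contDiffAt (Ioi_mem_nhds hh)).differentiableAt (by simp)

lemma contDiff_line_fst {n : ℕ} {f : Space n → ℝ} (hf : ContDiff ℝ ∞ f) (g : Space n)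
    (e : EuclideanSpace ℝ (Fin n)) : ContDiff ℝ ∞ fun t : ℝ => f (g.1 + t • e, g.2) :=
  hf.comp (by fun_prop)

lemma contDiff_line_snd {n : ℕ} {f : Space n → ℝ} (hf : ContDiff ℝ ∞ f) (g : Space n) :
    ContDiff ℝ ∞ fun t : ℝ => f (g.1, t) :=
  hf.comp (by fun_prop)

lemma iteratedDeriv_two_linComb {f₁ f₂ : ℝ → ℝ} (h₁ : ContDiff ℝ ∞ f₁) (h₂ : ContDiff ℝ ∞ f₂)
    (c d t : ℝ) : iteratedDeriv 2 (fun t => c * f₁ t + d * f₂ t) t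
      = c * iteratedDeriv 2 f₁ t + d * iteratedDeriv 2 f₂ t := by
  have d₁ := h₁.differentiable (by simp)
  have d₂ := h₂.differentiable (by simp)
  have dd₁ : Differentiable ℝ (deriv f₁) :=
    ((contDiff_infty_iff_deriv.1 h₁).2).differentiable (by simp)
  have dd₂ : Differentiable ℝ (deriv f₂) :=
    ((contDiff_infty_iff_deriv.1 h₂).2).differentiable (by simp)
  simp only [iteratedDeriv_succ, iteratedDeriv_zero]
  have e : (deriv fun t => c * f₁ t + d * f₂ t) = fun t => c * deriv f₁ t + d * deriv f₂ t :=
    funext fun t => (((d₁ t).hasDerivAt.const_mul c).add ((d₂ t).hasDerivAt.const_mul d)).deriv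
  rw [e]
  exact (((dd₁ t).hasDerivAt.const_mul c).add ((dd₂ t).hasDerivAt.const_mul d)).deriv

lemma grushinOp_linComb {n : ℕ} {f₁ f₂ : Space n → ℝ} (h₁ : ContDiff ℝ ∞ f₁)
    (h₂ : ContDiff ℝ ∞ f₂) (c d : ℝ) (g : Space n) :
    grushinOp n (fun y => c * f₁ y + d * f₂ y) g = c * grushinOp n f₁ g + d * grushinOp n f₂ g := by
  unfold grushinOp
  rw [iteratedDeriv_two_linComb (contDiff_line_snd h₁ g) (contDiff_line_snd h₂ g),
    Finset.sum_congr rfl fun i _ => iteratedDeriv_two_linComb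
      (contDiff_line_fst h₁ g (EuclideanSpace.single i 1))
      (contDiff_line_fst h₂ g (EuclideanSpace.single i 1)) c d 0,
    Finset.sum_add_distrib, ← Finset.mul_sum, ← Finset.mul_sum]
  ring

lemma IsSolution.linComb {n : ℕ} {v w : ℝ → Space n → ℝ} (hv : IsSolution n v)
    (hw : IsSolution n w) (c d : ℝ) : IsSolution n fun t g => c * v t g + d * w t g := by
  refine ⟨(contDiffOn_const.mul hv.1).add (contDiffOn_const.mul hw.1), fun h hh g => ?_⟩
  rw [grushinOp_linComb (hv.contDiff hh) (hw.contDiff hh), ← hv.2 h hh, ← hw.2 h hh]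
  exact (((hv.differentiableAt hh g).hasDerivAt.const_mul c).add
    ((hw.differentiableAt hh g).hasDerivAt.const_mul d)).deriv

lemma isSolution_const (n : ℕ) (c : ℝ) : IsSolution n fun _ _ => c := by
  refine ⟨contDiffOn_const, fun h _ g => ?_⟩
  simp [grushinOp, iteratedDeriv_const]

lemma IsSolution.shift {n : ℕ} {v : ℝ → Space n → ℝ} (hv : IsSolution n v) {e : ℝ} (he : 0 ≤ e) :
    IsSolution n fun t => v (e + t) := by
  refine ⟨?_, fun h hh g => ?_⟩
  · refine hv.1.comp (f := fun q : ℝ × Space n => (e + q.1, q.2)) (by fun_prop) ?_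
    rintro q ⟨hq, -⟩
    have h1 : (0 : ℝ) < q.1 := hq
    exact ⟨show (0 : ℝ) < e + q.1 by linarith, mem_univ _⟩
  · rw [← hv.2 _ (by linarith), deriv_comp_const_add (f := fun t => v t g)]

lemma contDiff_barrier (n : ℕ) : ContDiff ℝ ∞ (barrier (n := n)) := by
  unfold barrier
  exact (contDiff_const.add (contDiff_fst.norm_sq ℝ)).add (contDiff_snd.pow 2)

lemma one_le_barrier {n : ℕ} (g : Space n) : 1 ≤ barrier g := by
  unfold barrier; nlinarith [sq_nonneg ‖g.1‖, sq_nonneg g.2]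

lemma norm_sq_le_barrier {n : ℕ} (g : Space n) : ‖g‖ ^ 2 ≤ barrier g := by
  unfold barrier
  rcases max_choice ‖g.1‖ ‖g.2‖ with h | h <;> rw [Prod.norm_def, h]
  · nlinarith [sq_nonneg g.2]
  · rw [Real.norm_eq_abs, sq_abs]; nlinarith [sq_nonneg ‖g.1‖]

lemma grushinOp_barrier {n : ℕ} (g : Space n) :
    grushinOp n barrier g = 2 * n + 2 * ‖g.1‖ ^ 2 := by
  have hq : ∀ A B t : ℝ, iteratedDeriv 2 (fun t : ℝ => A + (B * t + t ^ 2)) t = 2 := by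
    intro A B t
    have h1 : ∀ t : ℝ, HasDerivAt (fun t : ℝ => A + (B * t + t ^ 2)) (B + 2 * t) t := fun t => by
      have := (((hasDerivAt_id t).const_mul B).add (hasDerivAt_pow 2 t)).const_add A
      refine this.congr_deriv ?_
      simp
    have h2 : HasDerivAt (fun t : ℝ => B + 2 * t) 2 t := by
      simpa using ((hasDerivAt_id t).const_mul 2).const_add B
    simp only [iteratedDeriv_succ, iteratedDeriv_zero]
    rw [funext fun t => (h1 t).deriv, h2.deriv]
  have hx : ∀ i : Fin n, (fun t : ℝ => barrier (g.1 + t • EuclideanSpace.single i (1 : ℝ), g.2))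
      = fun t => barrier g + (2 * g.1 i * t + t ^ 2) := by
    intro i
    funext t
    have := Rsq_line g (0 : Space n) i t
    simp only [Rsq, Prod.fst_zero, norm_zero] at this
    simp only [barrier]
    linarith
  have hu : (fun t : ℝ => barrier (g.1, t)) = fun t => (1 + ‖g.1‖ ^ 2) + (0 * t + t ^ 2) := by
    funext t
    simp [barrier]
  unfold grushinOp
  simp only [hx, hu, hq]
  simp
  ring

lemma iteratedDeriv_two_nonneg_of_isLocalMin {f : ℝ → ℝ} {t : ℝ} (hf : Continuous f)
    (h : IsLocalMin f t) : 0 ≤ iteratedDeriv 2 f t := by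
  rw [iteratedDeriv_succ, iteratedDeriv_one]
  by_contra! hneg
  have hmax := isLocalMax_of_deriv_deriv_neg hneg h.deriv_eq_zero hf.continuousAt
  -- a point that is both a local minimum and a local maximum has zero second derivative
  have hc : f =ᶠ[𝓝 t] fun _ => f t := by
    filter_upwards [h, hmax] with s h1 h2 using le_antisymm h2 h1
  have hd : deriv f =ᶠ[𝓝 t] deriv fun _ => f t := hc.deriv
  rw [hd.deriv_eq] at hneg
  simp at hneg

lemma grushinOp_nonneg_of_forall_le {n : ℕ} {f : Space n → ℝ} (hf : Continuous f) {g : Space n}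
    (h : ∀ y, f g ≤ f y) : 0 ≤ grushinOp n f g := by
  unfold grushinOp
  refine add_nonneg (Finset.sum_nonneg fun i _ => ?_) (mul_nonneg (by positivity) ?_)
  · refine iteratedDeriv_two_nonneg_of_isLocalMin (by fun_prop) (.of_forall fun t => ?_)
    simpa using h _
  · exact iteratedDeriv_two_nonneg_of_isLocalMin (by fun_prop) (.of_forall fun t => h _)

lemma deriv_nonpos_of_forall_le {f : ℝ → ℝ} {t : ℝ} (ht : 0 < t) (hf : DifferentiableAt ℝ f t)
    (h : ∀ s, 0 < s → s ≤ t → f t ≤ f s) : deriv f t ≤ 0 := by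
  have h1 := hf.hasDerivAt.hasDerivWithinAt (s := Iio t)
  have h2 := (hasDerivWithinAt_iff_tendsto_slope' (by simp)).1 h1
  refine le_of_tendsto h2 ?_
  filter_upwards [Ioo_mem_nhdsLT ht] with s hs
  rw [slope_def_field]
  exact div_nonpos_of_nonneg_of_nonpos (by linarith [h s hs.1 hs.2.le]) (by linarith [hs.2])

/-- The minimum principle for solutions that are bounded below: an initial lower bound by a
multiple `-η` of the barrier persists, up to the growth factor of the barrier. The initial bound
is required as a lower limit in `(h, g)` jointly. -/
theorem IsSolution.neg_barrier_le {n : ℕ} {v : ℝ → Space n → ℝ} (hv : IsSolution n v) {M η : ℝ}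
    (hM : ∀ h, 0 < h → ∀ g, -M ≤ v h g) (hη : 0 ≤ η)
    (hinit : ∀ g₀ : Space n, ∀ ε : ℝ, 0 < ε →
      ∀ᶠ q : ℝ × Space n in 𝓝[>] 0 ×ˢ 𝓝 g₀, -η * barrier g₀ - ε < v q.1 q.2)
    {h : ℝ} (hh : 0 < h) (g : Space n) :
    -(η * Real.exp ((2 * n + 3) * h) * barrier g) ≤ v h g := by
  set c : ℝ := 2 * n + 3 with hc
  have hcpos : 0 < c := by positivity
  suffices H : ∀ ε : ℝ, 0 < ε → 0 ≤ v h g + (η + ε) * Real.exp (c * h) * barrier g by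
    have hb := one_le_barrier g
    have he := Real.exp_pos (c * h)
    refine le_of_forall_pos_le_add fun δ hδ => ?_
    have h1 := H (δ / (Real.exp (c * h) * barrier g)) (by positivity)
    have h2 : (η + δ / (Real.exp (c * h) * barrier g)) * Real.exp (c * h) * barrier g
        = η * Real.exp (c * h) * barrier g + δ := by
      field_simp
    linarith
  intro ε hε
  set κ := η + ε with hκ
  have hκpos : 0 < κ := by positivity
  by_contra! hneg
  let W : ℝ → Space n → ℝ := fun t y => v t y + κ * Real.exp (c * t) * barrier y
  have hWcont : ContinuousOn (fun q : ℝ × Space n => W q.1 q.2) (Ioi 0 ×ˢ univ) := by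
    refine hv.1.continuousOn.add ?_
    have := (contDiff_barrier n).continuous
    exact Continuous.continuousOn (by fun_prop)
  -- `W` is positive far away in space
  have hfar : ∀ t, 0 < t → ∀ y : Space n, M / κ + 1 ≤ ‖y‖ ^ 2 → 0 < W t y := by
    intro t ht y hy
    have h1 := hM t ht y
    have h2 := (norm_sq_le_barrier y).trans' hy
    have h3 : 1 ≤ Real.exp (c * t) := Real.one_le_exp (by positivity)
    have h4 : M + κ ≤ κ * barrier y := by
      have := mul_le_mul_of_nonneg_left h2 hκpos.le
      rw [mul_add, mul_div_cancel₀ _ hκpos.ne'] at this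
      linarith
    have h5 : κ * barrier y ≤ κ * Real.exp (c * t) * barrier y := by
      have := one_le_barrier y
      rw [mul_right_comm]
      exact le_mul_of_one_le_right (by positivity) h3
    show 0 < v t y + κ * Real.exp (c * t) * barrier y
    linarith
  -- and, on compact sets, for small times
  obtain ⟨ρ, hρ⟩ : ∃ ρ : ℝ, 0 ≤ ρ ∧ M / κ + 1 ≤ ρ ^ 2 := by
    refine ⟨|M / κ + 1| + 1, by positivity, ?_⟩
    nlinarith [le_abs_self (M / κ + 1), abs_nonneg (M / κ + 1)]
  have hfar' : ∀ t, 0 < t → ∀ y : Space n, y ∉ Metric.closedBall (0 : Space n) ρ → 0 < W t y := by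
    intro t ht y hy
    refine hfar t ht y (hρ.2.trans ?_)
    rw [mem_closedBall_zero_iff, not_le] at hy
    exact pow_le_pow_left₀ hρ.1 hy.le 2
  have hsmall : ∀ᶠ t in 𝓝 (0 : ℝ), ∀ y ∈ Metric.closedBall (0 : Space n) ρ, 0 < t → 0 < W t y := by
    refine (isCompact_closedBall (0 : Space n) ρ).eventually_forall_of_forall_eventually ?_
    intro y₀ _
    have hb := one_le_barrier y₀
    have h1 := hinit y₀ (ε / 2) (by positivity)
    rw [← nhdsWithin_univ, ← nhdsWithin_prod_eq, eventually_nhdsWithin_iff] at h1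
    have h2 : ∀ᶠ q : ℝ × Space n in 𝓝 (0, y₀), κ * barrier y₀ - ε / 2 < κ * barrier q.2 := by
      have hcont : Continuous fun q : ℝ × Space n => κ * barrier q.2 := by
        have := (contDiff_barrier n).continuous
        fun_prop
      exact hcont.continuousAt.eventually (lt_mem_nhds (by simp; linarith))
    filter_upwards [h1, h2] with q h1 h2 hq
    have h3 := h1 ⟨hq, mem_univ _⟩
    have h4 : 1 ≤ Real.exp (c * q.1) := Real.one_le_exp (by positivity)
    have h5 : κ * barrier q.2 ≤ κ * Real.exp (c * q.1) * barrier q.2 := by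
      have := one_le_barrier q.2
      rw [mul_right_comm]
      exact le_mul_of_one_le_right (by positivity) h4
    show 0 < v q.1 q.2 + κ * Real.exp (c * q.1) * barrier q.2
    have h6 : κ * barrier y₀ = η * barrier y₀ + ε * barrier y₀ := by rw [hκ]; ring
    nlinarith
  obtain ⟨τ, hτ, hτW⟩ := Metric.eventually_nhds_iff.1 hsmall
  set τ' := min (τ / 2) h with hτ'
  have hτ'pos : 0 < τ' := lt_min (by positivity) hh
  have hWneg : W h g < 0 := hneg
  have hgball : g ∈ Metric.closedBall (0 : Space n) ρ := by
    by_contra hg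
    exact absurd (hfar' h hh g hg) (not_lt.2 hWneg.le)
  obtain ⟨⟨t₁, y₁⟩, ⟨ht₁, hy₁⟩, hmin⟩ :=
    (isCompact_Icc.prod (isCompact_closedBall (0 : Space n) ρ)).exists_isMinOn
      (s := Icc τ' h ×ˢ Metric.closedBall (0 : Space n) ρ)
      ⟨(h, g), ⟨⟨min_le_right _ _, le_rfl⟩, hgball⟩⟩
      (hWcont.mono (prod_mono (fun t ht => hτ'pos.trans_le ht.1) (subset_univ _)))
  have hW₁ : W t₁ y₁ < 0 :=
    (hmin (show (h, g) ∈ Icc τ' h ×ˢ Metric.closedBall (0 : Space n) ρ from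
      ⟨⟨min_le_right _ _, le_rfl⟩, hgball⟩)).trans_lt hWneg
  have ht₁pos : 0 < t₁ := hτ'pos.trans_le ht₁.1
  have hglobal : ∀ t, 0 < t → t ≤ h → ∀ y, W t₁ y₁ ≤ W t y := by
    intro t ht hth y
    by_cases hy : y ∈ Metric.closedBall (0 : Space n) ρ
    · rcases le_or_gt τ' t with h1 | h1
      · exact hmin (show (t, y) ∈ Icc τ' h ×ˢ Metric.closedBall (0 : Space n) ρ from
          ⟨⟨h1, hth⟩, hy⟩)
      · refine hW₁.le.trans (hτW ?_ y hy ht).le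
        rw [Real.dist_eq, sub_zero, abs_of_pos ht]
        have := min_le_left (τ / 2) h
        linarith
    · exact hW₁.le.trans (hfar' t ht y hy).le
  -- at the minimum of `W` the time derivative and `Δ_G` have the wrong signs
  have hdE : HasDerivAt (fun t => κ * Real.exp (c * t) * barrier y₁)
      (κ * (Real.exp (c * t₁) * c) * barrier y₁) t₁ := by
    have := (((hasDerivAt_id t₁).const_mul c).exp.const_mul κ).mul_const (barrier y₁)
    simpa using this
  have hdW := (hv.differentiableAt ht₁pos y₁).hasDerivAt.add hdE
  have hle : deriv (fun t => W t y₁) t₁ ≤ 0 :=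
    deriv_nonpos_of_forall_le ht₁pos hdW.differentiableAt
      fun s hs hst => hglobal s hs (hst.trans ht₁.2) y₁
  rw [show deriv (fun t => W t y₁) t₁ = _ from hdW.deriv, hv.2 t₁ ht₁pos y₁] at hle
  have hWc : Continuous (W t₁) :=
    (hv.contDiff ht₁pos).continuous.add (continuous_const.mul (contDiff_barrier n).continuous)
  have hge : 0 ≤ grushinOp n (W t₁) y₁ :=
    grushinOp_nonneg_of_forall_le hWc (hglobal t₁ ht₁pos ht₁.2)
  have hlin := grushinOp_linComb (hv.contDiff ht₁pos) (contDiff_barrier n) 1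
    (κ * Real.exp (c * t₁)) y₁
  simp only [one_mul] at hlin
  rw [show W t₁ = fun y => v t₁ y + κ * Real.exp (c * t₁) * barrier y from rfl, hlin,
    grushinOp_barrier] at hge
  have hψ : 2 * (n : ℝ) + 2 * ‖y₁.1‖ ^ 2 < c * barrier y₁ := by
    rw [hc, barrier]
    have : (0 : ℝ) ≤ n := n.cast_nonneg
    nlinarith [mul_nonneg this (sq_nonneg ‖y₁.1‖), mul_nonneg this (sq_nonneg y₁.2),
      sq_nonneg ‖y₁.1‖, sq_nonneg y₁.2]
  have hpos : 0 < κ * Real.exp (c * t₁) := by positivity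
  nlinarith [mul_lt_mul_of_pos_left hψ hpos]

end Grushin

/-! ### Solutions obtained by integrating a smooth kernel against a test function -/

namespace Grushin

/-- The time derivative of a function that is jointly smooth is jointly smooth. -/
lemma contDiffOn_deriv_fst {n : ℕ} {F : ℝ → Space n → ℝ} {I : Set ℝ} (hI : IsOpen I)
    (hF : ContDiffOn ℝ ∞ (fun q : ℝ × Space n => F q.1 q.2) (I ×ˢ univ)) :
    ContDiffOn ℝ ∞ (fun q : ℝ × Space n => deriv (fun t => F t q.2) q.1) (I ×ˢ univ) := by
  have hopen : IsOpen (I ×ˢ (univ : Set (Space n))) := hI.prod isOpen_univ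
  have h1 := ((contDiffOn_infty_iff_fderiv_of_isOpen hopen).1 hF).2
  refine (h1.clm_apply (contDiffOn_const (c := ((1 : ℝ), (0 : Space n))))).congr fun q hq => ?_
  have h2 := ((hF.contDiffAt (hopen.mem_nhds hq)).differentiableAt (by simp)).hasFDerivAt
  have h3 : HasDerivAt (fun t : ℝ => (t, q.2)) ((1 : ℝ), (0 : Space n)) q.1 :=
    (hasDerivAt_id q.1).prodMk (hasDerivAt_const q.1 q.2)
  exact (h2.comp_hasDerivAt q.1 h3).deriv

lemma continuous_section {n : ℕ} {F : ℝ → Space n → ℝ} {I : Set ℝ}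
    (hF : ContDiffOn ℝ ∞ (fun q : ℝ × Space n => F q.1 q.2) (I ×ˢ univ)) {t : ℝ} (ht : t ∈ I) :
    Continuous (F t) := by
  rw [← continuousOn_univ]
  exact hF.continuousOn.comp (f := fun y : Space n => (t, y)) (by fun_prop)
    fun y _ => ⟨ht, mem_univ _⟩

lemma hasDerivAt_integral_mul {n : ℕ} {F : ℝ → Space n → ℝ} {I : Set ℝ} (hI : IsOpen I)
    (hF : ContDiffOn ℝ ∞ (fun q : ℝ × Space n => F q.1 q.2) (I ×ˢ univ)) {f : Space n → ℝ}
    (hf : Continuous f) (hfs : HasCompactSupport f) {t : ℝ} (ht : t ∈ I) :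
    HasDerivAt (fun t => ∫ y, F t y * f y) (∫ y, deriv (fun t => F t y) t * f y) t := by
  have hD := contDiffOn_deriv_fst hI hF
  obtain ⟨δ, hδ, hδI⟩ := Metric.nhds_basis_closedBall.mem_iff.1 (hI.mem_nhds ht)
  have hK : IsCompact (Metric.closedBall t δ ×ˢ tsupport f) := (isCompact_closedBall t δ).prod hfs
  obtain ⟨C, hC⟩ := hK.exists_bound_of_continuousOn
    (hD.continuousOn.mono (prod_mono hδI (subset_univ _)))
  have hmul : ∀ {G : Space n → ℝ}, Continuous G → Integrable fun y => G y * f y := fun hG =>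
    (hG.mul hf).integrable_of_hasCompactSupport hfs.mul_left
  refine (hasDerivAt_integral_of_dominated_loc_of_deriv_le (μ := volume) (𝕜 := ℝ)
    (F := fun t y => F t y * f y) (F' := fun t y => deriv (fun t => F t y) t * f y)
    (bound := fun y => C * ‖f y‖) (Metric.closedBall_mem_nhds t hδ) ?_
    (hmul (continuous_section hF ht)) ?_ ?_ ?_ ?_).2
  · filter_upwards [hI.mem_nhds ht] with s hs
    exact (hmul (continuous_section hF hs)).aestronglyMeasurable
  · exact (hmul (continuous_section (F := fun t y => deriv (fun t => F t y) t) hD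
      ht)).aestronglyMeasurable
  · refine .of_forall fun y s hs => ?_
    rw [norm_mul]
    by_cases hy : y ∈ tsupport f
    · gcongr
      exact hC (s, y) ⟨hs, hy⟩
    · simp [image_eq_zero_of_notMem_tsupport hy]
  · exact (hf.integrable_of_hasCompactSupport hfs).norm.const_mul C
  · refine .of_forall fun y s hs => ?_
    have h1 : ContDiffOn ℝ ∞ (fun t => F t y) I :=
      hF.comp (f := fun t : ℝ => (t, y)) (by fun_prop) fun s hs => ⟨hs, mem_univ _⟩
    exact ((h1.contDiffAt (hI.mem_nhds (hδI hs))).differentiableAt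
      (by simp)).hasDerivAt.mul_const (f y)

lemma iteratedDeriv_two_integral_mul {n : ℕ} {F : ℝ → Space n → ℝ}
    (hF : ContDiff ℝ ∞ (fun q : ℝ × Space n => F q.1 q.2)) {f : Space n → ℝ}
    (hf : Continuous f) (hfs : HasCompactSupport f) (t : ℝ) :
    iteratedDeriv 2 (fun t => ∫ y, F t y * f y) t
        = ∫ y, iteratedDeriv 2 (fun t => F t y) t * f y ∧
      Integrable fun y => iteratedDeriv 2 (fun t => F t y) t * f y := by
  have hF' : ContDiffOn ℝ ∞ (fun q : ℝ × Space n => F q.1 q.2) (univ ×ˢ univ) := by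
    rw [univ_prod_univ]; exact hF.contDiffOn
  have hD := contDiffOn_deriv_fst isOpen_univ hF'
  have hDD := contDiffOn_deriv_fst (F := fun t y => deriv (fun t => F t y) t) isOpen_univ hD
  simp only [iteratedDeriv_succ, iteratedDeriv_zero]
  refine ⟨?_, ((continuous_section (F := fun t y => deriv (deriv fun t => F t y) t) hDD
    (mem_univ t)).mul hf).integrable_of_hasCompactSupport hfs.mul_left⟩
  have e : (deriv fun t => ∫ y, F t y * f y) = fun t => ∫ y, deriv (fun t => F t y) t * f y :=
    funext fun t => (hasDerivAt_integral_mul isOpen_univ hF' hf hfs (mem_univ t)).deriv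
  rw [e]
  exact (hasDerivAt_integral_mul (F := fun t y => deriv (fun t => F t y) t) isOpen_univ hD hf hfs
    (mem_univ t)).deriv

/-- A smooth kernel that solves the heat equation in `(h, g)`, integrated in `g'` against a test
function, gives a solution. Joint smoothness is read off from smoothness of convolutions with a
parameter, after the kernel is cut off outside the support of the test function. -/
theorem isSolution_integral_mul {n : ℕ} {p : ℝ → Space n → Space n → ℝ}
    (hp : ContDiffOn ℝ ∞ (fun q : ℝ × Space n × Space n => p q.1 q.2.1 q.2.2)
      (Ioi (0 : ℝ) ×ˢ (univ : Set (Space n × Space n))))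
    (heat : ∀ h : ℝ, 0 < h → ∀ g g' : Space n,
      deriv (fun t : ℝ => p t g g') h = grushinOp n (fun y : Space n => p h y g') g)
    {f : Space n → ℝ} (hf : Continuous f) (hfs : HasCompactSupport f) :
    IsSolution n fun h g => ∫ g', p h g g' * f g' := by
  constructor
  · obtain ⟨r, hr⟩ := hfs.isCompact.isBounded.subset_closedBall (0 : Space n)
    have hr' : tsupport f ⊆ Metric.closedBall (0 : Space n) (max r 1) :=
      hr.trans (Metric.closedBall_subset_closedBall (le_max_left _ _))
    let χ : ContDiffBump (0 : Space n) := ⟨max r 1, max r 1 + 1, by positivity, by linarith⟩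
    have hχf : ∀ y, χ y * f y = f y := by
      intro y
      by_cases hy : y ∈ tsupport f
      · rw [χ.one_of_mem_closedBall (hr' hy), one_mul]
      · simp [image_eq_zero_of_notMem_tsupport hy]
    have hs : IsOpen (Ioi (0 : ℝ) ×ˢ (univ : Set (Space n))) := isOpen_Ioi.prod isOpen_univ
    have key := contDiffOn_convolution_right_with_param (𝕜 := ℝ) (μ := (volume : Measure (Space n)))
      (f := f) (n := ⊤) (ContinuousLinearMap.mul ℝ ℝ)
      (g := fun (q : ℝ × Space n) (y : Space n) => p q.1 q.2 (-y) * χ (-y))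
      (s := Ioi (0 : ℝ) ×ˢ (univ : Set (Space n))) (k := Metric.closedBall 0 (max r 1 + 1)) hs
      (isCompact_closedBall _ _) ?_ hf.locallyIntegrable ?_
    · refine (key.comp (f := fun q : ℝ × Space n => (q, (0 : Space n))) (by fun_prop)
        fun q hq => ⟨hq, mem_univ _⟩).congr fun q hq => ?_
      simp only [Function.comp_apply, convolution, ContinuousLinearMap.mul_apply', zero_sub,
        neg_neg]
      refine integral_congr_ae (.of_forall fun y => ?_)
      simp only
      rw [← hχf y]
      linear_combination (-p q.1 q.2 y * χ y) * hχf y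
    · intro q y _ hy
      have : χ (-y) = 0 := by
        refine χ.zero_of_le_dist ?_
        rw [Metric.mem_closedBall, not_le] at hy
        simpa using hy.le
      simp only [this, mul_zero]
    · refine ContDiffOn.mul ?_ ?_
      · refine hp.comp (f := fun q : (ℝ × Space n) × Space n => (q.1.1, q.1.2, -q.2))
          (by fun_prop) ?_
        rintro q ⟨⟨hq, -⟩, -⟩
        exact ⟨hq, mem_univ _⟩
      · have := χ.contDiff (n := ⊤)
        exact ContDiff.contDiffOn (this.comp (by fun_prop))
  · intro h hh g
    have ht : ContDiffOn ℝ ∞ (fun q : ℝ × Space n => p q.1 g q.2) (Ioi 0 ×ˢ univ) :=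
      hp.comp (f := fun q : ℝ × Space n => (q.1, g, q.2)) (by fun_prop)
        fun q hq => ⟨hq.1, mem_univ _⟩
    rw [(hasDerivAt_integral_mul (F := fun t g' => p t g g') isOpen_Ioi ht hf hfs hh).deriv]
    have hx : ∀ i : Fin n, ContDiff ℝ ∞ fun q : ℝ × Space n =>
        p h (g.1 + q.1 • EuclideanSpace.single i (1 : ℝ), g.2) q.2 := fun i => by
      rw [← contDiffOn_univ]
      exact hp.comp (f := fun q : ℝ × Space n =>
        (h, (g.1 + q.1 • EuclideanSpace.single i (1 : ℝ), g.2), q.2)) (by fun_prop)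
        fun q _ => ⟨hh, mem_univ _⟩
    have hu : ContDiff ℝ ∞ fun q : ℝ × Space n => p h (g.1, q.1) q.2 := by
      rw [← contDiffOn_univ]
      exact hp.comp (f := fun q : ℝ × Space n => (h, (g.1, q.1), q.2)) (by fun_prop)
        fun q _ => ⟨hh, mem_univ _⟩
    have ix := fun i => iteratedDeriv_two_integral_mul (F := fun t g' =>
      p h (g.1 + t • EuclideanSpace.single i (1 : ℝ), g.2) g') (hx i) hf hfs 0
    have iu := iteratedDeriv_two_integral_mul (F := fun t g' => p h (g.1, t) g') hu hf hfs g.2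
    simp only [grushinOp, heat h hh]
    rw [iu.1, Finset.sum_congr rfl fun i _ => (ix i).1,
      ← integral_finsetSum _ fun i _ => (ix i).2, ← integral_const_mul,
      ← integral_add (integrable_finsetSum _ fun i _ => (ix i).2) (iu.2.const_mul _)]
    refine integral_congr_ae (.of_forall fun y => ?_)
    simp only [add_mul, Finset.sum_mul]
    ring

end Grushin

/-! ### Fourier representation of the kernel and its initial values -/

namespace Grushin

open scoped FourierTransform

/-- The factor, with values in `(0, 1]`, by which the Mehler kernel of frequency `ξ` differs from
the Euclidean heat kernel. -/
noncomputable def damping (n : ℕ) (h ξ : ℝ) (x x' : EuclideanSpace ℝ (Fin n)) : ℝ :=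
  weight n (4 * Real.pi * h * ξ) *
    Real.exp (-(((‖x‖ ^ 2 + ‖x'‖ ^ 2) *
        (Real.cosh (4 * Real.pi * h * ξ) / sinhc (4 * Real.pi * h * ξ) - 1)
      + 2 * inner ℝ x x' * (1 - 1 / sinhc (4 * Real.pi * h * ξ))) / (4 * h)))

/-- The Mehler kernel: the heat kernel of `Δ_x - (2πξ)² |x|²` on `ℝⁿ`. -/
noncomputable def mehler (n : ℕ) (h ξ : ℝ) (x x' : EuclideanSpace ℝ (Fin n)) : ℝ :=
  (4 * Real.pi * h) ^ (-((n : ℝ) / 2)) * Real.exp (-(‖x - x'‖ ^ 2 / (4 * h))) * damping n h ξ x x'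

lemma abs_two_inner_le {n : ℕ} (x x' : EuclideanSpace ℝ (Fin n)) :
    |2 * inner ℝ x x'| ≤ ‖x‖ ^ 2 + ‖x'‖ ^ 2 := by
  have h1 := norm_add_sq_real x x'
  have h2 := norm_sub_sq_real x x'
  rw [abs_le]
  constructor <;> nlinarith [sq_nonneg ‖x + x'‖, sq_nonneg ‖x - x'‖]

lemma one_div_sinhc_le_one (τ : ℝ) : 1 / sinhc τ ≤ 1 :=
  (div_le_one (sinhc_pos τ)).2 (one_le_sinhc τ)

lemma two_le_cosh_add_one_div_sinhc (τ : ℝ) : 2 ≤ Real.cosh τ / sinhc τ + 1 / sinhc τ := by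
  rw [← add_div, le_div_iff₀ (sinhc_pos τ), sinhc_eq_cosh_half_mul]
  have h2 : Real.cosh τ + 1 = 2 * Real.cosh (τ / 2) ^ 2 := by
    have h := Real.cosh_two_mul (τ / 2)
    rw [show 2 * (τ / 2) = τ by ring] at h
    rw [h, Real.sinh_sq]; ring
  rw [h2]
  have h3 := Real.cosh_pos (τ / 2)
  nlinarith [mul_le_mul_of_nonneg_left (sinhc_le_cosh (τ / 2)) h3.le]

lemma damping_exponent_nonneg {n : ℕ} (τ : ℝ) (x x' : EuclideanSpace ℝ (Fin n)) :
    0 ≤ (‖x‖ ^ 2 + ‖x'‖ ^ 2) * (Real.cosh τ / sinhc τ - 1)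
      + 2 * inner ℝ x x' * (1 - 1 / sinhc τ) := by
  have h1 := two_le_cosh_add_one_div_sinhc τ
  have h2 := one_div_sinhc_le_one τ
  have h3 := (abs_le.1 (abs_two_inner_le x x')).1
  nlinarith [mul_le_mul_of_nonneg_right h3 (sub_nonneg.2 h2),
    mul_nonneg (show 0 ≤ ‖x‖ ^ 2 + ‖x'‖ ^ 2 by positivity) (sub_nonneg.2 h1)]

lemma damping_exponent_le {n : ℕ} (τ : ℝ) (x x' : EuclideanSpace ℝ (Fin n)) :
    (‖x‖ ^ 2 + ‖x'‖ ^ 2) * (Real.cosh τ / sinhc τ - 1) + 2 * inner ℝ x x' * (1 - 1 / sinhc τ)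
      ≤ 2 * (‖x‖ ^ 2 + ‖x'‖ ^ 2) * (Real.cosh τ - 1) := by
  have hS := one_le_sinhc τ
  have hc := sinhc_le_cosh τ
  have h1 : Real.cosh τ / sinhc τ ≤ Real.cosh τ := div_le_self (Real.cosh_pos τ).le hS
  have h2 : 1 - 1 / sinhc τ ≤ Real.cosh τ - 1 := by
    have : 1 - 1 / sinhc τ ≤ sinhc τ - 1 := by
      rw [← sub_nonneg]
      have e : sinhc τ - 1 - (1 - 1 / sinhc τ) = (sinhc τ - 1) ^ 2 / sinhc τ := by
        have := (sinhc_pos τ).ne'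
        field_simp
      rw [e]
      have := sinhc_pos τ
      positivity
    linarith
  have h3 := (abs_le.1 (abs_two_inner_le x x')).2
  have h4 := sub_nonneg.2 (one_div_sinhc_le_one τ)
  have hR : 0 ≤ ‖x‖ ^ 2 + ‖x'‖ ^ 2 := by positivity
  nlinarith [mul_le_mul_of_nonneg_left h1 hR, mul_le_mul_of_nonneg_left h2 hR,
    mul_le_mul_of_nonneg_right h3 h4]

lemma damping_nonneg (n : ℕ) (h ξ : ℝ) (x x' : EuclideanSpace ℝ (Fin n)) :
    0 ≤ damping n h ξ x x' := mul_nonneg (weight_pos n _).le (Real.exp_pos _).le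

lemma damping_le_weight (n : ℕ) {h : ℝ} (hh : 0 < h) (ξ : ℝ) (x x' : EuclideanSpace ℝ (Fin n)) :
    damping n h ξ x x' ≤ weight n (4 * Real.pi * h * ξ) := by
  refine mul_le_of_le_one_right (weight_pos n _).le (Real.exp_le_one_iff.2 ?_)
  have := damping_exponent_nonneg (4 * Real.pi * h * ξ) x x'
  rw [neg_nonpos]
  positivity

lemma damping_le_one (n : ℕ) {h : ℝ} (hh : 0 < h) (ξ : ℝ) (x x' : EuclideanSpace ℝ (Fin n)) :
    damping n h ξ x x' ≤ 1 := (damping_le_weight n hh ξ x x').trans (weight_le_one n _)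

lemma continuous_damping (n : ℕ) (h : ℝ) :
    Continuous fun q : ℝ × EuclideanSpace ℝ (Fin n) × EuclideanSpace ℝ (Fin n) =>
      damping n h q.1 q.2.1 q.2.2 := by
  unfold damping
  have h1 := continuous_weight n
  have h2 := continuous_sinhc
  have h3 : Continuous fun τ => Real.cosh τ / sinhc τ :=
    Real.continuous_cosh.div h2 fun t => (sinhc_pos t).ne'
  have h4 : Continuous fun τ => 1 / sinhc τ := continuous_const.div h2 fun t => (sinhc_pos t).ne'
  have h5 : Continuous fun q : ℝ × EuclideanSpace ℝ (Fin n) × EuclideanSpace ℝ (Fin n) =>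
      4 * Real.pi * h * q.1 := by fun_prop
  have h6 := h1.comp h5
  have h7 := h3.comp h5
  have h8 := h4.comp h5
  simp only [Function.comp_def] at h6 h7 h8
  fun_prop

lemma continuous_mehler (n : ℕ) (h : ℝ) :
    Continuous fun q : ℝ × EuclideanSpace ℝ (Fin n) × EuclideanSpace ℝ (Fin n) =>
      mehler n h q.1 q.2.1 q.2.2 := by
  unfold mehler
  have := continuous_damping n h
  fun_prop

lemma mehler_nonneg (n : ℕ) {h : ℝ} (hh : 0 < h) (ξ : ℝ) (x x' : EuclideanSpace ℝ (Fin n)) :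
    0 ≤ mehler n h ξ x x' := by
  have := damping_nonneg n h ξ x x'
  have := Real.pi_pos
  unfold mehler
  positivity

lemma mehler_le_weight (n : ℕ) {h : ℝ} (hh : 0 < h) (ξ : ℝ) (x x' : EuclideanSpace ℝ (Fin n)) :
    mehler n h ξ x x' ≤ (4 * Real.pi * h) ^ (-((n : ℝ) / 2)) * weight n (4 * Real.pi * h * ξ) := by
  have h1 := damping_le_weight n hh ξ x x'
  have h2 := damping_nonneg n h ξ x x'
  have h3 : Real.exp (-(‖x - x'‖ ^ 2 / (4 * h))) ≤ 1 := by
    rw [Real.exp_le_one_iff, neg_nonpos]; positivity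
  have := Real.pi_pos
  unfold mehler
  calc _ ≤ (4 * Real.pi * h) ^ (-((n : ℝ) / 2)) * 1 * weight n (4 * Real.pi * h * ξ) := by gcongr
    _ = _ := by ring

/-- The substitution `τ = 4πhξ` turns the kernel into an inverse Fourier integral of Mehler
kernels. -/
lemma kernel_eq_fourier (n : ℕ) {h : ℝ} (hh : 0 < h) (g g' : Space n) :
    kernel n h g g' = (∫ ξ : ℝ, Complex.exp (2 * Real.pi * Complex.I * ξ * (g.2 - g'.2 : ℝ)) *
      (mehler n h ξ g.1 g'.1 : ℂ)).re := by
  have hpi := Real.pi_pos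
  set p : ℝ := (n : ℝ) / 2 with hp
  have hpos : 0 < 4 * Real.pi * h := by positivity
  have hb : (4 * h)⁻¹ / Real.pi = (4 * Real.pi * h)⁻¹ := by field_simp
  have hint : ∀ ξ : ℝ, Complex.exp (2 * Real.pi * Complex.I * ξ * (g.2 - g'.2 : ℝ)) *
      (mehler n h ξ g.1 g'.1 : ℂ) = ((4 * Real.pi * h) ^ (-p) : ℝ) *
        ((weight n (4 * Real.pi * h * ξ) : ℂ) * Complex.exp (phase (4 * Real.pi * h * ξ)
          ((4 * h)⁻¹ * Rsq g g', (4 * h)⁻¹ * inner ℝ g.1 g'.1, (4 * h)⁻¹ * (g.2 - g'.2)))) := by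
    intro ξ
    have hphase : phase (4 * Real.pi * h * ξ)
        ((4 * h)⁻¹ * Rsq g g', (4 * h)⁻¹ * inner ℝ g.1 g'.1, (4 * h)⁻¹ * (g.2 - g'.2))
        = 2 * Real.pi * Complex.I * ξ * (g.2 - g'.2 : ℝ)
          + ((-(‖g.1 - g'.1‖ ^ 2 / (4 * h)) : ℝ) + (-(((‖g.1‖ ^ 2 + ‖g'.1‖ ^ 2) *
        (Real.cosh (4 * Real.pi * h * ξ) / sinhc (4 * Real.pi * h * ξ) - 1)
      + 2 * inner ℝ g.1 g'.1 * (1 - 1 / sinhc (4 * Real.pi * h * ξ))) / (4 * h)) : ℝ)) := by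
      have hhc : (h : ℂ) ≠ 0 := by exact_mod_cast hh.ne'
      have hreal : -(‖g.1 - g'.1‖ ^ 2 / (4 * h)) + -(((‖g.1‖ ^ 2 + ‖g'.1‖ ^ 2) *
          (Real.cosh (4 * Real.pi * h * ξ) / sinhc (4 * Real.pi * h * ξ) - 1)
          + 2 * inner ℝ g.1 g'.1 * (1 - 1 / sinhc (4 * Real.pi * h * ξ))) / (4 * h))
          = -(Real.cosh (4 * Real.pi * h * ξ) / sinhc (4 * Real.pi * h * ξ))
              * ((4 * h)⁻¹ * Rsq g g')
            + 2 / sinhc (4 * Real.pi * h * ξ) * ((4 * h)⁻¹ * inner ℝ g.1 g'.1) := by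
        have hS := (sinhc_pos (4 * Real.pi * h * ξ)).ne'
        rw [norm_sub_sq_real, Rsq]
        field_simp
        ring
      rw [← Complex.ofReal_add, hreal]
      simp only [phase]
      push_cast
      field_simp
      ring
    rw [hphase, Complex.exp_add, Complex.exp_add, ← Complex.ofReal_exp, ← Complex.ofReal_exp,
      mehler, damping]
    push_cast
    ring
  simp_rw [hint]
  rw [integral_const_mul, Complex.re_ofReal_mul, Measure.integral_comp_mul_left
    (fun τ : ℝ => (weight n τ : ℂ) * Complex.exp (phase τ
      ((4 * h)⁻¹ * Rsq g g', (4 * h)⁻¹ * inner ℝ g.1 g'.1, (4 * h)⁻¹ * (g.2 - g'.2)))),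
    Complex.real_smul, Complex.re_ofReal_mul, abs_of_pos (inv_pos.2 hpos), kernel, hb, ← hp,
    Real.inv_rpow hpos.le, ← Real.rpow_neg hpos.le, neg_add, Real.rpow_add hpos,
    Real.rpow_neg_one, mul_assoc]
  rfl

/-- The integral of the Mehler kernel against a function, after the substitution
`x' = x + √h y`. -/
lemma integral_mehler_mul {n : ℕ} {h : ℝ} (hh : 0 < h) (ξ : ℝ) (x : EuclideanSpace ℝ (Fin n))
    (φ : EuclideanSpace ℝ (Fin n) → ℝ) :
    ∫ x', mehler n h ξ x x' * φ x' = ∫ y : EuclideanSpace ℝ (Fin n),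
      (4 * Real.pi) ^ (-((n : ℝ) / 2)) * Real.exp (-(1 / 4) * ‖y‖ ^ 2)
        * (damping n h ξ x (x + √h • y) * φ (x + √h • y)) := by
  have hpi := Real.pi_pos
  have hs : 0 < √h := Real.sqrt_pos.2 hh
  rw [← integral_add_left_eq_self (fun x' => mehler n h ξ x x' * φ x') x]
  have h1 := Measure.integral_comp_smul (volume : Measure (EuclideanSpace ℝ (Fin n)))
    (fun z => mehler n h ξ x (x + z) * φ (x + z)) (√h)
  have hfac : |(√h ^ Module.finrank ℝ (EuclideanSpace ℝ (Fin n)))⁻¹| = h ^ (-((n : ℝ) / 2)) := by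
    rw [finrank_euclideanSpace_fin, abs_of_pos (by positivity), Real.rpow_neg hh.le,
      Real.sqrt_eq_rpow, ← Real.rpow_natCast, ← Real.rpow_mul hh.le]
    congr 2; ring
  have hne : h ^ (-((n : ℝ) / 2)) ≠ 0 := (Real.rpow_pos_of_pos hh _).ne'
  rw [hfac, smul_eq_mul] at h1
  rw [← mul_right_inj' hne, ← h1, ← integral_const_mul]
  refine integral_congr_ae (.of_forall fun y => ?_)
  simp only [mehler]
  have hn : ‖x - (x + √h • y)‖ ^ 2 = h * ‖y‖ ^ 2 := by
    rw [sub_add_cancel_left, norm_neg, norm_smul, mul_pow, Real.norm_of_nonneg hs.le,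
      Real.sq_sqrt hh.le]
  rw [hn, Real.mul_rpow (by positivity) hh.le,
    show -(h * ‖y‖ ^ 2 / (4 * h)) = -(1 / 4) * ‖y‖ ^ 2 by field_simp]
  ring

lemma integrable_gaussian (n : ℕ) : Integrable fun y : EuclideanSpace ℝ (Fin n) =>
    (4 * Real.pi) ^ (-((n : ℝ) / 2)) * Real.exp (-(1 / 4) * ‖y‖ ^ 2) := by
  refine Integrable.const_mul ?_ _
  by_contra h
  have h1 := GaussianFourier.integral_rexp_neg_mul_sq_norm (V := EuclideanSpace ℝ (Fin n))
    (b := 1 / 4) (by norm_num)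
  rw [integral_undef h] at h1
  have := Real.pi_pos
  have h2 : 0 < (Real.pi / (1 / 4)) ^ (Module.finrank ℝ (EuclideanSpace ℝ (Fin n)) / 2 : ℝ) := by
    positivity
  exact h2.ne h1

lemma integral_gaussian_eq_one (n : ℕ) : ∫ y : EuclideanSpace ℝ (Fin n),
    (4 * Real.pi) ^ (-((n : ℝ) / 2)) * Real.exp (-(1 / 4) * ‖y‖ ^ 2) = 1 := by
  have := Real.pi_pos
  rw [integral_const_mul, GaussianFourier.integral_rexp_neg_mul_sq_norm (by norm_num),
    finrank_euclideanSpace_fin, show Real.pi / (1 / 4) = 4 * Real.pi by ring,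
    ← Real.rpow_add (by positivity)]
  simp

/-- The Mehler kernel is dominated by the Gaussian heat kernel, which has mass `1`. -/
lemma abs_integral_mehler_mul_le {n : ℕ} {h : ℝ} (hh : 0 < h) (ξ : ℝ)
    (x : EuclideanSpace ℝ (Fin n)) {φ : EuclideanSpace ℝ (Fin n) → ℝ} {M : ℝ}
    (hM : ∀ y, |φ y| ≤ M) : |∫ x', mehler n h ξ x x' * φ x'| ≤ M := by
  have hpi := Real.pi_pos
  rw [integral_mehler_mul hh, ← Real.norm_eq_abs]
  refine (norm_integral_le_of_norm_le ((integrable_gaussian n).mul_const M)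
    (.of_forall fun y => ?_)).trans ?_
  · rw [norm_mul, Real.norm_of_nonneg (by positivity)]
    gcongr
    rw [norm_mul, Real.norm_of_nonneg (damping_nonneg _ _ _ _ _)]
    calc _ ≤ 1 * M := mul_le_mul (damping_le_one n hh _ _ _) (hM _) (abs_nonneg _) zero_le_one
      _ = M := one_mul M
  · rw [integral_mul_const, integral_gaussian_eq_one, one_mul]

/-- As `h → 0` the damping factor tends to `1`, because `cosh τ - 1 = o(τ)`. -/
lemma tendsto_damping {n : ℕ} {ι : Type*} {l : Filter ι} {h : ι → ℝ} (hh : Tendsto h l (𝓝[>] 0))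
    {x x' : ι → EuclideanSpace ℝ (Fin n)} {x₀ x₀' : EuclideanSpace ℝ (Fin n)}
    (hx : Tendsto x l (𝓝 x₀)) (hx' : Tendsto x' l (𝓝 x₀')) (ξ : ℝ) :
    Tendsto (fun i => damping n (h i) ξ (x i) (x' i)) l (𝓝 1) := by
  have hh0 : Tendsto h l (𝓝 0) := hh.mono_right nhdsWithin_le_nhds
  have hpos : ∀ᶠ i in l, 0 < h i := hh.eventually self_mem_nhdsWithin
  have hw : Tendsto (fun i => weight n (4 * Real.pi * h i * ξ)) l (𝓝 1) := by
    have h1 : Continuous fun t : ℝ => weight n (4 * Real.pi * t * ξ) :=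
      (continuous_weight n).comp (by fun_prop)
    have h2 := (h1.tendsto 0).comp hh0
    simpa [weight, sinhc_zero, Function.comp_def] using h2
  have hslope : Tendsto (fun t : ℝ => (Real.cosh (4 * Real.pi * t * ξ) - 1) / t) (𝓝[>] 0)
      (𝓝 0) := by
    have h1 : HasDerivAt (fun t : ℝ => Real.cosh (4 * Real.pi * t * ξ)) 0 0 := by
      have := (((hasDerivAt_id (0 : ℝ)).const_mul (4 * Real.pi)).mul_const ξ).cosh
      simpa using this
    have h2 := (hasDerivAt_iff_tendsto_slope.1 h1).mono_left
      (nhdsWithin_mono (0 : ℝ) fun t (ht : 0 < t) => ht.ne')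
    refine h2.congr fun t => ?_
    simp [slope_def_field]
  have he : Tendsto (fun i => ((‖x i‖ ^ 2 + ‖x' i‖ ^ 2) *
        (Real.cosh (4 * Real.pi * h i * ξ) / sinhc (4 * Real.pi * h i * ξ) - 1)
      + 2 * inner ℝ (x i) (x' i) * (1 - 1 / sinhc (4 * Real.pi * h i * ξ))) / (4 * h i)) l
      (𝓝 0) := by
    have h1 : Tendsto (fun i => (‖x i‖ ^ 2 + ‖x' i‖ ^ 2) / 2 *
        ((Real.cosh (4 * Real.pi * h i * ξ) - 1) / h i)) l (𝓝 0) := by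
      have := ((((hx.norm.pow 2).add (hx'.norm.pow 2)).div_const 2).mul (hslope.comp hh))
      simpa using this
    refine tendsto_of_tendsto_of_tendsto_of_le_of_le' tendsto_const_nhds h1 ?_ ?_
    · filter_upwards [hpos] with i hi
      have := damping_exponent_nonneg (4 * Real.pi * h i * ξ) (x i) (x' i)
      positivity
    · filter_upwards [hpos] with i hi
      have := damping_exponent_le (4 * Real.pi * h i * ξ) (x i) (x' i)
      rw [div_le_iff₀ (by positivity)]
      refine this.trans (le_of_eq ?_)
      field_simp
      ring
  have := hw.mul (Real.continuous_exp.continuousAt.tendsto.comp he.neg)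
  simpa [damping] using this

lemma tendsto_integral_mehler_mul {n : ℕ} {φ : EuclideanSpace ℝ (Fin n) → ℝ} (hφ : Continuous φ)
    {M : ℝ} (hM : ∀ y, |φ y| ≤ M) (ξ : ℝ) (x₀ : EuclideanSpace ℝ (Fin n)) :
    Tendsto (fun q : ℝ × EuclideanSpace ℝ (Fin n) => ∫ x', mehler n q.1 ξ q.2 x' * φ x')
      (𝓝[>] 0 ×ˢ 𝓝 x₀) (𝓝 (φ x₀)) := by
  have hpi := Real.pi_pos
  have hpos : ∀ᶠ q : ℝ × EuclideanSpace ℝ (Fin n) in 𝓝[>] 0 ×ˢ 𝓝 x₀, 0 < q.1 :=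
    tendsto_fst.eventually self_mem_nhdsWithin
  have hlim : φ x₀ = ∫ y : EuclideanSpace ℝ (Fin n),
      (4 * Real.pi) ^ (-((n : ℝ) / 2)) * Real.exp (-(1 / 4) * ‖y‖ ^ 2) * (1 * φ x₀) := by
    rw [integral_mul_const, integral_gaussian_eq_one]; ring
  rw [hlim]
  refine Tendsto.congr' (f₁ := fun q : ℝ × EuclideanSpace ℝ (Fin n) =>
    ∫ y : EuclideanSpace ℝ (Fin n),
      (4 * Real.pi) ^ (-((n : ℝ) / 2)) * Real.exp (-(1 / 4) * ‖y‖ ^ 2)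
        * (damping n q.1 ξ q.2 (q.2 + √q.1 • y) * φ (q.2 + √q.1 • y))) ?_ ?_
  · filter_upwards [hpos] with q hq
    exact (integral_mehler_mul hq ξ q.2 φ).symm
  refine tendsto_integral_filter_of_dominated_convergence (fun y =>
    (4 * Real.pi) ^ (-((n : ℝ) / 2)) * Real.exp (-(1 / 4) * ‖y‖ ^ 2) * M) ?_ ?_
    ((integrable_gaussian n).mul_const M) ?_
  · refine .of_forall fun q => Continuous.aestronglyMeasurable ?_
    have := (continuous_damping n q.1).comp (f := fun y : EuclideanSpace ℝ (Fin n) =>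
      (ξ, q.2, q.2 + √q.1 • y)) (by fun_prop)
    simp only [Function.comp_def] at this
    fun_prop
  · filter_upwards [hpos] with q hq
    refine .of_forall fun y => ?_
    rw [norm_mul, Real.norm_of_nonneg (by positivity)]
    gcongr
    rw [norm_mul, Real.norm_of_nonneg (damping_nonneg _ _ _ _ _)]
    calc _ ≤ 1 * M := mul_le_mul (damping_le_one n hq _ _ _) (hM _) (abs_nonneg _) zero_le_one
      _ = M := one_mul M
  · refine .of_forall fun y => ?_
    have h1 : Tendsto (fun q : ℝ × EuclideanSpace ℝ (Fin n) => q.2 + √q.1 • y)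
        (𝓝[>] 0 ×ˢ 𝓝 x₀) (𝓝 x₀) := by
      have hc : Continuous fun q : ℝ × EuclideanSpace ℝ (Fin n) => q.2 + √q.1 • y := by fun_prop
      have := hc.tendsto (0, x₀)
      simp only [Real.sqrt_zero, zero_smul, add_zero, nhds_prod_eq] at this
      exact this.mono_left (Filter.prod_mono nhdsWithin_le_nhds le_rfl)
    exact ((tendsto_damping tendsto_fst tendsto_snd h1 ξ).mul
      ((hφ.tendsto x₀).comp h1)).const_mul _

open scoped FourierTransform

lemma continuous_kernel {n : ℕ} (hn : 2 ≤ n) {h : ℝ} (hh : 0 < h) (g : Space n) :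
    Continuous (kernel n h g) := by
  rw [← continuousOn_univ]
  exact (contDiffOn_kernel hn).continuousOn.comp (f := fun y : Space n => (h, g, y)) (by fun_prop)
    fun y _ => ⟨hh, mem_univ _⟩

lemma integrable_weight {n : ℕ} (hn : 2 ≤ n) : Integrable (weight n) := by
  have := (admissible_weight hn).integrable.norm
  refine this.congr (.of_forall fun τ => ?_)
  simp only [Complex.norm_real, Real.norm_of_nonneg (weight_pos n τ).le]

/-- Against a product test function the kernel integrates to an inverse Fourier integral of the
Mehler evolution of the `x`-factor. -/
lemma integral_kernel_mul_tensor {n : ℕ} (hn : 2 ≤ n) {h : ℝ} (hh : 0 < h) (g : Space n)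
    {φ : EuclideanSpace ℝ (Fin n) → ℝ} {ψ : ℝ → ℝ} (hφ : Continuous φ)
    (hφs : HasCompactSupport φ) (hψ : Continuous ψ) (hψs : HasCompactSupport ψ) :
    ∫ g' : Space n, kernel n h g g' * (φ g'.1 * ψ g'.2)
      = (∫ ξ : ℝ, Complex.exp (2 * Real.pi * Complex.I * ξ * g.2) * 𝓕 (fun t => (ψ t : ℂ)) ξ *
          ((∫ x', mehler n h ξ g.1 x' * φ x' : ℝ) : ℂ)).re := by
  have hpi := Real.pi_pos
  let F : Space n → ℝ → ℂ := fun g' ξ =>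
    Complex.exp (2 * Real.pi * Complex.I * ξ * (g.2 - g'.2 : ℝ)) * (mehler n h ξ g.1 g'.1 : ℂ)
      * (φ g'.1 * ψ g'.2 : ℝ)
  have hFc : Continuous (Function.uncurry F) := by
    have h1 := (continuous_mehler n h).comp (f := fun q : Space n × ℝ => (q.2, g.1, q.1.1))
      (by fun_prop)
    simp only [Function.comp_def] at h1
    simp only [Function.uncurry_def, F]
    fun_prop
  have hf : Integrable fun g' : Space n => φ g'.1 * ψ g'.2 :=
    (hφ.integrable_of_hasCompactSupport hφs).mul_prod (hψ.integrable_of_hasCompactSupport hψs)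
  have hwt : Integrable fun ξ : ℝ =>
      (4 * Real.pi * h) ^ (-((n : ℝ) / 2)) * weight n (4 * Real.pi * h * ξ) :=
    ((integrable_weight hn).comp_mul_left' (by positivity)).const_mul _
  have hFint : Integrable (Function.uncurry F) (volume.prod volume) := by
    refine Integrable.mono' (hf.norm.mul_prod hwt) hFc.aestronglyMeasurable
      (.of_forall fun q => ?_)
    simp only [Function.uncurry_def, F, norm_mul, Complex.norm_real]
    have h1 : ‖Complex.exp (2 * Real.pi * Complex.I * q.2 * (g.2 - q.1.2 : ℝ))‖ = 1 := by
      rw [Complex.norm_exp]; simp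
    rw [h1, one_mul, Real.norm_of_nonneg (mehler_nonneg n hh _ _ _), mul_comm]
    gcongr
    exact mehler_le_weight n hh _ _ _
  have h1 : ∀ g' : Space n, kernel n h g g' * (φ g'.1 * ψ g'.2) = (∫ ξ, F g' ξ).re := by
    intro g'
    rw [kernel_eq_fourier n hh, integral_mul_const, Complex.re_mul_ofReal]
  have h2 : Integrable fun g' => ∫ ξ, F g' ξ := hFint.integral_prod_left
  simp_rw [h1]
  have h3 := Complex.reCLM.integral_comp_comm h2
  simp only [Complex.reCLM_apply] at h3
  rw [h3, integral_integral_swap hFint]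
  congr 1
  refine integral_congr_ae (.of_forall fun ξ => ?_)
  simp only [F]
  have h4 : ∀ g' : Space n,
      Complex.exp (2 * Real.pi * Complex.I * ξ * (g.2 - g'.2 : ℝ)) * (mehler n h ξ g.1 g'.1 : ℂ)
        * (φ g'.1 * ψ g'.2 : ℝ) = Complex.exp (2 * Real.pi * Complex.I * ξ * g.2) *
        (((mehler n h ξ g.1 g'.1 * φ g'.1 : ℝ) : ℂ) *
          (Complex.exp (↑(-2 * Real.pi * g'.2 * ξ) * Complex.I) • (ψ g'.2 : ℂ))) := by
    intro g'
    have : 2 * Real.pi * Complex.I * ξ * (g.2 - g'.2 : ℝ)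
        = 2 * Real.pi * Complex.I * ξ * g.2 + ↑(-2 * Real.pi * g'.2 * ξ) * Complex.I := by
      push_cast; ring
    rw [this, Complex.exp_add, smul_eq_mul]
    push_cast
    ring
  simp_rw [h4]
  rw [integral_const_mul]
  have h5 := integral_prod_mul (μ := (volume : Measure (EuclideanSpace ℝ (Fin n))))
    (ν := (volume : Measure ℝ)) (fun x' => ((mehler n h ξ g.1 x' * φ x' : ℝ) : ℂ))
    (fun t => Complex.exp (↑(-2 * Real.pi * t * ξ) * Complex.I) • (ψ t : ℂ))
  rw [Measure.volume_eq_prod, h5, integral_complex_ofReal, Real.fourier_real_eq_integral_exp_smul]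
  ring

lemma integrable_fourier_ofReal {ψ : ℝ → ℝ} (hψ : ContDiff ℝ ∞ ψ) (hψs : HasCompactSupport ψ) :
    Integrable (𝓕 (fun t => (ψ t : ℂ))) := by
  have hc : HasCompactSupport fun t => (ψ t : ℂ) := hψs.comp_left Complex.ofReal_zero
  have hd : ContDiff ℝ ∞ fun t => (ψ t : ℂ) := Complex.ofRealCLM.contDiff.comp hψ
  exact (𝓕 (hc.toSchwartzMap hd)).integrable

lemma norm_exp_two_pi_mul (ξ u : ℝ) :
    ‖Complex.exp (2 * Real.pi * Complex.I * ξ * u)‖ = 1 := by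
  rw [Complex.norm_exp]; simp

lemma abs_integral_kernel_mul_tensor_le {n : ℕ} (hn : 2 ≤ n) {φ : EuclideanSpace ℝ (Fin n) → ℝ}
    {ψ : ℝ → ℝ} (hφ : Continuous φ) (hφs : HasCompactSupport φ) (hψ : ContDiff ℝ ∞ ψ)
    (hψs : HasCompactSupport ψ) {M : ℝ} (hM : ∀ y, |φ y| ≤ M) {h : ℝ} (hh : 0 < h)
    (g : Space n) : |∫ g' : Space n, kernel n h g g' * (φ g'.1 * ψ g'.2)|
      ≤ ∫ ξ : ℝ, ‖𝓕 (fun t => (ψ t : ℂ)) ξ‖ * M := by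
  rw [integral_kernel_mul_tensor hn hh g hφ hφs hψ.continuous hψs]
  refine (Complex.abs_re_le_norm _).trans (norm_integral_le_of_norm_le
    ((integrable_fourier_ofReal hψ hψs).norm.mul_const M) (.of_forall fun ξ => ?_))
  rw [norm_mul, norm_mul, norm_exp_two_pi_mul, one_mul, Complex.norm_real]
  gcongr
  exact abs_integral_mehler_mul_le hh ξ g.1 hM

/-- Dominated convergence in the Fourier integral, followed by Fourier inversion for `ψ`. -/
lemma tendsto_integral_kernel_mul_tensor {n : ℕ} (hn : 2 ≤ n)
    {φ : EuclideanSpace ℝ (Fin n) → ℝ} {ψ : ℝ → ℝ} (hφ : Continuous φ)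
    (hφs : HasCompactSupport φ) (hψ : ContDiff ℝ ∞ ψ) (hψs : HasCompactSupport ψ)
    (g₀ : Space n) : Tendsto (fun q : ℝ × Space n =>
        ∫ g' : Space n, kernel n q.1 q.2 g' * (φ g'.1 * ψ g'.2))
      (𝓝[>] 0 ×ˢ 𝓝 g₀) (𝓝 (φ g₀.1 * ψ g₀.2)) := by
  have hpos : ∀ᶠ q : ℝ × Space n in 𝓝[>] 0 ×ˢ 𝓝 g₀, 0 < q.1 :=
    tendsto_fst.eventually self_mem_nhdsWithin
  obtain ⟨M, hM⟩ := hφs.exists_bound_of_continuous hφ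
  have hFi := integrable_fourier_ofReal hψ hψs
  have hinv : (fun t => (ψ t : ℂ)) g₀.2
      = ∫ ξ : ℝ, Complex.exp (2 * Real.pi * Complex.I * ξ * g₀.2) * 𝓕 (fun t => (ψ t : ℂ)) ξ := by
    have hc : Continuous fun t => (ψ t : ℂ) := Complex.continuous_ofReal.comp hψ.continuous
    have hcs : HasCompactSupport fun t => (ψ t : ℂ) := hψs.comp_left Complex.ofReal_zero
    conv_lhs => rw [← hc.fourierInv_fourier_eq (hc.integrable_of_hasCompactSupport hcs) hFi]
    rw [Real.fourierInv_eq']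
    refine integral_congr_ae (.of_forall fun ξ => ?_)
    simp only [smul_eq_mul]
    congr 2
    simp
    ring
  have hlim : φ g₀.1 * ψ g₀.2 = (∫ ξ : ℝ, Complex.exp (2 * Real.pi * Complex.I * ξ * g₀.2) *
      𝓕 (fun t => (ψ t : ℂ)) ξ * (φ g₀.1 : ℂ)).re := by
    rw [integral_mul_const, ← hinv]
    simp [mul_comm]
  rw [hlim]
  refine Tendsto.congr' (f₁ := fun q : ℝ × Space n =>
    (∫ ξ : ℝ, Complex.exp (2 * Real.pi * Complex.I * ξ * q.2.2) * 𝓕 (fun t => (ψ t : ℂ)) ξ *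
          ((∫ x', mehler n q.1 ξ q.2.1 x' * φ x' : ℝ) : ℂ)).re) ?_ ?_
  · filter_upwards [hpos] with q hq
    exact (integral_kernel_mul_tensor hn hq q.2 hφ hφs hψ.continuous hψs).symm
  refine (Complex.continuous_re.tendsto _).comp
    (tendsto_integral_filter_of_dominated_convergence
      (fun ξ => ‖𝓕 (fun t => (ψ t : ℂ)) ξ‖ * M) ?_ ?_ (hFi.norm.mul_const M) ?_)
  · refine .of_forall fun q => ?_
    have h1 : StronglyMeasurable fun ξ : ℝ => ∫ x', mehler n q.1 ξ q.2.1 x' * φ x' := by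
      have hc : Continuous fun z : ℝ × EuclideanSpace ℝ (Fin n) =>
          mehler n q.1 z.1 q.2.1 z.2 * φ z.2 :=
        ((continuous_mehler n q.1).comp (f := fun z : ℝ × EuclideanSpace ℝ (Fin n) =>
          (z.1, q.2.1, z.2)) (by fun_prop)).mul (hφ.comp continuous_snd)
      exact hc.stronglyMeasurable.integral_prod_right
    have h2 : Continuous fun ξ : ℝ => Complex.exp (2 * Real.pi * Complex.I * ξ * q.2.2) := by
      fun_prop
    exact (h2.aestronglyMeasurable.mul hFi.aestronglyMeasurable).mul
      (Complex.continuous_ofReal.comp_stronglyMeasurable h1).aestronglyMeasurable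
  · filter_upwards [hpos] with q hq
    refine .of_forall fun ξ => ?_
    rw [norm_mul, norm_mul, norm_exp_two_pi_mul, one_mul, Complex.norm_real]
    gcongr
    exact abs_integral_mehler_mul_le hq ξ q.2.1 hM
  · refine .of_forall fun ξ => ?_
    have h1 : Tendsto (fun q : ℝ × Space n => Complex.exp (2 * Real.pi * Complex.I * ξ * q.2.2))
        (𝓝[>] 0 ×ˢ 𝓝 g₀) (𝓝 (Complex.exp (2 * Real.pi * Complex.I * ξ * g₀.2))) := by
      have hc : Continuous fun y : Space n =>
        Complex.exp (2 * Real.pi * Complex.I * ξ * y.2) := by fun_prop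
      exact (hc.tendsto g₀).comp tendsto_snd
    have h2 : Tendsto (fun q : ℝ × Space n => (q.1, q.2.1)) (𝓝[>] 0 ×ˢ 𝓝 g₀)
        (𝓝[>] 0 ×ˢ 𝓝 g₀.1) :=
      tendsto_fst.prodMk ((continuous_fst.tendsto g₀).comp tendsto_snd)
    have h3 := (tendsto_integral_mehler_mul hφ hM ξ g₀.1).comp h2
    exact (h1.mul_const _).mul ((Complex.continuous_ofReal.tendsto _).comp h3)

/-! ### Positivity and conservation of mass -/

/-- A smooth bump of product form: `1` on the closed ball of radius `r / 2` around `g₀` and `0`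
outside the ball of radius `r`. -/
noncomputable def productBump {n : ℕ} (g₀ : Space n) {r : ℝ} (hr : 0 < r) (g : Space n) : ℝ :=
  (⟨r / 2, r, by positivity, by linarith⟩ : ContDiffBump g₀.1) g.1 *
    (⟨r / 2, r, by positivity, by linarith⟩ : ContDiffBump g₀.2) g.2

section productBump

variable {n : ℕ} (g₀ : Space n) {r : ℝ} (hr : 0 < r)

lemma productBump_nonneg (g : Space n) : 0 ≤ productBump g₀ hr g :=
  mul_nonneg (ContDiffBump.nonneg _) (ContDiffBump.nonneg _)

lemma productBump_le_one (g : Space n) : productBump g₀ hr g ≤ 1 :=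
  mul_le_one₀ (ContDiffBump.le_one _) (ContDiffBump.nonneg _) (ContDiffBump.le_one _)

lemma productBump_eq_one {g : Space n} (hg : dist g g₀ ≤ r / 2) : productBump g₀ hr g = 1 := by
  rw [Prod.dist_eq, max_le_iff] at hg
  rw [productBump, ContDiffBump.one_of_mem_closedBall _ (Metric.mem_closedBall.2 hg.1),
    ContDiffBump.one_of_mem_closedBall _ (Metric.mem_closedBall.2 hg.2), one_mul]

lemma productBump_eq_zero {g : Space n} (hg : r ≤ dist g g₀) : productBump g₀ hr g = 0 := by
  rw [Prod.dist_eq, le_max_iff] at hg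
  rcases hg with hg | hg
  · exact mul_eq_zero_of_left (ContDiffBump.zero_of_le_dist _ hg) _
  · exact mul_eq_zero_of_right _ (ContDiffBump.zero_of_le_dist _ hg)

lemma continuous_productBump : Continuous (productBump g₀ hr) :=
  ((ContDiffBump.continuous _).comp continuous_fst).mul
    ((ContDiffBump.continuous _).comp continuous_snd)

lemma hasCompactSupport_productBump : HasCompactSupport (productBump g₀ hr) := by
  refine HasCompactSupport.of_support_subset_isCompact (isCompact_closedBall g₀ r) fun g hg => ?_
  by_contra h
  rw [Metric.mem_closedBall, not_le] at h
  exact hg (productBump_eq_zero g₀ hr h.le)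

end productBump

lemma isSolution_kernel_mul {n : ℕ} (hn : 2 ≤ n) {f : Space n → ℝ} (hf : Continuous f)
    (hfs : HasCompactSupport f) : IsSolution n fun h g => ∫ g', kernel n h g g' * f g' :=
  isSolution_integral_mul (contDiffOn_kernel hn) (fun _ hh g g' => kernel_heat_eq hn hh g g') hf hfs

lemma exists_bound_integral_kernel_mul_productBump {n : ℕ} (hn : 2 ≤ n) (g₀ : Space n) {r : ℝ}
    (hr : 0 < r) : ∃ B : ℝ, ∀ h, 0 < h → ∀ g,
      |∫ g', kernel n h g g' * productBump g₀ hr g'| ≤ B :=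
  ⟨_, fun _ hh g => abs_integral_kernel_mul_tensor_le hn (ContDiffBump.continuous _)
    (ContDiffBump.hasCompactSupport _) (ContDiffBump.contDiff _) (ContDiffBump.hasCompactSupport _)
    (M := 1) (fun y => by
      rw [abs_of_nonneg (ContDiffBump.nonneg _)]; exact ContDiffBump.le_one _) hh g⟩

lemma tendsto_integral_kernel_mul_productBump {n : ℕ} (hn : 2 ≤ n) (g₀ : Space n) {r : ℝ}
    (hr : 0 < r) (g₁ : Space n) : Tendsto (fun q : ℝ × Space n =>
        ∫ g', kernel n q.1 q.2 g' * productBump g₀ hr g') (𝓝[>] 0 ×ˢ 𝓝 g₁)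
      (𝓝 (productBump g₀ hr g₁)) :=
  tendsto_integral_kernel_mul_tensor hn (ContDiffBump.continuous _)
    (ContDiffBump.hasCompactSupport _) (ContDiffBump.contDiff _) (ContDiffBump.hasCompactSupport _)
    g₁

lemma integral_kernel_mul_productBump_nonneg {n : ℕ} (hn : 2 ≤ n) (g₀ : Space n) {r : ℝ}
    (hr : 0 < r) {h : ℝ} (hh : 0 < h) (g : Space n) :
    0 ≤ ∫ g', kernel n h g g' * productBump g₀ hr g' := by
  obtain ⟨B, hB⟩ := exists_bound_integral_kernel_mul_productBump hn g₀ hr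
  have := (isSolution_kernel_mul hn (continuous_productBump g₀ hr)
    (hasCompactSupport_productBump g₀ hr)).neg_barrier_le (M := B) (η := 0)
    (fun h hh g => (abs_le.1 (hB h hh g)).1) le_rfl (fun g₁ ε hε =>
      (tendsto_integral_kernel_mul_productBump hn g₀ hr g₁).eventually (lt_mem_nhds (by
        have := productBump_nonneg g₀ hr g₁
        linarith))) hh g
  simpa using this

/-- The kernel is nonnegative, since its integrals against all bumps are. -/
lemma kernel_nonneg {n : ℕ} (hn : 2 ≤ n) {h : ℝ} (hh : 0 < h) (g g' : Space n) :
    0 ≤ kernel n h g g' := by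
  by_contra! hneg
  have hc := continuous_kernel hn hh g
  obtain ⟨r, hr, hball⟩ := Metric.eventually_nhds_iff.1 (hc.tendsto g' |>.eventually
    (gt_mem_nhds hneg))
  have h1 := integral_kernel_mul_productBump_nonneg hn g' hr hh g
  have h2 : 0 < ∫ y, -(kernel n h g y * productBump g' hr y) := by
    refine (Continuous.integral_pos_of_hasCompactSupport_nonneg_nonzero (x := g')
      (hc.mul (continuous_productBump g' hr)).neg
      ((hasCompactSupport_productBump g' hr).mul_left.neg) (fun y => ?_) ?_)
    · by_cases hy : dist y g' < r
      · have := mul_nonneg (neg_nonneg.2 (hball hy).le) (productBump_nonneg g' hr y)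
        simpa using this
      · simp [productBump_eq_zero g' hr (not_lt.1 hy)]
    · rw [productBump_eq_one g' hr (by simp; positivity), mul_one]
      exact (neg_pos.2 hneg).ne'
  rw [integral_neg] at h2
  linarith

/-- The minimum principle for `1 - w`, where `w` is the evolution of a bump. -/
lemma integral_kernel_mul_productBump_le_one {n : ℕ} (hn : 2 ≤ n) (g₀ : Space n) {r : ℝ}
    (hr : 0 < r) {h : ℝ} (hh : 0 < h) (g : Space n) :
    ∫ g', kernel n h g g' * productBump g₀ hr g' ≤ 1 := by
  obtain ⟨B, hB⟩ := exists_bound_integral_kernel_mul_productBump hn g₀ hr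
  have hsol := (isSolution_const n 1).linComb (isSolution_kernel_mul hn
    (continuous_productBump g₀ hr) (hasCompactSupport_productBump g₀ hr)) 1 (-1)
  have := hsol.neg_barrier_le (M := B) (η := 0)
    (fun h hh g => by linarith [(abs_le.1 (hB h hh g)).2]) le_rfl (fun g₁ ε hε =>
      (((tendsto_integral_kernel_mul_productBump hn g₀ hr g₁).const_mul (-1)).const_add
        (1 * 1)).eventually (lt_mem_nhds (by
        have := productBump_le_one g₀ hr g₁
        linarith))) hh g
  simp only [zero_mul, neg_zero] at this
  linarith

/-- The minimum principle for `w - 1`, where `w` is the evolution of a bump of radius `r` at the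
origin: initially `w - 1` vanishes on the ball of radius `r / 2` and is at least `-1` elsewhere, so
it lies above `-(2/r)²` times the barrier. -/
lemma le_integral_kernel_mul_productBump {n : ℕ} (hn : 2 ≤ n) {r : ℝ}
    (hr : 0 < r) {h : ℝ} (hh : 0 < h) (g : Space n) :
    1 - (2 / r) ^ 2 * Real.exp ((2 * n + 3) * h) * barrier g
      ≤ ∫ g', kernel n h g g' * productBump 0 hr g' := by
  obtain ⟨B, hB⟩ := exists_bound_integral_kernel_mul_productBump hn (0 : Space n) hr
  have hsol := (isSolution_kernel_mul hn (continuous_productBump (0 : Space n) hr)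
    (hasCompactSupport_productBump 0 hr)).linComb (isSolution_const n 1) 1 (-1)
  have := hsol.neg_barrier_le (M := B + 1) (η := (2 / r) ^ 2)
    (fun h hh g => by linarith [(abs_le.1 (hB h hh g)).1]) (by positivity) (fun g₁ ε hε =>
      (((tendsto_integral_kernel_mul_productBump hn 0 hr g₁).const_mul 1).add_const
        (-1 * 1)).eventually (lt_mem_nhds (by
        -- the bump is at least `1 - (2/r)² ψ`, as `ψ ≥ (r/2)²` where the bump is not `1`
        rcases le_or_gt (dist g₁ 0) (r / 2) with h1 | h1
        · rw [productBump_eq_one 0 hr h1]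
          have := one_le_barrier g₁
          have : 0 ≤ (2 / r) ^ 2 * barrier g₁ := by positivity
          linarith
        · have h2 := productBump_nonneg 0 hr g₁
          have h3 : (r / 2) ^ 2 ≤ barrier g₁ := by
            rw [dist_zero_right] at h1
            exact (pow_le_pow_left₀ (by positivity) h1.le 2).trans (norm_sq_le_barrier g₁)
          have h4 : 1 ≤ (2 / r) ^ 2 * barrier g₁ := by
            calc (1 : ℝ) = (2 / r) ^ 2 * (r / 2) ^ 2 := by field_simp
              _ ≤ _ := by gcongr
          linarith))) hh g
  linarith

lemma integrable_kernel {n : ℕ} (hn : 2 ≤ n) {h : ℝ} (hh : 0 < h) (g : Space n) :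
    Integrable (kernel n h g) := by
  have hc := continuous_kernel hn hh g
  have hcover := aecover_closedBall (μ := (volume : Measure (Space n))) (x := (0 : Space n))
    (l := atTop) (r := fun k : ℕ => (k : ℝ)) tendsto_natCast_atTop_atTop
  refine hcover.integrable_of_integral_norm_bounded 1
    (fun k => hc.continuousOn.integrableOn_compact (isCompact_closedBall _ _)) ?_
  filter_upwards [eventually_gt_atTop 0] with k hk
  have hr : (0 : ℝ) < 2 * k := by positivity
  have hi : Integrable fun y => kernel n h g y * productBump 0 hr y :=
    (hc.mul (continuous_productBump 0 hr)).integrable_of_hasCompactSupport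
      (hasCompactSupport_productBump 0 hr).mul_left
  refine le_trans ?_ (integral_kernel_mul_productBump_le_one hn 0 hr hh g)
  refine le_trans (le_of_eq ?_) (setIntegral_le_integral
    (s := Metric.closedBall (0 : Space n) (k : ℝ)) hi (.of_forall fun y =>
      mul_nonneg (kernel_nonneg hn hh g y) (productBump_nonneg 0 hr y)))
  refine setIntegral_congr_fun measurableSet_closedBall fun y hy => ?_
  rw [Real.norm_of_nonneg (kernel_nonneg hn hh g y), productBump_eq_one 0 hr (by
    rw [Metric.mem_closedBall] at hy
    linarith), mul_one]

/-- The heat semigroup conserves mass. -/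
lemma integral_kernel {n : ℕ} (hn : 2 ≤ n) {h : ℝ} (hh : 0 < h) (g : Space n) :
    ∫ g', kernel n h g g' = 1 := by
  have hpos : ∀ k : ℕ, (0 : ℝ) < 2 * (k + 1 : ℕ) := fun k => by positivity
  have hk : Tendsto (fun k : ℕ => (2 : ℝ) * (k + 1 : ℕ)) atTop atTop :=
    ((tendsto_natCast_atTop_atTop (R := ℝ)).comp (tendsto_add_atTop_nat 1)).const_mul_atTop
      two_pos
  have h1 : Tendsto (fun k : ℕ => ∫ g', kernel n h g g' * productBump 0 (hpos k) g') atTop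
      (𝓝 (∫ g', kernel n h g g')) := by
    refine tendsto_integral_of_dominated_convergence (fun g' => kernel n h g g')
      (fun k => ((continuous_kernel hn hh g).mul
        (continuous_productBump 0 (hpos k))).aestronglyMeasurable) (integrable_kernel hn hh g)
      (fun k => .of_forall fun y => ?_) (.of_forall fun y => ?_)
    · rw [norm_mul, Real.norm_of_nonneg (kernel_nonneg hn hh g y),
        Real.norm_of_nonneg (productBump_nonneg 0 (hpos k) y)]
      exact mul_le_of_le_one_right (kernel_nonneg hn hh g y) (productBump_le_one 0 (hpos k) y)
    · refine tendsto_const_nhds.congr' ?_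
      filter_upwards [hk.eventually_ge_atTop (2 * dist y 0)] with k hk
      rw [productBump_eq_one 0 (hpos k) (by linarith), mul_one]
  have h2 : Tendsto (fun k : ℕ => ∫ g', kernel n h g g' * productBump 0 (hpos k) g') atTop
      (𝓝 1) := by
    refine tendsto_of_tendsto_of_tendsto_of_le_of_le (g := fun k : ℕ =>
      1 - (2 / ((2 : ℝ) * (k + 1 : ℕ))) ^ 2 * Real.exp ((2 * n + 3) * h) * barrier g) ?_
      tendsto_const_nhds (fun k => le_integral_kernel_mul_productBump hn (hpos k) hh g)
      (fun k => integral_kernel_mul_productBump_le_one hn 0 (hpos k) hh g)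
    have := ((((hk.const_div_atTop 2).pow 2).mul_const (Real.exp ((2 * n + 3) * h))).mul_const
      (barrier g)).const_sub 1
    simpa using this
  exact tendsto_nhds_unique h1 h2

lemma integrable_kernel_mul {n : ℕ} (hn : 2 ≤ n) {h : ℝ} (hh : 0 < h) (g : Space n)
    {f : Space n → ℝ} (hf : Continuous f) {M : ℝ} (hM : ∀ y, |f y| ≤ M) :
    Integrable fun g' => kernel n h g g' * f g' :=
  (integrable_kernel hn hh g).mul_bdd (c := M) hf.aestronglyMeasurable (.of_forall hM)

/-- The kernel concentrates at its base point, jointly in time and base point: the mass outside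
a ball is at most `1` minus the integral of a bump supported there. -/
lemma tendsto_integral_kernel_mul {n : ℕ} (hn : 2 ≤ n) {f : Space n → ℝ} (hf : Continuous f)
    {M : ℝ} (hM : ∀ y, |f y| ≤ M) (g₀ : Space n) :
    Tendsto (fun q : ℝ × Space n => ∫ g', kernel n q.1 q.2 g' * f g') (𝓝[>] 0 ×ˢ 𝓝 g₀)
      (𝓝 (f g₀)) := by
  have hM0 : 0 ≤ M := (abs_nonneg _).trans (hM g₀)
  rw [Metric.tendsto_nhds]
  intro ε hε
  obtain ⟨r, hr, hball⟩ := Metric.continuous_iff.1 hf g₀ (ε / 2) (by positivity)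
  have h1 := (((tendsto_integral_kernel_mul_productBump hn g₀ hr g₀).const_sub 1).const_mul
    (2 * M)).const_add (ε / 2)
  rw [productBump_eq_one g₀ hr (by simp; positivity)] at h1
  have hpos : ∀ᶠ q : ℝ × Space n in 𝓝[>] 0 ×ˢ 𝓝 g₀, 0 < q.1 :=
    tendsto_fst.eventually self_mem_nhdsWithin
  filter_upwards [hpos, h1.eventually (gt_mem_nhds
    (show ε / 2 + 2 * M * (1 - 1) < ε by linarith))] with q hq hlt
  have i0 := integrable_kernel hn hq q.2
  have i1 := integrable_kernel_mul hn hq q.2 hf hM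
  have i2 := integrable_kernel_mul hn hq q.2 (continuous_productBump g₀ hr) (M := 1) fun y => by
    rw [abs_of_nonneg (productBump_nonneg g₀ hr y)]; exact productBump_le_one g₀ hr y
  have e1 : (∫ g', kernel n q.1 q.2 g' * f g') - f g₀
      = ∫ g', kernel n q.1 q.2 g' * (f g' - f g₀) := by
    simp_rw [mul_sub]
    rw [integral_sub i1 (i0.mul_const _), integral_mul_const, integral_kernel hn hq, one_mul]
  have e2 : ∫ g', kernel n q.1 q.2 g' * (ε / 2 + 2 * M * (1 - productBump g₀ hr g'))
      = ε / 2 + 2 * M * (1 - ∫ g', kernel n q.1 q.2 g' * productBump g₀ hr g') := by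
    have : ∀ g', kernel n q.1 q.2 g' * (ε / 2 + 2 * M * (1 - productBump g₀ hr g'))
        = kernel n q.1 q.2 g' * (ε / 2 + 2 * M)
          - kernel n q.1 q.2 g' * productBump g₀ hr g' * (2 * M) := fun g' => by ring
    simp_rw [this]
    rw [integral_sub (i0.mul_const _) (i2.mul_const _), integral_mul_const, integral_mul_const,
      integral_kernel hn hq]
    ring
  have i3 : Integrable fun g' =>
      kernel n q.1 q.2 g' * (ε / 2 + 2 * M * (1 - productBump g₀ hr g')) := by
    refine ((i0.mul_const (ε / 2 + 2 * M)).sub (i2.mul_const (2 * M))).congr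
      (.of_forall fun g' => ?_)
    simp only [Pi.sub_apply]
    ring
  rw [Real.dist_eq, e1, ← Real.norm_eq_abs]
  refine lt_of_le_of_lt (norm_integral_le_of_norm_le i3 (.of_forall fun y => ?_)) (e2 ▸ hlt)
  rw [norm_mul, Real.norm_of_nonneg (kernel_nonneg hn hq q.2 y)]
  refine mul_le_mul_of_nonneg_left ?_ (kernel_nonneg hn hq q.2 y)
  have hb1 := productBump_le_one g₀ hr y
  rcases lt_or_ge (dist y g₀) r with hy | hy
  · have h3 := (hball y hy).le
    rw [Real.dist_eq] at h3
    have h4 : 0 ≤ 2 * M * (1 - productBump g₀ hr y) :=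
      mul_nonneg (by positivity) (by linarith)
    rw [Real.norm_eq_abs]
    linarith
  · rw [productBump_eq_zero g₀ hr hy, Real.norm_eq_abs]
    have h3 := abs_sub (f y) (f g₀)
    have h4 := hM y
    have h5 := hM g₀
    linarith

theorem isHeatKernel_kernel {n : ℕ} (hn : 2 ≤ n) : IsHeatKernel n (kernel n) := by
  refine ⟨contDiffOn_kernel hn, fun h hh g g' => kernel_nonneg hn hh g g',
    fun h hh g g' => kernel_heat_eq hn hh g g', fun h hh g => integrable_kernel hn hh g,
    fun h hh g => (integral_kernel hn hh g).le, fun f hf hfs g => ?_⟩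
  obtain ⟨M, hM⟩ := hfs.exists_bound_of_continuous hf
  have h : Tendsto (fun h : ℝ => (h, g)) (𝓝[>] 0) (𝓝[>] 0 ×ˢ 𝓝 g) :=
    tendsto_id.prodMk tendsto_const_nhds
  have h1 := (tendsto_integral_kernel_mul hn hf hM g).comp h
  simpa only [Function.comp_def] using h1

end Grushin

/-! ### Uniqueness of the heat kernel -/

namespace Grushin

lemma IsSolution.tendsto_shift {n : ℕ} {V : ℝ → Space n → ℝ} (hV : IsSolution n V) {e : ℝ}
    (he : 0 < e) (g₀ : Space n) :
    Tendsto (fun q : ℝ × Space n => V (e + q.1) q.2) (𝓝[>] 0 ×ˢ 𝓝 g₀) (𝓝 (V e g₀)) := by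
  have hopen : IsOpen (Ioi (0 : ℝ) ×ˢ (univ : Set (Space n))) := isOpen_Ioi.prod isOpen_univ
  have h1 : ContinuousAt (fun q : ℝ × Space n => V q.1 q.2) (e, g₀) :=
    hV.1.continuousOn.continuousAt (hopen.mem_nhds ⟨he, mem_univ _⟩)
  have h2 : Tendsto (fun q : ℝ × Space n => (e + q.1, q.2)) (𝓝[>] 0 ×ˢ 𝓝 g₀) (𝓝 (e, g₀)) := by
    have hc : Continuous fun q : ℝ × Space n => (e + q.1, q.2) := by fun_prop
    have := hc.tendsto (0, g₀)
    simp only [add_zero, nhds_prod_eq (x := (0 : ℝ))] at this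
    exact this.mono_left (Filter.prod_mono nhdsWithin_le_nhds le_rfl)
  have h3 := h1.tendsto.comp h2
  simpa only [Function.comp_def] using h3

/-- A bounded nonnegative solution dominates the evolution of any cut-off of its value at an
earlier time. -/
lemma IsSolution.integral_kernel_mul_le {n : ℕ} (hn : 2 ≤ n) {V : ℝ → Space n → ℝ}
    (hV : IsSolution n V) {B : ℝ} (h0 : ∀ h, 0 < h → ∀ g, 0 ≤ V h g)
    (hB : ∀ h, 0 < h → ∀ g, V h g ≤ B) {e : ℝ} (he : 0 < e) {χ : Space n → ℝ}
    (hχ : Continuous χ) (hχs : HasCompactSupport χ) (hχ0 : ∀ y, 0 ≤ χ y) (hχ1 : ∀ y, χ y ≤ 1)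
    {t : ℝ} (ht : 0 < t) (g : Space n) :
    ∫ y, kernel n t g y * (V e y * χ y) ≤ V (e + t) g := by
  have hB0 : 0 ≤ B := (h0 e he g).trans (hB e he g)
  have hVe : Continuous (V e) := (hV.contDiff he).continuous
  have hle : ∀ y, V e y * χ y ≤ V e y := fun y => mul_le_of_le_one_right (h0 e he y) (hχ1 y)
  have habs : ∀ y, |V e y * χ y| ≤ B := fun y => by
    rw [abs_of_nonneg (mul_nonneg (h0 e he y) (hχ0 y))]
    exact (hle y).trans (hB e he y)
  have hf : Continuous fun y => V e y * χ y := hVe.mul hχ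
  have hsol := (hV.shift he.le).linComb (isSolution_kernel_mul hn hf hχs.mul_left) 1 (-1)
  have hw : ∀ t, 0 < t → ∀ g, ∫ y, kernel n t g y * (V e y * χ y) ≤ B := by
    intro t ht g
    calc ∫ y, kernel n t g y * (V e y * χ y) ≤ ∫ y, kernel n t g y * B := by
          refine integral_mono (integrable_kernel_mul hn ht g hf habs)
            ((integrable_kernel hn ht g).mul_const B) fun y => ?_
          exact mul_le_mul_of_nonneg_left ((le_abs_self _).trans (habs y))
            (kernel_nonneg hn ht g y)
      _ = B := by rw [integral_mul_const, integral_kernel hn ht, one_mul]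
  have := hsol.neg_barrier_le (M := B) (η := 0)
    (fun t ht g => by
      have h1 := h0 (e + t) (by linarith) g
      have h2 := hw t ht g
      linarith) le_rfl (fun g₁ ε hε =>
      (((hV.tendsto_shift he g₁).const_mul 1).add
        ((tendsto_integral_kernel_mul hn hf habs g₁).const_mul (-1))).eventually
        (lt_mem_nhds (by
          have := hle g₁
          linarith))) ht g
  simp only [zero_mul, neg_zero] at this
  linarith

lemma exists_cutoff (n : ℕ) : ∃ χ : ℕ → Space n → ℝ, (∀ k, Continuous (χ k)) ∧
    (∀ k, HasCompactSupport (χ k)) ∧ (∀ k y, 0 ≤ χ k y) ∧ (∀ k y, χ k y ≤ 1) ∧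
    ∀ y, Tendsto (fun k => χ k y) atTop (𝓝 1) := by
  have hpos : ∀ k : ℕ, (0 : ℝ) < 2 * (k + 1 : ℕ) := fun k => by positivity
  have hk : Tendsto (fun k : ℕ => (2 : ℝ) * (k + 1 : ℕ)) atTop atTop :=
    ((tendsto_natCast_atTop_atTop (R := ℝ)).comp (tendsto_add_atTop_nat 1)).const_mul_atTop
      two_pos
  refine ⟨fun k => productBump 0 (hpos k), fun k => continuous_productBump _ _,
    fun k => hasCompactSupport_productBump _ _, fun k => productBump_nonneg _ _,
    fun k => productBump_le_one _ _, fun y => tendsto_const_nhds.congr' ?_⟩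
  filter_upwards [hk.eventually_ge_atTop (2 * dist y 0)] with k hk
  rw [productBump_eq_one 0 (hpos k) (by linarith)]

lemma tendsto_integral_kernel_mul_cutoff {n : ℕ} (hn : 2 ≤ n) {t : ℝ} (ht : 0 < t) (g : Space n)
    {f : ℕ → Space n → ℝ} {f₀ : Space n → ℝ} {M : ℝ} (hf : ∀ k, Continuous (f k))
    (hM : ∀ k y, |f k y| ≤ M) (hlim : ∀ y, Tendsto (fun k => f k y) atTop (𝓝 (f₀ y))) :
    Tendsto (fun k => ∫ y, kernel n t g y * f k y) atTop (𝓝 (∫ y, kernel n t g y * f₀ y)) := by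
  refine tendsto_integral_of_dominated_convergence (fun y => kernel n t g y * M)
    (fun k => ((continuous_kernel hn ht g).mul (hf k)).aestronglyMeasurable)
    ((integrable_kernel hn ht g).mul_const M) (fun k => .of_forall fun y => ?_)
    (.of_forall fun y => (hlim y).const_mul _)
  rw [norm_mul, Real.norm_of_nonneg (kernel_nonneg hn ht g y)]
  exact mul_le_mul_of_nonneg_left (hM k y) (kernel_nonneg hn ht g y)

/-- Bounded solutions are propagated by the kernel: the domination of cut-offs is applied to
`M + v` and `M - v`, whose sum has total mass `2 M`. -/
lemma IsSolution.eq_integral_kernel_mul {n : ℕ} (hn : 2 ≤ n) {v : ℝ → Space n → ℝ}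
    (hv : IsSolution n v) {M : ℝ} (hM : ∀ h, 0 < h → ∀ g, |v h g| ≤ M) {e : ℝ} (he : 0 < e)
    {t : ℝ} (ht : 0 < t) (g : Space n) : ∫ y, kernel n t g y * v e y = v (e + t) g := by
  obtain ⟨χ, hχ, hχs, hχ0, hχ1, hχlim⟩ := exists_cutoff n
  have hve : Continuous (v e) := (hv.contDiff he).continuous
  have i0 := integrable_kernel hn ht g
  have i1 := integrable_kernel_mul hn ht g hve (hM e he)
  have key : ∀ c : ℝ, |c| = 1 →
      ∫ y, kernel n t g y * (M * 1 + c * v e y) ≤ M + c * v (e + t) g := by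
    intro c hc
    have hcv : ∀ h, 0 < h → ∀ y, |c * v h y| ≤ M := fun h hh y => by
      rw [abs_mul, hc, one_mul]; exact hM h hh y
    have hsol := (isSolution_const n 1).linComb hv M c
    have h0 : ∀ h, 0 < h → ∀ y, 0 ≤ M * 1 + c * v h y := fun h hh y => by
      linarith [(abs_le.1 (hcv h hh y)).1]
    have h2 : ∀ h, 0 < h → ∀ y, M * 1 + c * v h y ≤ 2 * M := fun h hh y => by
      linarith [(abs_le.1 (hcv h hh y)).2]
    have hlim := tendsto_integral_kernel_mul_cutoff hn ht g (M := 2 * M)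
      (f := fun k y => (M * 1 + c * v e y) * χ k y) (f₀ := fun y => (M * 1 + c * v e y))
      (fun k => (continuous_const.add (continuous_const.mul hve)).mul (hχ k))
      (fun k y => by
        rw [abs_of_nonneg (mul_nonneg (h0 e he y) (hχ0 k y))]
        exact (mul_le_of_le_one_right (h0 e he y) (hχ1 k y)).trans (h2 e he y))
      (fun y => by simpa using (hχlim y).const_mul (M * 1 + c * v e y))
    refine le_of_tendsto hlim (.of_forall fun k => ?_)
    have := hsol.integral_kernel_mul_le hn h0 h2 he (hχ k) (hχs k) (hχ0 k) (hχ1 k) ht g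
    simpa using this
  have hsplit : ∀ c : ℝ, ∫ y, kernel n t g y * (M * 1 + c * v e y)
      = M + c * ∫ y, kernel n t g y * v e y := by
    intro c
    have : ∀ y, kernel n t g y * (M * 1 + c * v e y)
        = kernel n t g y * M + c * (kernel n t g y * v e y) := fun y => by ring
    simp_rw [this]
    rw [integral_add (i0.mul_const M) (i1.const_mul c), integral_mul_const, integral_const_mul,
      integral_kernel hn ht, one_mul]
  have k1 := key 1 (by simp)
  have k2 := key (-1) (by simp)
  rw [hsplit] at k1 k2
  linarith

/-- Every heat kernel agrees with the explicit one: for a test function `f` the solution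
`∫ p f` is bounded, hence propagated by `kernel` from each earlier time, and its initial value
is `f`. -/
theorem IsHeatKernel.eq_kernel {n : ℕ} (hn : 2 ≤ n) {p : ℝ → Space n → Space n → ℝ}
    (hp : IsHeatKernel n p) {h : ℝ} (hh : 0 < h) (g g' : Space n) : p h g g' = kernel n h g g' := by
  have hpc : Continuous (p h g) := by
    rw [← continuousOn_univ]
    exact hp.smooth.continuousOn.comp (f := fun y : Space n => (h, g, y)) (by fun_prop)
      fun y _ => ⟨hh, mem_univ _⟩
  have hkc := continuous_kernel hn hh g
  suffices H : p h g =ᵐ[volume] kernel n h g from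
    congrFun ((Continuous.ae_eq_iff_eq _ hpc hkc).1 H) g'
  refine ae_eq_of_integral_contDiff_smul_eq hpc.locallyIntegrable hkc.locallyIntegrable
    fun f hfd hfs => ?_
  have hf := hfd.continuous
  obtain ⟨M, hM⟩ := hfs.exists_bound_of_continuous hf
  have hM' : ∀ y, |f y| ≤ M := hM
  have hsol := isSolution_integral_mul hp.smooth hp.heat_eq hf hfs
  set v : ℝ → Space n → ℝ := fun h g => ∫ g', p h g g' * f g' with hv
  have hvM : ∀ h, 0 < h → ∀ g, |v h g| ≤ M := by
    intro h hh g
    have hM0 : 0 ≤ M := (abs_nonneg _).trans (hM' g)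
    rw [← Real.norm_eq_abs]
    refine (norm_integral_le_of_norm_le ((hp.integrable h hh g).mul_const M)
      (.of_forall fun y => ?_)).trans ?_
    · rw [norm_mul, Real.norm_of_nonneg (hp.nonneg h hh g y)]
      exact mul_le_mul_of_nonneg_left (hM y) (hp.nonneg h hh g y)
    · rw [integral_mul_const]
      exact mul_le_of_le_one_left hM0 (hp.mass_le_one h hh g)
  -- let the earlier time tend to zero in the propagation identity
  let e : ℕ → ℝ := fun k => 1 / ((k : ℝ) + 1)
  have he : ∀ k, 0 < e k := fun k => Nat.one_div_pos_of_nat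
  have he0 : Tendsto e atTop (𝓝 0) := tendsto_one_div_add_atTop_nhds_zero_nat
  have he0' : Tendsto e atTop (𝓝[>] 0) :=
    tendsto_nhdsWithin_iff.2 ⟨he0, .of_forall he⟩
  have h1 : Tendsto (fun k => ∫ y, kernel n h g y * v (e k) y) atTop
      (𝓝 (∫ y, kernel n h g y * f y)) :=
    tendsto_integral_kernel_mul_cutoff hn hh g (fun k => (hsol.contDiff (he k)).continuous)
      (fun k y => hvM (e k) (he k) y) fun y => (hp.initial f hf hfs y).comp he0'
  have h2 : Tendsto (fun k => v (e k + h) g) atTop (𝓝 (v h g)) := by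
    have hc := (hsol.differentiableAt hh g).continuousAt
    have : Tendsto (fun k => e k + h) atTop (𝓝 h) := by simpa using he0.add_const h
    exact hc.tendsto.comp this
  have h3 : (fun k => ∫ y, kernel n h g y * v (e k) y) = fun k => v (e k + h) g :=
    funext fun k => hsol.eq_integral_kernel_mul hn hvM (he k) hh g
  rw [h3] at h1
  have h4 := tendsto_nhds_unique h2 h1
  simp only [smul_eq_mul]
  simp_rw [mul_comm (f _)]
  exact h4

end Grushin

/-! ### Shifting a horizontal line of integration -/

namespace Grushin

/-- A horizontal line of integration may be shifted across a strip of holomorphy on which the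
function decays uniformly. -/
lemma integral_eq_integral_add_mul_I {F : ℂ → ℂ} {θ : ℝ} (hθ : 0 ≤ θ)
    (hd : ∀ z : ℂ, 0 ≤ z.im → z.im ≤ θ → DifferentiableAt ℂ F z)
    (h0 : Integrable fun t : ℝ => F t) (h1 : Integrable fun t : ℝ => F (t + θ * Complex.I))
    {B : ℝ → ℝ} (hB : Tendsto B atTop (𝓝 0))
    (hdecay : ∀ᶠ T in atTop, ∀ y ∈ Icc 0 θ,
      ‖F ((T : ℝ) + y * Complex.I)‖ ≤ B T ∧ ‖F ((-T : ℝ) + y * Complex.I)‖ ≤ B T) :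
    ∫ t : ℝ, F t = ∫ t : ℝ, F (t + θ * Complex.I) := by
  have hrect : ∀ T : ℝ, (∫ x : ℝ in -T..T, F x) - (∫ x : ℝ in -T..T, F (x + θ * Complex.I))
      = Complex.I * (∫ y : ℝ in 0..θ, F ((-T : ℝ) + y * Complex.I))
        - Complex.I * (∫ y : ℝ in 0..θ, F ((T : ℝ) + y * Complex.I)) := by
    intro T
    have h := Complex.integral_boundary_rect_eq_zero_of_differentiableOn F (-T : ℝ)
      (T + θ * Complex.I) (fun z hz => ?_)
    · simp only [Complex.ofReal_re, Complex.ofReal_im, Complex.add_re, Complex.mul_re,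
        Complex.I_re, mul_zero, Complex.I_im, mul_one, sub_zero, add_zero, Complex.add_im,
        Complex.mul_im, zero_add, smul_eq_mul, zero_mul, Complex.ofReal_zero] at h
      linear_combination h
    · have him : z.im ∈ uIcc (0 : ℝ) θ := by simpa using hz.2
      rw [uIcc_of_le hθ] at him
      exact (hd z him.1 him.2).differentiableWithinAt
  have hside : ∀ c : ℝ → ℝ, (∀ᶠ T in atTop, ∀ y ∈ Icc 0 θ, ‖F ((c T : ℝ) + y * Complex.I)‖ ≤ B T) →
      Tendsto (fun T => ∫ y : ℝ in 0..θ, F ((c T : ℝ) + y * Complex.I)) atTop (𝓝 0) := by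
    intro c hc
    have hBθ : Tendsto (fun T => B T * |θ - 0|) atTop (𝓝 0) := by simpa using hB.mul_const |θ - 0|
    refine squeeze_zero_norm' ?_ hBθ
    filter_upwards [hc] with T hT
    refine intervalIntegral.norm_integral_le_of_norm_le_const fun y hy => hT y ?_
    rw [uIoc_of_le hθ] at hy
    exact ⟨hy.1.le, hy.2⟩
  have hr := hside (fun T => T) (hdecay.mono fun T hT y hy => (hT y hy).1)
  have hl := hside (fun T => -T) (hdecay.mono fun T hT y hy => (hT y hy).2)
  have hlim := (hl.const_mul Complex.I).sub (hr.const_mul Complex.I)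
  have hlim' := (intervalIntegral_tendsto_integral h0 tendsto_neg_atTop_atBot tendsto_id).sub
    (intervalIntegral_tendsto_integral h1 tendsto_neg_atTop_atBot tendsto_id)
  have heq := tendsto_nhds_unique (hlim'.congr fun T => hrect T) hlim
  rw [mul_zero, sub_zero] at heq
  exact sub_eq_zero.1 heq

/-! ### Two-sided bounds for the integral of `(1 + κ (cosh t - 1)) ^ (-n/2)` -/

lemma half_sq_le_cosh_sub_one (t : ℝ) : t ^ 2 / 2 ≤ Real.cosh t - 1 := by
  have h := Real.cosh_two_mul (|t| / 2)
  rw [show 2 * (|t| / 2) = |t| by ring, Real.cosh_abs, Real.cosh_sq] at h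
  have h1 : |t| / 2 ≤ Real.sinh (|t| / 2) := Real.self_le_sinh_iff.2 (by positivity)
  have h2 := pow_le_pow_left₀ (show 0 ≤ |t| / 2 by positivity) h1 2
  rw [div_pow, sq_abs] at h2
  linarith

/-- Bernoulli's inequality gives an integrable bound with the right dependence on `n κ`. -/
lemma one_add_mul_cosh_rpow_le {n : ℕ} (hn : 2 ≤ n) {κ : ℝ} (hκ : 0 < κ) (t : ℝ) :
    (1 + κ * (Real.cosh t - 1)) ^ (-((n : ℝ) / 2)) ≤ (1 + (√(n * κ) / 2 * t) ^ 2)⁻¹ := by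
  have hn' : (2 : ℝ) ≤ n := by exact_mod_cast hn
  have hc := half_sq_le_cosh_sub_one t
  have h0 : 0 ≤ κ * (Real.cosh t - 1) := mul_nonneg hκ.le (by nlinarith [sq_nonneg t])
  rw [Real.rpow_neg (by linarith)]
  refine inv_anti₀ (by positivity) ?_
  refine le_trans ?_ (one_add_mul_self_le_rpow_one_add (by linarith) (by linarith))
  rw [mul_pow, div_pow, Real.sq_sqrt (by positivity)]
  have := mul_le_mul_of_nonneg_left hc (show 0 ≤ (n : ℝ) / 2 * κ by positivity)
  linarith

lemma continuous_one_add_mul_cosh_rpow (n : ℕ) {κ : ℝ} (hκ : 0 < κ) :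
    Continuous fun t : ℝ => (1 + κ * (Real.cosh t - 1)) ^ (-((n : ℝ) / 2)) := by
  refine Continuous.rpow_const (by fun_prop) fun t => Or.inl ?_
  have := Real.one_le_cosh t
  have : 0 ≤ κ * (Real.cosh t - 1) := mul_nonneg hκ.le (by linarith)
  linarith

lemma one_add_mul_cosh_rpow_nonneg (n : ℕ) {κ : ℝ} (hκ : 0 < κ) (t : ℝ) :
    0 ≤ (1 + κ * (Real.cosh t - 1)) ^ (-((n : ℝ) / 2)) := by
  have := Real.one_le_cosh t
  have : 0 ≤ κ * (Real.cosh t - 1) := mul_nonneg hκ.le (by linarith)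
  positivity

lemma integrable_one_add_mul_cosh_rpow {n : ℕ} (hn : 2 ≤ n) {κ : ℝ} (hκ : 0 < κ) :
    Integrable fun t : ℝ => (1 + κ * (Real.cosh t - 1)) ^ (-((n : ℝ) / 2)) := by
  have hc : √(n * κ) / 2 ≠ 0 := by positivity
  refine Integrable.mono' (integrable_inv_one_add_sq.comp_mul_left' hc)
    (continuous_one_add_mul_cosh_rpow n hκ).aestronglyMeasurable (.of_forall fun t => ?_)
  rw [Real.norm_of_nonneg (one_add_mul_cosh_rpow_nonneg n hκ t)]
  exact one_add_mul_cosh_rpow_le hn hκ t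

lemma integral_one_add_mul_cosh_rpow_le {n : ℕ} (hn : 2 ≤ n) {κ : ℝ} (hκ : 0 < κ) :
    ∫ t : ℝ, (1 + κ * (Real.cosh t - 1)) ^ (-((n : ℝ) / 2)) ≤ 2 * Real.pi / √(n * κ) := by
  have hc : 0 < √(n * κ) / 2 := by positivity
  calc _ ≤ ∫ t : ℝ, (1 + (√(n * κ) / 2 * t) ^ 2)⁻¹ :=
        integral_mono (integrable_one_add_mul_cosh_rpow hn hκ)
          (integrable_inv_one_add_sq.comp_mul_left' hc.ne') fun t =>
            one_add_mul_cosh_rpow_le hn hκ t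
    _ = 2 * Real.pi / √(n * κ) := by
        rw [Measure.integral_comp_mul_left (fun x : ℝ => (1 + x ^ 2)⁻¹),
          integral_univ_inv_one_add_sq,
          abs_of_pos (inv_pos.2 hc), smul_eq_mul]
        field_simp

/-- On `|t| ≤ 1 / √(n κ)` the integrand is at least `exp (-1/2) ≥ 1/2`. -/
lemma le_integral_one_add_mul_cosh_rpow {n : ℕ} (hn : 2 ≤ n) {κ : ℝ} (hκ : 1 / 2 ≤ κ) :
    1 / √(n * κ) ≤ ∫ t : ℝ, (1 + κ * (Real.cosh t - 1)) ^ (-((n : ℝ) / 2)) := by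
  have hn' : (2 : ℝ) ≤ n := by exact_mod_cast hn
  have hκ0 : 0 < κ := by linarith
  have hnκ : 1 ≤ n * κ := by nlinarith
  set δ := 1 / √(n * κ) with hδ
  have hδ0 : 0 < δ := by positivity
  have hδsq : δ ^ 2 = 1 / (n * κ) := by rw [hδ, div_pow, Real.sq_sqrt (by positivity), one_pow]
  have hδ1 : δ ^ 2 ≤ 1 := by rw [hδsq]; exact (div_le_one (by positivity)).2 hnκ
  have hpt : ∀ t ∈ Icc (-δ) δ, 1 / 2 ≤ (1 + κ * (Real.cosh t - 1)) ^ (-((n : ℝ) / 2)) := by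
    intro t ht
    have ht2 : t ^ 2 ≤ δ ^ 2 := sq_le_sq' ht.1 ht.2
    have hcosh : Real.cosh t - 1 ≤ t ^ 2 := by
      have h1 := Real.cosh_le_exp_half_sq t
      have h2 : Real.exp (t ^ 2 / 2) * (1 - t ^ 2 / 2) ≤ 1 := by
        have := Real.one_sub_le_exp_neg (t ^ 2 / 2)
        calc _ ≤ Real.exp (t ^ 2 / 2) * Real.exp (-(t ^ 2 / 2)) := by gcongr
          _ = 1 := by rw [← Real.exp_add]; simp
      have h3 := Real.exp_pos (t ^ 2 / 2)
      nlinarith [sq_nonneg t, mul_nonneg (sq_nonneg t) (show 0 ≤ 1 - t ^ 2 by linarith)]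
    have hc1 := Real.one_le_cosh t
    have h0 : 0 ≤ κ * (Real.cosh t - 1) := mul_nonneg hκ0.le (by linarith)
    have hle : 1 + κ * (Real.cosh t - 1) ≤ Real.exp (1 / n) := by
      have : κ * (Real.cosh t - 1) ≤ 1 / n := by
        calc κ * (Real.cosh t - 1) ≤ κ * (1 / (n * κ)) := by
              gcongr
              exact hcosh.trans (ht2.trans hδsq.le)
          _ = 1 / n := by field_simp
      linarith [Real.add_one_le_exp (1 / (n : ℝ))]
    rw [Real.rpow_neg (by linarith), one_div]
    refine inv_anti₀ (by positivity) ?_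
    calc (1 + κ * (Real.cosh t - 1)) ^ ((n : ℝ) / 2) ≤ Real.exp (1 / n) ^ ((n : ℝ) / 2) := by
          gcongr
      _ = Real.exp (1 / 2) := by
          rw [← Real.exp_mul]
          congr 1
          field_simp
      _ ≤ 2 := by
          have h1 : Real.exp (1 / 2) * Real.exp (1 / 2) = Real.exp 1 := by
            rw [← Real.exp_add]; norm_num
          have h2 := Real.exp_one_lt_d9
          nlinarith [Real.exp_pos (1 / 2)]
  have hint := integrable_one_add_mul_cosh_rpow hn hκ0
  calc δ = ∫ _t in Icc (-δ) δ, (1 / 2 : ℝ) := by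
        rw [setIntegral_const, measureReal_def, Real.volume_Icc,
          ENNReal.toReal_ofReal (by linarith),
          smul_eq_mul]
        ring
    _ ≤ ∫ t in Icc (-δ) δ, (1 + κ * (Real.cosh t - 1)) ^ (-((n : ℝ) / 2)) :=
        setIntegral_mono_on (by simp) hint.integrableOn measurableSet_Icc hpt
    _ ≤ _ := setIntegral_le_integral hint (.of_forall fun t =>
        one_add_mul_cosh_rpow_nonneg n hκ0 t)

end Grushin

/-! ### The Gamma integral with a complex rate -/

namespace Grushin

lemma integrableOn_rpow_mul_exp_neg_mul {a r : ℝ} (ha : 0 < a) (hr : 0 < r) :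
    IntegrableOn (fun t : ℝ => t ^ (a - 1) * Real.exp (-(r * t))) (Ioi 0) := by
  have h := integrableOn_rpow_mul_exp_neg_mul_rpow (p := 1) (s := a - 1) (b := r) (by linarith)
    one_pos hr
  simpa using h

lemma norm_rpow_mul_cexp {a : ℝ} {r : ℂ} {t : ℝ} (ht : 0 < t) :
    ‖((t ^ (a - 1) : ℝ) : ℂ) * Complex.exp (-(r * t))‖ = t ^ (a - 1) * Real.exp (-(r.re * t)) := by
  rw [norm_mul, Complex.norm_real, Real.norm_of_nonneg (by positivity), Complex.norm_exp]
  simp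

lemma aestronglyMeasurable_rpow_mul_cexp (a : ℝ) (r : ℂ) : AEStronglyMeasurable
    (fun t : ℝ => ((t ^ (a - 1) : ℝ) : ℂ) * Complex.exp (-(r * t))) (volume.restrict (Ioi 0)) := by
  refine ContinuousOn.aestronglyMeasurable ?_ measurableSet_Ioi
  refine ContinuousOn.mul (Complex.continuous_ofReal.comp_continuousOn ?_) (by fun_prop)
  exact continuousOn_id.rpow_const fun t ht => Or.inl (ne_of_gt ht)

/-- The Gamma integral for a complex rate, by analytic continuation from real rates. -/
lemma integral_rpow_mul_cexp {a : ℝ} (ha : 0 < a) {r : ℂ} (hr : 0 < r.re) :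
    ∫ t : ℝ in Ioi 0, ((t ^ (a - 1) : ℝ) : ℂ) * Complex.exp (-(r * t))
      = r ^ (-a : ℂ) * (Real.Gamma a : ℂ) := by
  set U : Set ℂ := {z | 0 < z.re} with hU
  have hUo : IsOpen U := isOpen_lt continuous_const Complex.continuous_re
  have hUc : IsPreconnected U := (convex_halfSpace_re_gt 0).isPreconnected
  have hf : DifferentiableOn ℂ (fun r : ℂ => ∫ t : ℝ in Ioi 0,
      ((t ^ (a - 1) : ℝ) : ℂ) * Complex.exp (-(r * t))) U := by
    intro r hr
    have hr' : 0 < r.re := hr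
    have hs : {z : ℂ | r.re / 2 < z.re} ∈ 𝓝 r :=
      (isOpen_lt continuous_const Complex.continuous_re).mem_nhds (show r.re / 2 < r.re by linarith)
    refine (hasDerivAt_integral_of_dominated_loc_of_deriv_le (𝕜 := ℂ)
      (F' := fun r t => ((t ^ (a - 1) : ℝ) : ℂ) * (Complex.exp (-(r * t)) * -(1 * (t : ℂ))))
      (bound := fun t => t ^ ((a + 1) - 1) * Real.exp (-(r.re / 2 * t))) hs
      (.of_forall fun z => aestronglyMeasurable_rpow_mul_cexp a z) ?_ ?_ ?_ ?_
      ?_).2.differentiableAt.differentiableWithinAt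
    · refine Integrable.mono' (integrableOn_rpow_mul_exp_neg_mul ha hr')
        (aestronglyMeasurable_rpow_mul_cexp a r) ?_
      filter_upwards [ae_restrict_mem measurableSet_Ioi] with t ht
      exact (norm_rpow_mul_cexp ht).le
    · simp_rw [← mul_assoc]
      exact (aestronglyMeasurable_rpow_mul_cexp a r).mul
        (Continuous.aestronglyMeasurable (by fun_prop))
    · filter_upwards [ae_restrict_mem measurableSet_Ioi] with t ht z hz
      have ht' : (0 : ℝ) < t := ht
      rw [← mul_assoc, norm_mul, norm_rpow_mul_cexp ht, one_mul, norm_neg, Complex.norm_real,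
        Real.norm_of_nonneg ht'.le, add_sub_cancel_right]
      have h1 : t ^ (a - 1) * t = t ^ a := by
        rw [Real.rpow_sub_one ht'.ne']; field_simp
      calc t ^ (a - 1) * Real.exp (-(z.re * t)) * t = t ^ a * Real.exp (-(z.re * t)) := by
            rw [← h1]; ring
        _ ≤ _ := by
            have hz' : r.re / 2 < z.re := hz
            gcongr
    · exact integrableOn_rpow_mul_exp_neg_mul (by linarith) (by linarith)
    · refine .of_forall fun t z _ => ?_
      exact (((hasDerivAt_id z).mul_const (t : ℂ)).neg.cexp).const_mul _
  have hg : DifferentiableOn ℂ (fun r : ℂ => r ^ (-a : ℂ) * (Real.Gamma a : ℂ)) U := by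
    intro z hz
    refine DifferentiableAt.differentiableWithinAt ?_
    exact (differentiableAt_id.cpow_const (Or.inl hz)).mul_const _
  have hreal : ∀ x : ℝ, 0 < x → (∫ t : ℝ in Ioi 0,
      ((t ^ (a - 1) : ℝ) : ℂ) * Complex.exp (-((x : ℂ) * t)))
        = (x : ℂ) ^ (-a : ℂ) * (Real.Gamma a : ℂ) := by
    intro x hx
    have h := Real.integral_rpow_mul_exp_neg_mul_Ioi ha hx
    rw [one_div, Real.inv_rpow hx.le, ← Real.rpow_neg hx.le] at h
    rw [← Complex.ofReal_neg, ← Complex.ofReal_cpow hx.le, ← Complex.ofReal_mul, ← h,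
      ← integral_complex_ofReal]
    refine integral_congr_ae (.of_forall fun t => ?_)
    push_cast
    rfl
  refine (hf.analyticOnNhd hUo).eqOn_of_preconnected_of_frequently_eq (hg.analyticOnNhd hUo) hUc
    (show (1 : ℂ) ∈ U by simp [hU]) ?_ hr
  have ht : Tendsto (fun x : ℝ => (x : ℂ)) (𝓝[>] 1) (𝓝[≠] 1) := by
    refine tendsto_nhdsWithin_iff.2 ⟨?_, ?_⟩
    · exact (Complex.continuous_ofReal.tendsto' 1 1 (by simp)).mono_left nhdsWithin_le_nhds
    · filter_upwards [self_mem_nhdsWithin] with x hx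
      have : (1 : ℝ) < x := hx
      simp only [mem_compl_iff, mem_singleton_iff]
      exact_mod_cast this.ne'
  refine ht.frequently (Eventually.frequently ?_)
  filter_upwards [self_mem_nhdsWithin] with x hx
  exact hreal x (zero_lt_one.trans hx)

end Grushin

/-! ### The contour shift for the Green function -/

namespace Grushin

/-- The function whose `(-n/2)`-th power, integrated over the real line, gives the Green function
regularized by `ε`. Here `R = |x|² + |x'|²`, `a = x · x'` and `s = |u - u'|`. -/
noncomputable def contourBase (R a s ε : ℝ) (z : ℂ) : ℂ :=
  ε * csinhc z + R * Complex.cosh z - 2 * s * Complex.I * Complex.sinh z - 2 * a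

/-- The angle `θ` with `R = D² cos θ` and `2 s = D² sin θ`. -/
noncomputable def contourAngle (R s : ℝ) : ℝ := Complex.arg (⟨R, 2 * s⟩ : ℂ)

section contour

variable {R a s : ℝ}

lemma norm_mk_eq_sqrt (R s : ℝ) : ‖(⟨R, 2 * s⟩ : ℂ)‖ = √(R ^ 2 + (2 * s) ^ 2) := by
  rw [Complex.norm_def, Complex.normSq_mk]
  congr 1; ring

lemma sqrt_mul_cos_contourAngle (R s : ℝ) :
    √(R ^ 2 + (2 * s) ^ 2) * Real.cos (contourAngle R s) = R := by
  rw [← norm_mk_eq_sqrt, contourAngle, Complex.norm_mul_cos_arg]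

lemma sqrt_mul_sin_contourAngle (R s : ℝ) :
    √(R ^ 2 + (2 * s) ^ 2) * Real.sin (contourAngle R s) = 2 * s := by
  rw [← norm_mk_eq_sqrt, contourAngle, Complex.norm_mul_sin_arg]

lemma contourAngle_nonneg (R : ℝ) (hs : 0 ≤ s) : 0 ≤ contourAngle R s :=
  Complex.arg_nonneg_iff.2 (by simpa using hs)

lemma contourAngle_le (hR : 0 ≤ R) (s : ℝ) : contourAngle R s ≤ Real.pi / 2 :=
  (le_abs_self _).trans (Complex.abs_arg_le_pi_div_two_iff.2 hR)

lemma contourBase_eq (R a s ε : ℝ) (z : ℂ) : contourBase R a s ε z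
    = ε * csinhc z + (√(R ^ 2 + (2 * s) ^ 2) : ℝ) *
      Complex.cosh (z - contourAngle R s * Complex.I) - 2 * a := by
  have h1 : ((√(R ^ 2 + (2 * s) ^ 2) : ℝ) : ℂ) * (Real.cos (contourAngle R s) : ℝ) = R := by
    exact_mod_cast sqrt_mul_cos_contourAngle R s
  have h2 : ((√(R ^ 2 + (2 * s) ^ 2) : ℝ) : ℂ) * (Real.sin (contourAngle R s) : ℝ) = 2 * s := by
    exact_mod_cast sqrt_mul_sin_contourAngle R s
  rw [contourBase, Complex.cosh_sub, Complex.cosh_mul_I, Complex.sinh_mul_I, ← Complex.ofReal_cos,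
    ← Complex.ofReal_sin]
  linear_combination (-Complex.cosh z) * h1 + (Complex.sinh z * Complex.I) * h2

lemma cosh_add_mul_I_re (t y : ℝ) :
    (Complex.cosh (t + y * Complex.I)).re = Real.cosh t * Real.cos y := by
  rw [Complex.cosh_add, Complex.sinh_mul_I, Complex.cosh_mul_I]
  simp [Complex.cosh_ofReal_re, Complex.cos_ofReal_re]

lemma le_sqrt_sq_add (R s : ℝ) : R ≤ √(R ^ 2 + (2 * s) ^ 2) :=
  Real.le_sqrt_of_sq_le (by nlinarith [sq_nonneg (2 * s)])

/-- In the strip `0 ≤ Im z ≤ θ` the base stays in the right half plane. -/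
lemma contourBase_re_ge (hR : 0 ≤ R) (ha : |2 * a| ≤ R) {ε : ℝ} {t y : ℝ}
    (hy0 : 0 ≤ y) (hy : y ≤ contourAngle R s) :
    ε * (csinhc (t + y * Complex.I)).re
      ≤ (contourBase R a s ε (t + y * Complex.I)).re := by
  have hθ := contourAngle_le hR s
  have hcos : Real.cos (contourAngle R s) ≤ Real.cos (y - contourAngle R s) := by
    rw [← Real.cos_neg (y - contourAngle R s)]
    exact Real.cos_le_cos_of_nonneg_of_le_pi (by linarith) (by linarith [Real.pi_pos])
      (by linarith)
  have hcos0 : 0 ≤ Real.cos (y - contourAngle R s) :=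
    Real.cos_nonneg_of_mem_Icc ⟨by linarith, by linarith⟩
  have h1 : R ≤ √(R ^ 2 + (2 * s) ^ 2) *
      (Real.cosh t * Real.cos (y - contourAngle R s)) := by
    calc R = √(R ^ 2 + (2 * s) ^ 2) * (1 * Real.cos (contourAngle R s)) := by
          rw [one_mul, sqrt_mul_cos_contourAngle]
      _ ≤ √(R ^ 2 + (2 * s) ^ 2) * (1 * Real.cos (y - contourAngle R s)) := by gcongr
      _ ≤ _ := by
          gcongr
          exact Real.one_le_cosh t
  have h2 := (abs_le.1 ha).2
  rw [contourBase_eq, show (t + y * Complex.I - contourAngle R s * Complex.I : ℂ)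
    = t + ((y - contourAngle R s : ℝ) : ℂ) * Complex.I by push_cast; ring]
  simp only [Complex.sub_re, Complex.add_re, Complex.re_ofReal_mul, cosh_add_mul_I_re]
  have h3 : (2 * (a : ℂ)).re = 2 * a := by simp
  rw [h3]
  linarith

lemma contourBase_re_pos (hR : 0 ≤ R) (ha : |2 * a| ≤ R) {ε : ℝ} (hε : 0 < ε) {t y : ℝ}
    (hy0 : 0 ≤ y) (hy : y ≤ contourAngle R s) :
    0 < (contourBase R a s ε (t + y * Complex.I)).re :=
  (mul_pos hε (csinhc_re_pos hy0 (hy.trans (contourAngle_le hR s)))).trans_le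
    (contourBase_re_ge hR ha hy0 hy)

lemma abs_sinh_re_le_norm_cosh (z : ℂ) : |Real.sinh z.re| ≤ ‖Complex.cosh z‖ := by
  have h := abs_norm_sub_norm_le (Complex.exp z) (-Complex.exp (-z))
  rw [norm_neg, Complex.norm_exp, Complex.norm_exp, Complex.neg_re, sub_neg_eq_add] at h
  rw [Complex.cosh, norm_div, Real.sinh_eq, abs_div, Complex.norm_ofNat, abs_two]
  gcongr

lemma norm_sinh_le_cosh_re (z : ℂ) : ‖Complex.sinh z‖ ≤ Real.cosh z.re := by
  have h := norm_sub_le (Complex.exp z) (Complex.exp (-z))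
  rw [Complex.norm_exp, Complex.norm_exp, Complex.neg_re] at h
  rw [Complex.sinh, norm_div, Real.cosh_eq, Complex.norm_ofNat]
  gcongr

lemma norm_csinhc_le {z : ℂ} (hz : 1 ≤ |z.re|) : ‖csinhc z‖ ≤ 2 * Real.sinh |z.re| / |z.re| := by
  have hpos : 0 < |z.re| := by linarith
  have h1 : |z.re| * ‖csinhc z‖ ≤ ‖Complex.sinh z‖ := by
    rw [← mul_csinhc, norm_mul]
    gcongr
    exact Complex.abs_re_le_norm z
  have h2 := norm_sinh_le_cosh_re z
  have h3 : Real.cosh z.re ≤ 2 * Real.sinh |z.re| := by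
    rw [← Real.cosh_abs]
    have h4 := Real.cosh_sub_sinh |z.re|
    have h5 : Real.exp (-|z.re|) ≤ 1 := Real.exp_le_one_iff.2 (by linarith)
    have h6 : |z.re| ≤ Real.sinh |z.re| := Real.self_le_sinh_iff.2 hpos.le
    linarith
  rw [le_div_iff₀ hpos]
  linarith

/-- Far out in every horizontal strip the base grows at least linearly. -/
lemma norm_contourBase_ge {ε : ℝ} (hε : 0 ≤ ε) {z : ℂ} (h1 : 1 ≤ |z.re|)
    (h2 : 4 * ε ≤ √(R ^ 2 + (2 * s) ^ 2) * |z.re|) :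
    √(R ^ 2 + (2 * s) ^ 2) / 2 * |z.re| - |2 * a| ≤ ‖contourBase R a s ε z‖ := by
  have hpos : 0 < |z.re| := by linarith
  have hsinh : |z.re| ≤ Real.sinh |z.re| := Real.self_le_sinh_iff.2 hpos.le
  set D := √(R ^ 2 + (2 * s) ^ 2) with hD
  have hD0 : 0 ≤ D := Real.sqrt_nonneg _
  have e1 : D * Real.sinh |z.re| ≤ ‖(D : ℂ) * Complex.cosh (z - contourAngle R s * Complex.I)‖ := by
    rw [norm_mul, Complex.norm_real, Real.norm_of_nonneg hD0]
    gcongr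
    have h := abs_sinh_re_le_norm_cosh (z - contourAngle R s * Complex.I)
    have hre : (z - contourAngle R s * Complex.I).re = z.re := by simp
    rw [hre, Real.abs_sinh] at h
    exact h
  have e2 : ‖(ε : ℂ) * csinhc z‖ ≤ D / 2 * Real.sinh |z.re| := by
    rw [norm_mul, Complex.norm_real, Real.norm_of_nonneg hε]
    calc ε * ‖csinhc z‖ ≤ ε * (2 * Real.sinh |z.re| / |z.re|) := by
          gcongr
          exact norm_csinhc_le h1
      _ = (4 * ε) / 2 / |z.re| * Real.sinh |z.re| := by ring
      _ ≤ (D * |z.re|) / 2 / |z.re| * Real.sinh |z.re| := by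
          have : 0 ≤ Real.sinh |z.re| := by linarith
          gcongr
      _ = _ := by field_simp
  have e3 : ‖(2 * a : ℂ)‖ = |2 * a| := by
    rw [← Real.norm_eq_abs, ← Complex.norm_real]; push_cast; rfl
  have e4 : ‖(D : ℂ) * Complex.cosh (z - contourAngle R s * Complex.I)‖
      ≤ ‖contourBase R a s ε z‖ + ‖(ε : ℂ) * csinhc z‖ + ‖(2 * a : ℂ)‖ := by
    rw [contourBase_eq]
    calc _ = ‖(ε * csinhc z + (D : ℝ) * Complex.cosh (z - contourAngle R s * Complex.I) - 2 * a)
          - ε * csinhc z + 2 * a‖ := by congr 1; ring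
      _ ≤ _ := (norm_add_le _ _).trans (by gcongr; exact norm_sub_le _ _)
  have e5 : D / 2 * |z.re| ≤ D / 2 * Real.sinh |z.re| := by gcongr
  linarith

lemma differentiable_contourBase (R a s ε : ℝ) : Differentiable ℂ (contourBase R a s ε) := by
  unfold contourBase
  have := differentiable_csinhc
  fun_prop

lemma norm_contourBase_cpow_le {p : ℝ} (hp : 0 ≤ p) {z : ℂ} {c : ℝ} (hc : 0 < c) (h : c ≤ ‖z‖) :
    ‖z ^ (-p : ℂ)‖ ≤ c ^ (-p) := by
  rw [← Complex.ofReal_neg, Complex.norm_cpow_real]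
  exact Real.rpow_le_rpow_of_nonpos hc h (by linarith)

lemma continuous_contourBase_line (hR : 0 ≤ R) (ha : |2 * a| ≤ R) {ε : ℝ} (hε : 0 < ε) (p : ℝ)
    {y : ℝ} (hy0 : 0 ≤ y) (hy : y ≤ contourAngle R s) :
    Continuous fun t : ℝ => contourBase R a s ε (t + y * Complex.I) ^ (-p : ℂ) := by
  have h := (differentiable_contourBase R a s ε).continuous
  refine Continuous.cpow (by fun_prop) continuous_const fun t => Or.inl ?_
  exact contourBase_re_pos hR ha hε hy0 hy

/-- The base on the shifted line, up to the regularizing term: `D² cosh t - 2 a`. -/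
noncomputable def shiftedBase (R a s t : ℝ) : ℝ := √(R ^ 2 + (2 * s) ^ 2) * Real.cosh t - 2 * a

lemma contourBase_shifted (R a s ε t : ℝ) :
    contourBase R a s ε (t + contourAngle R s * Complex.I)
      = ε * csinhc (t + contourAngle R s * Complex.I) + (shiftedBase R a s t : ℂ) := by
  rw [contourBase_eq, add_sub_cancel_right, ← Complex.ofReal_cosh, shiftedBase]
  push_cast
  ring

lemma shiftedBase_eq (h : 0 < √(R ^ 2 + (2 * s) ^ 2) - 2 * a) (t : ℝ) :
    shiftedBase R a s t = (√(R ^ 2 + (2 * s) ^ 2) - 2 * a) *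
      (1 + √(R ^ 2 + (2 * s) ^ 2) / (√(R ^ 2 + (2 * s) ^ 2) - 2 * a) * (Real.cosh t - 1)) := by
  rw [shiftedBase, mul_add, mul_one, ← mul_assoc, mul_div_cancel₀ _ h.ne']
  ring

lemma shiftedBase_pos (h : 0 < √(R ^ 2 + (2 * s) ^ 2) - 2 * a) (t : ℝ) :
    0 < shiftedBase R a s t := by
  have h1 := mul_le_mul_of_nonneg_left (Real.one_le_cosh t) (Real.sqrt_nonneg (R ^ 2 + (2 * s) ^ 2))
  rw [shiftedBase]
  linarith

lemma shiftedBase_rpow (h : 0 < √(R ^ 2 + (2 * s) ^ 2) - 2 * a) (p t : ℝ) :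
    shiftedBase R a s t ^ p = (√(R ^ 2 + (2 * s) ^ 2) - 2 * a) ^ p *
      (1 + √(R ^ 2 + (2 * s) ^ 2) / (√(R ^ 2 + (2 * s) ^ 2) - 2 * a) * (Real.cosh t - 1)) ^ p := by
  rw [shiftedBase_eq h, Real.mul_rpow h.le]
  have h1 := Real.one_le_cosh t
  have h2 := mul_nonneg (div_nonneg (Real.sqrt_nonneg (R ^ 2 + (2 * s) ^ 2)) h.le)
    (sub_nonneg.2 h1)
  linarith

lemma integrable_shiftedBase_rpow {n : ℕ} (hn : 2 ≤ n)
    (hD : 0 < √(R ^ 2 + (2 * s) ^ 2)) (h : 0 < √(R ^ 2 + (2 * s) ^ 2) - 2 * a) :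
    Integrable fun t => shiftedBase R a s t ^ (-((n : ℝ) / 2)) := by
  simp_rw [shiftedBase_rpow h]
  exact (integrable_one_add_mul_cosh_rpow hn (div_pos hD h)).const_mul _

lemma norm_contourBase_shifted_cpow_le (hR : 0 ≤ R) (hs : 0 ≤ s) {ε : ℝ} (hε : 0 < ε)
    (h : 0 < √(R ^ 2 + (2 * s) ^ 2) - 2 * a) {p : ℝ} (hp : 0 ≤ p) (t : ℝ) :
    ‖contourBase R a s ε (t + contourAngle R s * Complex.I) ^ (-p : ℂ)‖
      ≤ shiftedBase R a s t ^ (-p) := by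
  refine norm_contourBase_cpow_le hp (shiftedBase_pos h t) (le_trans ?_ (Complex.re_le_norm _))
  rw [contourBase_shifted, Complex.add_re, Complex.re_ofReal_mul, Complex.ofReal_re]
  have := mul_pos hε (csinhc_re_pos (t := t) (contourAngle_nonneg R hs) (contourAngle_le hR s))
  linarith

lemma norm_contourBase_real_cpow_le (hR : 0 ≤ R) (ha : |2 * a| ≤ R) (hs : 0 ≤ s) {ε : ℝ}
    (hε : 0 < ε) {n : ℕ} (t : ℝ) :
    ‖contourBase R a s ε t ^ (-((n : ℝ) / 2 : ℝ) : ℂ)‖ ≤ ε ^ (-((n : ℝ) / 2)) * weight n t := by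
  have h1 := contourBase_re_ge (s := s) hR ha (ε := ε) (t := t) le_rfl (contourAngle_nonneg R hs)
  simp only [Complex.ofReal_zero, zero_mul, add_zero, csinhc_ofReal, Complex.ofReal_re] at h1
  have hS := sinhc_pos t
  refine (norm_contourBase_cpow_le (by positivity) (mul_pos hε hS)
    (h1.trans (Complex.re_le_norm _))).trans (le_of_eq ?_)
  rw [Real.mul_rpow hε.le hS.le, weight]

/-- The contour shift by `θ`, which removes the oscillation from the Green function. -/
lemma integral_contourBase_eq_shifted (hR : 0 ≤ R) (ha : |2 * a| ≤ R) (hs : 0 ≤ s) {ε : ℝ}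
    (hε : 0 < ε) {n : ℕ} (hn : 2 ≤ n) (hD : 0 < √(R ^ 2 + (2 * s) ^ 2))
    (h : 0 < √(R ^ 2 + (2 * s) ^ 2) - 2 * a) :
    ∫ t : ℝ, contourBase R a s ε t ^ (-((n : ℝ) / 2 : ℝ) : ℂ)
      = ∫ t : ℝ, contourBase R a s ε (t + contourAngle R s * Complex.I) ^
          (-((n : ℝ) / 2 : ℝ) : ℂ) := by
  set p : ℝ := (n : ℝ) / 2 with hp
  have hp0 : 0 < p := by
    have : (2 : ℝ) ≤ n := by exact_mod_cast hn
    rw [hp]; linarith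
  have hθ := contourAngle_nonneg R hs
  refine integral_eq_integral_add_mul_I (F := fun z => contourBase R a s ε z ^ (-p : ℂ)) hθ
    (fun z hz0 hz => ?_) ?_ ?_
    (B := fun T => (√(R ^ 2 + (2 * s) ^ 2) / 2 * T - |2 * a|) ^ (-p)) ?_ ?_
  · refine (differentiable_contourBase R a s ε z).cpow_const (Or.inl ?_)
    have := contourBase_re_pos hR ha hε (t := z.re) hz0 hz
    rwa [Complex.re_add_im] at this
  · refine Integrable.mono' ((integrable_weight hn).const_mul (ε ^ (-p))) ?_
      (.of_forall fun t => norm_contourBase_real_cpow_le hR ha hs hε t)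
    have := continuous_contourBase_line (s := s) hR ha hε p le_rfl hθ
    simpa using this.aestronglyMeasurable (μ := volume)
  · exact Integrable.mono' (integrable_shiftedBase_rpow hn hD h)
      (continuous_contourBase_line hR ha hε p hθ le_rfl).aestronglyMeasurable
      (.of_forall fun t => norm_contourBase_shifted_cpow_le hR hs hε h hp0.le t)
  · have h1 : Tendsto (fun T : ℝ => √(R ^ 2 + (2 * s) ^ 2) / 2 * T - |2 * a|) atTop atTop :=
      tendsto_atTop_add_const_right _ _ (tendsto_id.const_mul_atTop (by positivity))
    exact (tendsto_rpow_neg_atTop hp0).comp h1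
  · have h1 : Tendsto (fun T : ℝ => √(R ^ 2 + (2 * s) ^ 2) / 2 * T - |2 * a|) atTop atTop :=
      tendsto_atTop_add_const_right _ _ (tendsto_id.const_mul_atTop (by positivity))
    have h2 : Tendsto (fun T : ℝ => √(R ^ 2 + (2 * s) ^ 2) * T) atTop atTop :=
      tendsto_id.const_mul_atTop hD
    filter_upwards [h1.eventually_gt_atTop 0, h2.eventually_ge_atTop (4 * ε),
      eventually_ge_atTop 1] with T hT1 hT2 hT3 y _
    have key : ∀ z : ℂ, |z.re| = T → ‖contourBase R a s ε z ^ (-p : ℂ)‖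
        ≤ (√(R ^ 2 + (2 * s) ^ 2) / 2 * T - |2 * a|) ^ (-p) := by
      intro z hz
      refine norm_contourBase_cpow_le hp0.le hT1 ?_
      rw [← hz]
      exact norm_contourBase_ge hε.le (by rwa [hz]) (by rwa [hz])
    have hT0 : |T| = T := abs_of_nonneg (by linarith)
    exact ⟨key _ (by simp [hT0]), key _ (by simp [hT0])⟩

/-- The limit in which the regularization is removed. -/
lemma tendsto_integral_contourBase (hR : 0 ≤ R) (ha : |2 * a| ≤ R) (hs : 0 ≤ s) {n : ℕ}
    (hn : 2 ≤ n) (hD : 0 < √(R ^ 2 + (2 * s) ^ 2)) (h : 0 < √(R ^ 2 + (2 * s) ^ 2) - 2 * a)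
    {ε : ℕ → ℝ} (hε : ∀ k, 0 < ε k) (hε0 : Tendsto ε atTop (𝓝 0)) :
    Tendsto (fun k => (∫ t : ℝ, contourBase R a s (ε k) t ^ (-((n : ℝ) / 2 : ℝ) : ℂ)).re) atTop
      (𝓝 (∫ t : ℝ, shiftedBase R a s t ^ (-((n : ℝ) / 2)))) := by
  have hlim : ∫ t : ℝ, shiftedBase R a s t ^ (-((n : ℝ) / 2))
      = (∫ t : ℝ, (shiftedBase R a s t : ℂ) ^ (-((n : ℝ) / 2 : ℝ) : ℂ)).re := by
    have : ∀ t : ℝ, (shiftedBase R a s t : ℂ) ^ (-((n : ℝ) / 2 : ℝ) : ℂ)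
        = ((shiftedBase R a s t ^ (-((n : ℝ) / 2)) : ℝ) : ℂ) := fun t => by
      rw [Complex.ofReal_cpow (shiftedBase_pos h t).le, Complex.ofReal_neg]
    simp_rw [this]
    rw [integral_complex_ofReal, Complex.ofReal_re]
  rw [hlim]
  refine (Complex.continuous_re.tendsto _).comp ?_
  simp_rw [fun k => integral_contourBase_eq_shifted hR ha hs (hε k) hn hD h]
  refine tendsto_integral_of_dominated_convergence
    (fun t => shiftedBase R a s t ^ (-((n : ℝ) / 2)))
    (fun k => (continuous_contourBase_line hR ha (hε k) _ (contourAngle_nonneg R hs)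
      le_rfl).aestronglyMeasurable) (integrable_shiftedBase_rpow hn hD h)
    (fun k => .of_forall fun t =>
      norm_contourBase_shifted_cpow_le hR hs (hε k) h (by positivity) t)
    (.of_forall fun t => ?_)
  have h1 : Tendsto (fun k => contourBase R a s (ε k) (t + contourAngle R s * Complex.I)) atTop
      (𝓝 (shiftedBase R a s t : ℂ)) := by
    simp_rw [contourBase_shifted]
    have := (((Complex.continuous_ofReal.tendsto 0).comp hε0).mul_const
      (csinhc (t + contourAngle R s * Complex.I))).add_const (shiftedBase R a s t : ℂ)
    simpa using this
  exact h1.cpow tendsto_const_nhds (Or.inl (by simpa using shiftedBase_pos h t))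

end contour

end Grushin

/-! ### The Green function as a single real integral -/

namespace Grushin

/-- Changing the sign of `σ` conjugates the integral, so the kernel depends on `|u - u'|` only. -/
lemma expInt_ofReal_re_abs (w : ℝ → ℝ) (α β σ : ℝ) :
    (expInt (fun τ => (w τ : ℂ)) (α, β, |σ|)).re = (expInt (fun τ => (w τ : ℂ)) (α, β, σ)).re := by
  rcases abs_choice σ with h | h
  · rw [h]
  · rw [h, ← Complex.conj_re, expInt, expInt, ← integral_conj]
    congr 2 with τ
    have hphase : (starRingEnd ℂ) (phase τ (α, β, -σ)) = phase τ (α, β, σ) := by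
      apply Complex.ext <;>
        simp [phase, -Complex.ofReal_div, -Complex.ofReal_cosh]
    rw [map_mul, ← Complex.exp_conj, Complex.conj_ofReal, hphase]

lemma kernel_eq_expInt_s (n : ℕ) (h : ℝ) (hh : 0 < h) (g g' : Space n) :
    kernel n h g g' = ((4 * h)⁻¹ / Real.pi) ^ ((n : ℝ) / 2 + 1) *
      (expInt (fun τ => (weight n τ : ℂ)) ((4 * h)⁻¹ * Rsq g g', (4 * h)⁻¹ * inner ℝ g.1 g'.1,
        (4 * h)⁻¹ * s g g')).re := by
  have hb : 0 ≤ (4 * h)⁻¹ := by positivity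
  rw [kernel, ← expInt_ofReal_re_abs, abs_mul, abs_of_nonneg hb, s]

/-- The substitution `h = 1 / (4 b)`. -/
lemma integrableOn_and_integral_inv_four_mul (K : ℝ → ℝ) :
    (IntegrableOn K (Ioi 0) ↔
      IntegrableOn (fun b => 4 / (4 * b) ^ 2 * K (4 * b)⁻¹) (Ioi 0)) ∧
    ∫ h in Ioi (0 : ℝ), K h = ∫ b in Ioi (0 : ℝ), 4 / (4 * b) ^ 2 * K (4 * b)⁻¹ := by
  have himg : (fun b : ℝ => (4 * b)⁻¹) '' Ioi 0 = Ioi 0 := by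
    ext h
    constructor
    · rintro ⟨b, hb, rfl⟩
      have hb' : (0 : ℝ) < b := hb
      exact mem_Ioi.2 (by positivity)
    · intro hh
      have hh' : (0 : ℝ) < h := hh
      refine ⟨(4 * h)⁻¹, mem_Ioi.2 (by positivity), ?_⟩
      simp only
      field_simp
  have hder : ∀ b ∈ Ioi (0 : ℝ),
      HasDerivWithinAt (fun b : ℝ => (4 * b)⁻¹) (-(4 * 1) / (4 * b) ^ 2) (Ioi 0) b := by
    intro b hb
    have hb' : (0 : ℝ) < b := hb
    exact (((hasDerivAt_id b).const_mul 4).inv (by simpa using hb'.ne')).hasDerivWithinAt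
  have hinj : InjOn (fun b : ℝ => (4 * b)⁻¹) (Ioi 0) := by
    intro x _ y _ hxy
    simpa using hxy
  have habs : ∀ b : ℝ, |-(4 * 1) / (4 * b) ^ 2| = 4 / (4 * b) ^ 2 := fun b => by
    rw [abs_div, abs_of_nonneg (sq_nonneg (4 * b))]; norm_num
  have h1 := integrableOn_image_iff_integrableOn_abs_deriv_smul measurableSet_Ioi hder hinj K
  have h2 := integral_image_eq_integral_abs_deriv_smul measurableSet_Ioi hder hinj K
  rw [himg] at h1 h2
  simp only [habs, smul_eq_mul] at h1 h2
  exact ⟨h1, h2⟩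

section regularized

variable {R a s ε : ℝ}

/-- With `h = 1 / (4 b)`, the phase is `b` times a function of `τ` which `contourBase`
represents. -/
lemma exp_mul_cexp_phase (R a s ε b τ : ℝ) :
    (Real.exp (-(ε * b)) : ℂ) * Complex.exp (phase τ (b * R, b * a, b * s))
      = Complex.exp (-(contourBase R a s ε τ / sinhc τ * b)) := by
  have hS : (sinhc τ : ℂ) ≠ 0 := by exact_mod_cast (sinhc_pos τ).ne'
  have h1 := mul_csinhc τ
  rw [csinhc_ofReal] at h1
  rw [Complex.ofReal_exp, ← Complex.exp_add, phase, contourBase, csinhc_ofReal, ← h1]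
  congr 1
  push_cast
  field_simp
  ring

lemma le_re_contourBase_div (hR : 0 ≤ R) (ha : |2 * a| ≤ R) (hs : 0 ≤ s) (τ : ℝ) :
    ε ≤ (contourBase R a s ε τ / sinhc τ).re := by
  have h1 := contourBase_re_ge (s := s) hR ha (ε := ε) (t := τ) le_rfl (contourAngle_nonneg R hs)
  simp only [Complex.ofReal_zero, zero_mul, add_zero, csinhc_ofReal, Complex.ofReal_re] at h1
  rwa [Complex.div_ofReal_re, le_div_iff₀ (sinhc_pos τ)]

/-- The weight is the power of the positive number `sinhc τ` that turns the rate of the Gamma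
integral into `contourBase`. -/
lemma weight_mul_div_cpow {n : ℕ} {z : ℂ} (hz : z ≠ 0) (τ : ℝ) :
    (weight n τ : ℂ) * (z / sinhc τ) ^ (-((n : ℝ) / 2 : ℝ) : ℂ)
      = z ^ (-((n : ℝ) / 2 : ℝ) : ℂ) := by
  have hS := sinhc_pos τ
  have hS' : (sinhc τ : ℂ) ≠ 0 := by exact_mod_cast hS.ne'
  have hlog := Complex.log_ofReal_mul hS (div_ne_zero hz hS')
  rw [mul_div_cancel₀ _ hS'] at hlog
  rw [Complex.cpow_def_of_ne_zero hz, Complex.cpow_def_of_ne_zero (div_ne_zero hz hS'), hlog,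
    weight, Real.rpow_def_of_pos hS, Complex.ofReal_exp, ← Complex.exp_add]
  congr 1
  push_cast
  ring

/-- Absolute integrability of the double integral over `(b, τ)`, thanks to the factor
`exp (-ε b)`. -/
lemma integrable_prod_regularized (hR : 0 ≤ R) (ha : |2 * a| ≤ R) (hs : 0 ≤ s) (hε : 0 < ε)
    {n : ℕ} (hn : 2 ≤ n) :
    Integrable (fun q : ℝ × ℝ => ((q.1 ^ ((n : ℝ) / 2 - 1) : ℝ) : ℂ) * ((weight n q.2 : ℂ) *
      Complex.exp (-(contourBase R a s ε q.2 / sinhc q.2 * q.1))))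
      ((volume.restrict (Ioi 0)).prod volume) := by
  have hp0 : 0 < (n : ℝ) / 2 := by
    have : (2 : ℝ) ≤ n := by exact_mod_cast hn
    linarith
  refine Integrable.mono' ((integrableOn_rpow_mul_exp_neg_mul hp0 hε).mul_prod
    (integrable_weight hn)) ?_ ?_
  · refine Measurable.aestronglyMeasurable ?_
    have h1 := continuous_sinhc
    have h2 := continuous_weight n
    have h3 := (differentiable_contourBase R a s ε).continuous
    have h4 : Measurable fun q : ℝ × ℝ => contourBase R a s ε q.2 :=
      (h3.comp (Complex.continuous_ofReal.comp continuous_snd)).measurable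
    have h5 : Measurable fun q : ℝ × ℝ => (sinhc q.2 : ℂ) :=
      (Complex.continuous_ofReal.comp (h1.comp continuous_snd)).measurable
    have h6 : Measurable fun q : ℝ × ℝ => (weight n q.2 : ℂ) :=
      (Complex.continuous_ofReal.comp (h2.comp continuous_snd)).measurable
    fun_prop
  · have h0 : ∀ᵐ q : ℝ × ℝ ∂((volume.restrict (Ioi 0)).prod volume), q.1 ∈ Ioi (0 : ℝ) :=
      Measure.quasiMeasurePreserving_fst.ae (ae_restrict_mem measurableSet_Ioi)
    filter_upwards [h0] with q hq
    have hq' : (0 : ℝ) < q.1 := hq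
    have h1 := le_re_contourBase_div (ε := ε) hR ha hs q.2
    rw [mul_left_comm, norm_mul, norm_rpow_mul_cexp hq', Complex.norm_real,
      Real.norm_of_nonneg (weight_pos n _).le, mul_comm]
    have h2 := (weight_pos n q.2).le
    gcongr

lemma integral_integral_regularized (hR : 0 ≤ R) (ha : |2 * a| ≤ R) (hs : 0 ≤ s) (hε : 0 < ε)
    {n : ℕ} (hn : 2 ≤ n) :
    ∫ b in Ioi (0 : ℝ), ∫ τ : ℝ, ((b ^ ((n : ℝ) / 2 - 1) : ℝ) : ℂ) * ((weight n τ : ℂ) *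
      Complex.exp (-(contourBase R a s ε τ / sinhc τ * b)))
      = (Real.Gamma ((n : ℝ) / 2) : ℂ) *
        ∫ τ : ℝ, contourBase R a s ε τ ^ (-((n : ℝ) / 2 : ℝ) : ℂ) := by
  have hp0 : 0 < (n : ℝ) / 2 := by
    have : (2 : ℝ) ≤ n := by exact_mod_cast hn
    linarith
  rw [integral_integral_swap (integrable_prod_regularized hR ha hs hε hn), ← integral_const_mul]
  refine integral_congr_ae (.of_forall fun τ => ?_)
  have hr := hε.trans_le (le_re_contourBase_div (ε := ε) hR ha hs τ)
  have hz : contourBase R a s ε τ ≠ 0 := by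
    rintro h
    rw [h] at hr
    simp at hr
  simp only
  simp_rw [fun b : ℝ => mul_left_comm ((b ^ ((n : ℝ) / 2 - 1) : ℝ) : ℂ) (weight n τ : ℂ)]
  rw [integral_const_mul, integral_rpow_mul_cexp hp0 hr, ← mul_assoc, weight_mul_div_cpow hz,
    mul_comm]

/-- The integrand after the substitution `h = 1 / (4 b)`. -/
lemma regularized_kernel_substitution {n : ℕ} (g g' : Space n) {b : ℝ} (hb : 0 < b) :
    4 / (4 * b) ^ 2 * (Real.exp (-(ε * (4 * (4 * b)⁻¹)⁻¹)) * kernel n (4 * b)⁻¹ g g')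
      = (4 * Real.pi ^ ((n : ℝ) / 2 + 1))⁻¹ * (∫ τ : ℝ, ((b ^ ((n : ℝ) / 2 - 1) : ℝ) : ℂ) *
        ((weight n τ : ℂ) * Complex.exp (-(contourBase (Rsq g g') (inner ℝ g.1 g'.1)
          (Grushin.s g g') ε τ / sinhc τ * b)))).re := by
  have hπ := Real.pi_pos
  have e : (4 * (4 * b)⁻¹)⁻¹ = b := by field_simp
  have h1 : (∫ τ : ℝ, ((b ^ ((n : ℝ) / 2 - 1) : ℝ) : ℂ) *
        ((weight n τ : ℂ) * Complex.exp
          (-(contourBase (Rsq g g') (inner ℝ g.1 g'.1) (Grushin.s g g') ε τ / sinhc τ * b))))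
      = ((b ^ ((n : ℝ) / 2 - 1) * Real.exp (-(ε * b)) : ℝ) : ℂ) *
        expInt (fun τ => (weight n τ : ℂ))
          (b * Rsq g g', b * inner ℝ g.1 g'.1, b * Grushin.s g g') := by
    rw [expInt, ← integral_const_mul]
    refine integral_congr_ae (.of_forall fun τ => ?_)
    simp only
    rw [← exp_mul_cexp_phase]
    push_cast
    ring
  rw [kernel_eq_expInt_s n _ (by positivity), e, h1, Complex.re_ofReal_mul,
    Real.div_rpow hb.le hπ.le, show (n : ℝ) / 2 + 1 = ((n : ℝ) / 2 - 1) + 2 by ring,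
    Real.rpow_add hb, Real.rpow_two]
  field_simp

/-- The Green integral with the regularizing factor `exp (-ε / (4 h))`. -/
lemma regularized_green {n : ℕ} (hn : 2 ≤ n) (g g' : Space n) (hε : 0 < ε) :
    IntegrableOn (fun h => Real.exp (-(ε * (4 * h)⁻¹)) * kernel n h g g') (Ioi 0) ∧
    ∫ h in Ioi (0 : ℝ), Real.exp (-(ε * (4 * h)⁻¹)) * kernel n h g g'
      = Real.Gamma ((n : ℝ) / 2) / (4 * Real.pi ^ ((n : ℝ) / 2 + 1)) *
        (∫ τ : ℝ, contourBase (Rsq g g') (inner ℝ g.1 g'.1) (Grushin.s g g') ε τ ^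
          (-((n : ℝ) / 2 : ℝ) : ℂ)).re := by
  have hR := Rsq_nonneg g g'
  have ha : |2 * inner ℝ g.1 g'.1| ≤ Rsq g g' := abs_two_inner_le g.1 g'.1
  have hs : 0 ≤ Grushin.s g g' := abs_nonneg _
  obtain ⟨h1, h2⟩ := integrableOn_and_integral_inv_four_mul
    (fun h => Real.exp (-(ε * (4 * h)⁻¹)) * kernel n h g g')
  have hint := (integrable_prod_regularized hR ha hs hε hn).integral_prod_left
  refine ⟨h1.2 ?_, ?_⟩
  · refine IntegrableOn.congr_fun (hint.re.const_mul (4 * Real.pi ^ ((n : ℝ) / 2 + 1))⁻¹)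
      (fun b hb => ?_) measurableSet_Ioi
    exact (regularized_kernel_substitution g g' hb).symm
  · rw [h2, setIntegral_congr_fun measurableSet_Ioi
      (fun b hb => regularized_kernel_substitution g g' hb), integral_const_mul]
    have h3 := integral_re hint
    simp only [RCLike.re_to_complex] at h3
    rw [h3, integral_integral_regularized hR ha hs hε hn, Complex.re_ofReal_mul]
    ring

end regularized

lemma continuousOn_kernel_time {n : ℕ} (hn : 2 ≤ n) (g g' : Space n) :
    ContinuousOn (fun h => kernel n h g g') (Ioi 0) :=
  (contDiffOn_kernel hn).continuousOn.comp
    (f := fun h : ℝ => (h, g, g')) (by fun_prop) fun h hh => ⟨hh, mem_univ _⟩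

/-- The Green function is
`Γ(n/2) / (4 π^(n/2+1)) ∫ (D² cosh t - 2 x · x')^(-n/2) dt`; the convergence of the integral
over `h` comes from monotone convergence as the regularization is removed. -/
lemma green_kernel {n : ℕ} (hn : 2 ≤ n) (g g' : Space n)
    (hD : 0 < √(Rsq g g' ^ 2 + (2 * s g g') ^ 2))
    (hd : 0 < √(Rsq g g' ^ 2 + (2 * s g g') ^ 2) - 2 * inner ℝ g.1 g'.1) :
    IntegrableOn (fun h => kernel n h g g') (Ioi 0) ∧
    ∫ h in Ioi (0 : ℝ), kernel n h g g'
      = Real.Gamma ((n : ℝ) / 2) / (4 * Real.pi ^ ((n : ℝ) / 2 + 1)) *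
        ∫ t : ℝ, shiftedBase (Rsq g g') (inner ℝ g.1 g'.1) (s g g') t ^ (-((n : ℝ) / 2)) := by
  set L := Real.Gamma ((n : ℝ) / 2) / (4 * Real.pi ^ ((n : ℝ) / 2 + 1)) *
        ∫ t : ℝ, shiftedBase (Rsq g g') (inner ℝ g.1 g'.1) (s g g') t ^ (-((n : ℝ) / 2)) with hL
  have hL0 : 0 ≤ L := by
    have h1 : 0 ≤ Real.Gamma ((n : ℝ) / 2) := Real.Gamma_nonneg_of_nonneg (by positivity)
    have h2 : 0 ≤ ∫ t : ℝ,
        shiftedBase (Rsq g g') (inner ℝ g.1 g'.1) (s g g') t ^ (-((n : ℝ) / 2)) :=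
      integral_nonneg fun t => Real.rpow_nonneg (shiftedBase_pos hd t).le _
    have := Real.pi_pos
    positivity
  set ε : ℕ → ℝ := fun k => 1 / ((k : ℝ) + 1) with hεdef
  have hε : ∀ k, 0 < ε k := fun k => by rw [hεdef]; positivity
  have hε0 : Tendsto ε atTop (𝓝 0) := tendsto_one_div_add_atTop_nhds_zero_nat
  have hmeas : AEStronglyMeasurable (fun h => kernel n h g g') (volume.restrict (Ioi 0)) :=
    (continuousOn_kernel_time hn g g').aestronglyMeasurable measurableSet_Ioi
  have hlim : Tendsto (fun k => ∫ h in Ioi (0 : ℝ),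
      Real.exp (-(ε k * (4 * h)⁻¹)) * kernel n h g g') atTop (𝓝 L) :=
    ((tendsto_integral_contourBase (Rsq_nonneg g g') (abs_two_inner_le g.1 g'.1)
      (abs_nonneg _ : 0 ≤ s g g') hn hD hd hε hε0).const_mul
      (Real.Gamma ((n : ℝ) / 2) / (4 * Real.pi ^ ((n : ℝ) / 2 + 1)))).congr
      fun k => (regularized_green hn g g' (hε k)).2.symm
  have hK0 : ∀ k, ∀ h ∈ Ioi (0 : ℝ), 0 ≤ Real.exp (-(ε k * (4 * h)⁻¹)) * kernel n h g g' :=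
    fun k h hh => mul_nonneg (Real.exp_pos _).le (kernel_nonneg hn hh g g')
  have hmono : Tendsto (fun k => ∫⁻ h in Ioi (0 : ℝ),
      ENNReal.ofReal (Real.exp (-(ε k * (4 * h)⁻¹)) * kernel n h g g')) atTop
      (𝓝 (∫⁻ h in Ioi (0 : ℝ), ENNReal.ofReal (kernel n h g g'))) := by
    refine lintegral_tendsto_of_tendsto_of_monotone
      (fun k => ((regularized_green hn g g'
        (hε k)).1.aestronglyMeasurable.aemeasurable).ennreal_ofReal)
      ?_ ?_
    · filter_upwards [ae_restrict_mem measurableSet_Ioi] with h hh k l hkl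
      have hh' : (0 : ℝ) < h := hh
      have h1 := kernel_nonneg hn hh' g g'
      have h2 : ε l ≤ ε k := one_div_le_one_div_of_le (by positivity) (by gcongr)
      refine ENNReal.ofReal_le_ofReal (mul_le_mul_of_nonneg_right (Real.exp_le_exp.2 ?_) h1)
      gcongr
    · filter_upwards [ae_restrict_mem measurableSet_Ioi] with h hh
      refine ENNReal.tendsto_ofReal ?_
      have h1 := ((hε0.mul_const (4 * h)⁻¹).neg.rexp).mul_const (kernel n h g g')
      simpa using h1
  have heq : ∀ k, ∫⁻ h in Ioi (0 : ℝ),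
      ENNReal.ofReal (Real.exp (-(ε k * (4 * h)⁻¹)) * kernel n h g g')
      = ENNReal.ofReal (∫ h in Ioi (0 : ℝ), Real.exp (-(ε k * (4 * h)⁻¹)) * kernel n h g g') :=
    fun k => (ofReal_integral_eq_lintegral_ofReal (regularized_green hn g g' (hε k)).1
      ((ae_restrict_mem measurableSet_Ioi).mono (hK0 k))).symm
  simp_rw [heq] at hmono
  have hval := tendsto_nhds_unique hmono (ENNReal.tendsto_ofReal hlim)
  have hnn : 0 ≤ᵐ[volume.restrict (Ioi 0)] fun h => kernel n h g g' :=
    (ae_restrict_mem measurableSet_Ioi).mono fun h hh => kernel_nonneg hn hh g g'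
  refine ⟨⟨hmeas, ?_⟩, ?_⟩
  · rw [hasFiniteIntegral_iff_ofReal hnn, hval]
    exact ENNReal.ofReal_lt_top
  · rw [integral_eq_lintegral_of_nonneg_ae hnn hmeas, hval, ENNReal.toReal_ofReal hL0]

end Grushin

/-! ### Comparison with the explicit profile -/

namespace Grushin

lemma sqrt_sub_two_inner_pos {n : ℕ} {g g' : Space n} (hne : g ≠ g') :
    0 < √(Rsq g g' ^ 2 + (2 * s g g') ^ 2) - 2 * inner ℝ g.1 g'.1 := by
  have h1 := norm_sub_sq_real g.1 g'.1
  have hR : 0 ≤ Rsq g g' := Rsq_nonneg g g'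
  have hle := le_sqrt_sq_add (Rsq g g') (s g g')
  by_cases hx : g.1 = g'.1
  · have hu : g.2 ≠ g'.2 := fun hu => hne (Prod.ext hx hu)
    have hs : 0 < s g g' := abs_pos.2 (sub_ne_zero.2 hu)
    have h2 : Rsq g g' < √(Rsq g g' ^ 2 + (2 * s g g') ^ 2) :=
      Real.lt_sqrt_of_sq_lt (by nlinarith)
    unfold Rsq at *
    nlinarith [sq_nonneg ‖g.1 - g'.1‖]
  · have h2 : 0 < ‖g.1 - g'.1‖ ^ 2 := pow_pos (norm_pos_iff.2 (sub_ne_zero.2 hx)) 2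
    unfold Rsq at *
    nlinarith

lemma sqrt_pos_of_ne {n : ℕ} {g g' : Space n} (hne : g ≠ g') :
    0 < √(Rsq g g' ^ 2 + (2 * s g g') ^ 2) := by
  have h1 := sqrt_sub_two_inner_pos hne
  have h2 := (abs_le.1 (abs_two_inner_le g.1 g'.1)).1
  have h3 := le_sqrt_sq_add (Rsq g g') (s g g')
  unfold Rsq at *
  linarith

lemma DK_eq_sqrt_sqrt {n : ℕ} (g g' : Space n) :
    DK g g' = √√(Rsq g g' ^ 2 + (2 * s g g') ^ 2) := by
  have h : 0 ≤ Rsq g g' ^ 2 + (2 * s g g') ^ 2 := by positivity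
  rw [DK, Real.sqrt_eq_rpow, Real.sqrt_eq_rpow, ← Real.rpow_mul h]
  norm_num

/-- The Green function in terms of `κ = D² / d²`, the only parameter left after the power of `d`
is factored out. -/
lemma green_kernel_eq {n : ℕ} (hn : 2 ≤ n) {g g' : Space n} (hne : g ≠ g') :
    ∫ h in Ioi (0 : ℝ), kernel n h g g'
      = Real.Gamma ((n : ℝ) / 2) / (4 * Real.pi ^ ((n : ℝ) / 2 + 1)) * (dK g g' ^ n)⁻¹ *
        ∫ t : ℝ, (1 + DK g g' ^ 2 / dK g g' ^ 2 * (Real.cosh t - 1)) ^ (-((n : ℝ) / 2)) := by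
  have hd := sqrt_sub_two_inner_pos hne
  have hD := sqrt_pos_of_ne hne
  rw [(green_kernel hn g g' hD hd).2]
  simp_rw [shiftedBase_rpow hd]
  rw [integral_const_mul, DK_eq_sqrt_sqrt, dK, Real.sq_sqrt hD.le, Real.sq_sqrt hd.le,
    Real.rpow_neg hd.le, Real.rpow_div_two_eq_sqrt _ hd.le, Real.rpow_natCast]
  ring

/-- The ratio `D² / d²` is at least `1/2`, since `|2 x · x'| ≤ R² ≤ D²`. -/
lemma half_le_DK_sq_div_dK_sq {n : ℕ} {g g' : Space n} (hne : g ≠ g') :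
    1 / 2 ≤ DK g g' ^ 2 / dK g g' ^ 2 := by
  have hd := sqrt_sub_two_inner_pos hne
  have hD := sqrt_pos_of_ne hne
  have h1 := (abs_le.1 (abs_two_inner_le g.1 g'.1)).1
  have h3 := le_sqrt_sq_add (Rsq g g') (s g g')
  rw [DK_eq_sqrt_sqrt, dK, Real.sq_sqrt hD.le, Real.sq_sqrt hd.le, div_le_div_iff₀ two_pos hd]
  unfold Rsq at *
  linarith

lemma rpow_mul_dK_div_DK {n : ℕ} (hn : 2 ≤ n) {g g' : Space n} (hne : g ≠ g') :
    (n : ℝ) ^ (-(1 / 2) : ℝ) * (dK g g' / DK g g')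
      = 1 / √(n * (DK g g' ^ 2 / dK g g' ^ 2)) := by
  have hd : 0 < dK g g' := Real.sqrt_pos.2 (sqrt_sub_two_inner_pos hne)
  have hD : 0 < DK g g' := by
    rw [DK_eq_sqrt_sqrt]; exact Real.sqrt_pos.2 (sqrt_pos_of_ne hne)
  have hn' : (0 : ℝ) < n := by exact_mod_cast (by omega : 0 < n)
  rw [Real.rpow_neg hn'.le, ← Real.sqrt_eq_rpow, ← div_pow, Real.sqrt_mul hn'.le,
    Real.sqrt_sq (by positivity)]
  have := Real.sqrt_pos.2 hn'
  field_simp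

end Grushin

theorem mainTheorem7 :
    ∃ A : ℝ, 1 < A ∧ ∀ n : ℕ, 2 ≤ n →
      (∃ p : ℝ → Grushin.Space n → Grushin.Space n → ℝ, Grushin.IsHeatKernel n p) ∧
      ∀ p : ℝ → Grushin.Space n → Grushin.Space n → ℝ, Grushin.IsHeatKernel n p →
        ∀ g g' : Grushin.Space n, g ≠ g' →
          IntegrableOn (fun h : ℝ => p h g g') (Ioi 0) ∧
          A⁻¹ ≤ Grushin.green p g g' /
              (Real.Gamma ((n : ℝ) / 2) / (4 * Real.pi ^ ((n : ℝ) / 2 + 1)) *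
                (Grushin.dK g g' ^ n)⁻¹ * (n : ℝ) ^ (-(1 / 2) : ℝ) *
                (Grushin.dK g g' / Grushin.DK g g')) ∧
          Grushin.green p g g' /
              (Real.Gamma ((n : ℝ) / 2) / (4 * Real.pi ^ ((n : ℝ) / 2 + 1)) *
                (Grushin.dK g g' ^ n)⁻¹ * (n : ℝ) ^ (-(1 / 2) : ℝ) *
                (Grushin.dK g g' / Grushin.DK g g')) ≤ A := by
  have hA : 1 < 2 * Real.pi := by linarith [Real.pi_gt_three]
  refine ⟨2 * Real.pi, hA, fun n hn => ⟨⟨Grushin.kernel n, Grushin.isHeatKernel_kernel hn⟩,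
    fun p hp g g' hne => ?_⟩⟩
  have hpk : ∀ h ∈ Ioi (0 : ℝ), p h g g' = Grushin.kernel n h g g' :=
    fun h hh => hp.eq_kernel hn hh g g'
  have hint := (Grushin.green_kernel hn g g' (Grushin.sqrt_pos_of_ne hne)
    (Grushin.sqrt_sub_two_inner_pos hne)).1
  have hκ := Grushin.half_le_DK_sq_div_dK_sq hne
  have hlow := Grushin.le_integral_one_add_mul_cosh_rpow hn hκ
  have hupp := Grushin.integral_one_add_mul_cosh_rpow_le hn (one_half_pos.trans_le hκ)
  have hd : 0 < Grushin.dK g g' := Real.sqrt_pos.2 (Grushin.sqrt_sub_two_inner_pos hne)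
  have hn' : (0 : ℝ) < n := by exact_mod_cast (by omega : 0 < n)
  have hc : 0 < Real.Gamma ((n : ℝ) / 2) / (4 * Real.pi ^ ((n : ℝ) / 2 + 1)) *
      (Grushin.dK g g' ^ n)⁻¹ := by
    have := Real.Gamma_pos_of_pos (half_pos hn')
    have := Real.pi_pos
    positivity
  -- the profile without its factor `Γ(n/2) / (4 π^(n/2+1)) d^(-n)`
  have hm : 0 < 1 / √(n * (Grushin.DK g g' ^ 2 / Grushin.dK g g' ^ 2)) :=
    one_div_pos.2 (Real.sqrt_pos.2 (mul_pos hn' (by linarith)))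
  refine ⟨(integrableOn_congr_fun hpk measurableSet_Ioi).2 hint, ?_⟩
  rw [Grushin.green, setIntegral_congr_fun measurableSet_Ioi hpk, Grushin.green_kernel_eq hn hne,
    mul_assoc _ ((n : ℝ) ^ _), Grushin.rpow_mul_dK_div_DK hn hne, mul_div_mul_left _ _ hc.ne']
  constructor
  · refine (inv_le_one_of_one_le₀ hA.le).trans ?_
    rwa [one_le_div hm]
  · rw [div_le_iff₀ hm]
    refine hupp.trans (le_of_eq ?_)
    ring
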